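/- **Hardness of PAC learning regular expressions under the uniform distribution.** *Regular expressions.* Plain regular expressions over $\{0,1\}$ are built from $\emptyset$, the empty word and the letters $0,1$ by union, concatenation and Kleene star. Expressions with counting may also use $R\mapsto R^{j}$ ($j\in\mathbb N$), with $L(R^j)=L(R)^j$. Sizes are $|\emptyset|=|\varepsilon|=|0|=|1|=1$, $|R_1\vee R_2|=|R_1|+|R_2|+1$, $|R_1R_2|=|R_1|+|R_2|$, $|R^\star|=|R|+1$ and, with counting, $|R^{j}|=|R|+\lceil\log_2 j\rceil$ (read as $|R|$ for $j=0$). An expression represents $c:\{0,1\}^n\to\{0,1\}$ if for all $x\in\{0,1\}^n$: $x\in L(R)\iff c(x)=1$. *Local-PRG assumption.* Let $\mathcal G_{n,m,k}$ be the distribution of sequences of $m$ independent uniformly random ordered $k$-tuples $E_1,\dots,E_m$ of distinct elements of $[n]$. For $P:\{0,1\}^k\to\{0,1\}$ and $G=(E_1,\dots,E_m)$ let $f_{P,G}(x)=(P(x|_{E_1}),\dots,P(x|_{E_m}))$ for $x\in\{0,1\}^n$ (Goldreich's generator). The assumption states: for every constant $s>1$ there are a constant $k$ and a predicate $P:\{0,1\}^k\to\{0,1\}$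 such that, with $m=\lfloor n^s\rfloor$, every probabilistic algorithm $A$ running in time polynomial in $n$ satisfies, for all sufficiently large $n$, $$\Bigl|\Pr_{G\sim\mathcal G_{n,m,k},\,x\sim\{0,1\}^n}[A(G,f_{P,G}(x))=1]-\Pr_{G\sim\mathcal G_{n,m,k},\,y\sim\{0,1\}^m}[A(G,y)=1]\Bigr|\le \tfrac13 .$$ *Weak learning.* Let $\gamma>0$. A concept class $(\mathcal C_n)_n$, $\mathcal C_n\subseteq\{0,1\}^{\{0,1\}^n}$, is tractably $\gamma$-weakly learnable on the uniform distribution if there are a probabilistic learning algorithm and a deterministic evaluation algorithm for hypothesis descriptions, both running in time polynomial in $n$ and $1/\delta$, such that for all $n$, all $\delta\in(0,1)$ and all $c\in\mathcal C_n$, given polynomially many (in $n$ and $1/\delta$) independent examples $(x,c(x))$ with $x$ uniform on $\{0,1\}^n$, the learner outputs, with probability at least $1-\delta$ over the examples and its internal randomness, a description of a hypothesis $h$ with $\Pr_{x\sim\{0,1\}^n}[h(x)\ne c(x)]\le\frac12-\gamma$. The hypothesis $h$ may be arbitrary, as long as the evaluation algorithm computes it from its description. **Theorem.** Under the local-PRG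 assumption: 1. For all constants $\epsilon,\gamma>0$, the class $\mathcal C_n$ of functions $\{0,1\}^n\to\{0,1\}$ represented by a plain regular expression of size at most $n^\epsilon$ is not tractably $\gamma$-weakly learnable on the uniform distribution. 2. There is a constant $K>0$ such that for every constant $\gamma>0$ the class of functions $\{0,1\}^n\to\{0,1\}$ represented by a star-free regular expression (union and concatenation only) of size at most $Kn$ is not tractably $\gamma$-weakly learnable on the uniform distribution. 3. For all constants $\epsilon,\gamma>0$, the class of functions $\{0,1\}^n\to\{0,1\}$ represented by a regular expression using only union, concatenation and counting (no Kleene star), of size at most $n^\epsilon$, is not tractably $\gamma$-weakly learnable on the uniform distribution. -/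

import Mathlib

namespace PACRE

/-! ### Algorithms: programs on bit-string registers, with a step count

A program works on registers `0, 1, 2, …`, each holding a finite bit string that is accessed as a
stack (only finitely many registers occur in a program). One step pushes or pops one bit, or looks
at the top bit of a register. This is a multi-stack machine in structured form, polynomially
equivalent to Turing machines. Randomised algorithms receive independent uniform coin tosses as
an additional input string of polynomial length. -/

/-- Programs. -/
inductive Prog : Type
  | skip : Prog
  | push (r : ℕ) (b : Bool) : Prog
  | pop (r : ℕ) : Prog
  | seq (c₁ c₂ : Prog) : Prog
  /-- Branch on the top of register `r`: empty register, top bit `false`, top bit `true`. -/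
  | branch (r : ℕ) (cEmpty cFalse cTrue : Prog) : Prog
  /-- While register `r` is non-empty, execute the body. -/
  | loop (r : ℕ) (body : Prog) : Prog

/-- The contents of all registers. -/
abbrev Store : Type := ℕ → List Bool

/-- `Exec c σ t σ'`: started in `σ`, the program `c` halts after exactly `t` steps in `σ'`. -/
inductive Exec : Prog → Store → ℕ → Store → Prop
  | skip (σ : Store) : Exec .skip σ 1 σ
  | push (σ : Store) (r : ℕ) (b : Bool) :
      Exec (.push r b) σ 1 (Function.update σ r (b :: σ r))
  | pop (σ : Store) (r : ℕ) :
      Exec (.pop r) σ 1 (Function.update σ r (σ r).tail)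
  | seq {c₁ c₂ : Prog} {σ σ₁ σ₂ : Store} {t₁ t₂ : ℕ} :
      Exec c₁ σ t₁ σ₁ → Exec c₂ σ₁ t₂ σ₂ → Exec (.seq c₁ c₂) σ (t₁ + t₂) σ₂
  | branch_empty {r : ℕ} {c₀ c₁ c₂ : Prog} {σ σ' : Store} {t : ℕ} :
      σ r = [] → Exec c₀ σ t σ' → Exec (.branch r c₀ c₁ c₂) σ (t + 1) σ'
  | branch_false {r : ℕ} {c₀ c₁ c₂ : Prog} {σ σ' : Store} {t : ℕ} :
      (σ r).head? = some false → Exec c₁ σ t σ' → Exec (.branch r c₀ c₁ c₂) σ (t + 1) σ'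
  | branch_true {r : ℕ} {c₀ c₁ c₂ : Prog} {σ σ' : Store} {t : ℕ} :
      (σ r).head? = some true → Exec c₂ σ t σ' → Exec (.branch r c₀ c₁ c₂) σ (t + 1) σ'
  | loop_done {r : ℕ} {c : Prog} {σ : Store} :
      σ r = [] → Exec (.loop r c) σ 1 σ
  | loop_step {r : ℕ} {c : Prog} {σ σ₁ σ₂ : Store} {t₁ t₂ : ℕ} :
      σ r ≠ [] → Exec c σ t₁ σ₁ → Exec (.loop r c) σ₁ t₂ σ₂ →
      Exec (.loop r c) σ (t₁ + t₂ + 1) σ₂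

/-- Programs are deterministic: running time and final store are unique. -/
theorem Exec.unique {c : Prog} {σ σ₁ σ₂ : Store} {t₁ t₂ : ℕ}
    (h₁ : Exec c σ t₁ σ₁) (h₂ : Exec c σ t₂ σ₂) : t₁ = t₂ ∧ σ₁ = σ₂ := by
  induction h₁ generalizing t₂ σ₂ with
  | skip => cases h₂; exact ⟨rfl, rfl⟩
  | push => cases h₂; exact ⟨rfl, rfl⟩
  | pop => cases h₂; exact ⟨rfl, rfl⟩
  | seq _ _ ih₁ ih₂ =>
    cases h₂ with
    | seq a b =>
      obtain ⟨rfl, rfl⟩ := ih₁ a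
      obtain ⟨rfl, rfl⟩ := ih₂ b
      exact ⟨rfl, rfl⟩
  | branch_empty h _ ih =>
    cases h₂ with
    | branch_empty _ a => obtain ⟨rfl, rfl⟩ := ih a; exact ⟨rfl, rfl⟩
    | branch_false h' _ => simp [h] at h'
    | branch_true h' _ => simp [h] at h'
  | branch_false h _ ih =>
    cases h₂ with
    | branch_empty h' _ => simp [h'] at h
    | branch_false _ a => obtain ⟨rfl, rfl⟩ := ih a; exact ⟨rfl, rfl⟩
    | branch_true h' _ => simp [h] at h'
  | branch_true h _ ih =>
    cases h₂ with
    | branch_empty h' _ => simp [h'] at h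
    | branch_false h' _ => simp [h] at h'
    | branch_true _ a => obtain ⟨rfl, rfl⟩ := ih a; exact ⟨rfl, rfl⟩
  | loop_done h =>
    cases h₂ with
    | loop_done => exact ⟨rfl, rfl⟩
    | loop_step h' => exact absurd h h'
  | loop_step h _ _ ih₁ ih₂ =>
    cases h₂ with
    | loop_done h' => exact absurd h' h
    | loop_step _ a b =>
      obtain ⟨rfl, rfl⟩ := ih₁ a
      obtain ⟨rfl, rfl⟩ := ih₂ b
      exact ⟨rfl, rfl⟩

/-- The initial store: the inputs in registers `0, 1, …`, all other registers empty. -/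
def initStore (inputs : List (List Bool)) : Store := fun i => inputs.getD i []

/-- On the given inputs the program halts within `T` steps. -/
def HaltsWithin (c : Prog) (inputs : List (List Bool)) (T : ℕ) : Prop :=
  ∃ t ≤ T, ∃ σ, Exec c (initStore inputs) t σ

/-- On the given inputs the program halts within `T` steps, with `out` in register `0`. -/
def OutputsWithin (c : Prog) (inputs : List (List Bool)) (T : ℕ) (out : List Bool) : Prop :=
  ∃ t ≤ T, ∃ σ, Exec c (initStore inputs) t σ ∧ σ 0 = out

/-- The number `n` in unary. -/
def unary (n : ℕ) : List Bool := List.replicate n true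

/-- The `w` lowest binary digits of `v`, the lowest one first. -/
def binary (w v : ℕ) : List Bool := List.ofFn fun i : Fin w => v.testBit i

/-- The probability of an event under the uniform distribution on a finite nonempty set. -/
noncomputable def prob {Ω : Type} [Fintype Ω] (p : Ω → Prop) : ℝ :=
  (Nat.card {ω : Ω // p ω} : ℝ) / (Fintype.card Ω : ℝ)

/-! ### Goldreich's pseudorandom generator -/

/-- Hypergraphs on `n` vertices with `m` ordered hyperedges, each consisting of `k` distinct
vertices. A uniform element of this type has independent uniform hyperedges. -/
abbrev Hypergraph (n m k : ℕ) : Type := Fin m → (Fin k ↪ Fin n)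

/-- Goldreich's generator with predicate `P` and hypergraph `G`. -/
def goldreich {n m k : ℕ} (P : (Fin k → Bool) → Bool) (G : Hypergraph n m k)
    (x : Fin n → Bool) : Fin m → Bool :=
  fun j => P fun i => x (G j i)

/-- A hypergraph as a bit string: all vertices of all hyperedges in order, each of them in binary
with `⌈log₂ n⌉` digits. -/
def encodeHypergraph {n m k : ℕ} (G : Hypergraph n m k) : List Bool :=
  (List.ofFn fun j => (List.ofFn fun i => binary (Nat.clog 2 n) (G j i)).flatten).flatten

/-- A candidate distinguisher: a program, with the number of coin tosses it is given and its time
bound, both polynomials in `n`. -/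
structure Distinguisher where
  prog : Prog
  coins : Polynomial ℕ
  time : Polynomial ℕ

/-- The input of a distinguisher: `n` in unary, the hypergraph, the string to be judged, and the
coin tosses. -/
def distInput {n m k q : ℕ} (G : Hypergraph n m k) (y : Fin m → Bool) (r : Fin q → Bool) :
    List (List Bool) :=
  [unary n, encodeHypergraph G, List.ofFn y, List.ofFn r]

/-- `A` runs in polynomial time on all inputs made of a hypergraph with `m n` hyperedges of
cardinality `k` and a string of length `m n`. -/
def Distinguisher.PolyTime (A : Distinguisher) (k : ℕ) (m : ℕ → ℕ) : Prop :=
  ∀ (n : ℕ) (G : Hypergraph n (m n) k) (y : Fin (m n) → Bool) (r : Fin (A.coins.eval n) → Bool),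
    HaltsWithin A.prog (distInput G y r) (A.time.eval n)

/-- `A` outputs `1`. -/
def Distinguisher.Accepts (A : Distinguisher) {n m k : ℕ} (G : Hypergraph n m k)
    (y : Fin m → Bool) (r : Fin (A.coins.eval n) → Bool) : Prop :=
  OutputsWithin A.prog (distInput G y r) (A.time.eval n) [true]

/-- The probability that `A` outputs `1` on a pseudorandom string. -/
noncomputable def Distinguisher.probPseudo (A : Distinguisher) {k : ℕ}
    (P : (Fin k → Bool) → Bool) (n m : ℕ) : ℝ :=
  prob fun ω : Hypergraph n m k × (Fin n → Bool) × (Fin (A.coins.eval n) → Bool) =>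
    A.Accepts ω.1 (goldreich P ω.1 ω.2.1) ω.2.2

/-- The probability that `A` outputs `1` on a random string. -/
noncomputable def Distinguisher.probRandom (A : Distinguisher) (k n m : ℕ) : ℝ :=
  prob fun ω : Hypergraph n m k × (Fin m → Bool) × (Fin (A.coins.eval n) → Bool) =>
    A.Accepts ω.1 ω.2.1 ω.2.2

/-- With `m n` output bits, the family of Goldreich generators with predicate `P` is an
`ε`-pseudorandom generator: every probabilistic polynomial-time algorithm has distinguishing
advantage at most `ε`, for all sufficiently large `n`. -/
def IsPRG (ε : ℝ) {k : ℕ} (P : (Fin k → Bool) → Bool) (m : ℕ → ℕ) : Prop :=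
  ∀ A : Distinguisher, A.PolyTime k m →
    ∀ᶠ n in Filter.atTop, |A.probPseudo P n (m n) - A.probRandom k n (m n)| ≤ ε

/-- The local-PRG assumption. -/
def LocalPRGAssumption : Prop :=
  ∀ s : ℝ, 1 < s → ∃ (k : ℕ) (P : (Fin k → Bool) → Bool),
    IsPRG (1 / 3) P fun n => ⌊(n : ℝ) ^ s⌋₊

/-! ### Weak learning under the uniform distribution -/

/-- A learning algorithm: the program `learn` computes (the description of) a hypothesis, the
program `predict` evaluates a described hypothesis at a point. The numbers of examples and of coin
tosses given to `learn`, and the time bound for both programs, are polynomials in `n + d`, where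
`d = ⌈1 / δ⌉` comes from the confidence parameter. -/
structure Learner where
  learn : Prog
  predict : Prog
  examples : Polynomial ℕ
  coins : Polynomial ℕ
  time : Polynomial ℕ

/-- A labelled sample as a bit string: each point is followed by its label. -/
def encodeSample {n m : ℕ} (c : (Fin n → Bool) → Bool) (xs : Fin m → Fin n → Bool) : List Bool :=
  (List.ofFn fun j => List.ofFn (xs j) ++ [c (xs j)]).flatten

/-- The input of a learner: `n` and `d` in unary, a sample labelled by `c`, and the coin tosses. -/
def learnInput {n m q : ℕ} (d : ℕ) (c : (Fin n → Bool) → Bool) (xs : Fin m → Fin n → Bool)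
    (r : Fin q → Bool) : List (List Bool) :=
  [unary n, unary d, encodeSample c xs, List.ofFn r]

/-- The error, under the uniform distribution, of the hypothesis with description `h`. A point at
which the hypothesis is not evaluated within the time bound counts as an error. -/
noncomputable def Learner.error (L : Learner) {n : ℕ} (d : ℕ) (c : (Fin n → Bool) → Bool)
    (h : List Bool) : ℝ :=
  prob fun x : Fin n → Bool =>
    ¬ OutputsWithin L.predict [h, List.ofFn x] (L.time.eval (n + d)) [c x]

/-- `L` is a polynomial-time algorithm that `γ`-weakly learns the concept class `C` on the uniform
distribution: for all `n`, all `δ ∈ (0, 1)` and all `c ∈ C n`, with probability at least `1 - δ`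
over the independent uniform examples and the coin tosses, `L` outputs within its time bound a
hypothesis of error at most `1 / 2 - γ`. (To exceed the time bound counts as failure, so learners
that always respect it are a special case.) -/
def Learner.WeaklyLearns (L : Learner) (γ : ℝ) (C : ∀ n : ℕ, Set ((Fin n → Bool) → Bool)) : Prop :=
  ∀ (n : ℕ) (δ : ℝ), 0 < δ → δ < 1 → ∀ c ∈ C n,
    1 - δ ≤
      prob fun ω : (Fin (L.examples.eval (n + ⌈1 / δ⌉₊)) → Fin n → Bool) ×
          (Fin (L.coins.eval (n + ⌈1 / δ⌉₊)) → Bool) =>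
        ∃ h : List Bool,
          OutputsWithin L.learn (learnInput ⌈1 / δ⌉₊ c ω.1 ω.2) (L.time.eval (n + ⌈1 / δ⌉₊)) h ∧
          L.error ⌈1 / δ⌉₊ c h ≤ 1 / 2 - γ

/-! ### Regular expressions and their sizes -/

/-- The size of a plain regular expression. -/
def reSize : RegularExpression Bool → ℕ
  | .zero => 1
  | .epsilon => 1
  | .char _ => 1
  | .plus R₁ R₂ => reSize R₁ + reSize R₂ + 1
  | .comp R₁ R₂ => reSize R₁ + reSize R₂
  | .star R => reSize R + 1

/-- The expression does not use the Kleene star. -/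
def REStarFree : RegularExpression Bool → Prop
  | .zero => True
  | .epsilon => True
  | .char _ => True
  | .plus R₁ R₂ => REStarFree R₁ ∧ REStarFree R₂
  | .comp R₁ R₂ => REStarFree R₁ ∧ REStarFree R₂
  | .star _ => False

/-- Regular expressions over `{0, 1}` with the counting operator `R ↦ R ^ k`. -/
inductive CountRE : Type
  | zero : CountRE
  | epsilon : CountRE
  | char (a : Bool) : CountRE
  | plus (R₁ R₂ : CountRE) : CountRE
  | comp (R₁ R₂ : CountRE) : CountRE
  | star (R : CountRE) : CountRE
  | count (R : CountRE) (k : ℕ) : CountRE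

/-- The language of a counting regular expression. -/
def CountRE.lang : CountRE → Language Bool
  | .zero => 0
  | .epsilon => 1
  | .char a => {[a]}
  | .plus R₁ R₂ => R₁.lang + R₂.lang
  | .comp R₁ R₂ => R₁.lang * R₂.lang
  | .star R => KStar.kstar R.lang
  | .count R k => R.lang ^ k

/-- The size of a counting regular expression; exponents are written in binary and contribute
`⌈log₂ k⌉`. -/
def CountRE.size : CountRE → ℕ
  | .zero => 1
  | .epsilon => 1
  | .char _ => 1
  | .plus R₁ R₂ => R₁.size + R₂.size + 1
  | .comp R₁ R₂ => R₁.size + R₂.size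
  | .star R => R.size + 1
  | .count R k => R.size + Nat.clog 2 k

/-- The counting expression does not use the Kleene star. -/
def CountRE.StarFree : CountRE → Prop
  | .zero => True
  | .epsilon => True
  | .char _ => True
  | .plus R₁ R₂ => R₁.StarFree ∧ R₂.StarFree
  | .comp R₁ R₂ => R₁.StarFree ∧ R₂.StarFree
  | .star _ => False
  | .count R _ => R.StarFree

/-- The language `A` represents the function `c` on strings of length `n`. -/
def Represents (A : Language Bool) {n : ℕ} (c : (Fin n → Bool) → Bool) : Prop :=
  ∀ x : Fin n → Bool, List.ofFn x ∈ A ↔ c x = true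

/-- Functions on `{0, 1}ⁿ` representable by a plain regular expression of size at most `B n`. -/
def plainClass (B : ℕ → ℝ) (n : ℕ) : Set ((Fin n → Bool) → Bool) :=
  {c | ∃ R : RegularExpression Bool, (reSize R : ℝ) ≤ B n ∧ Represents R.matches' c}

/-- The same with expressions that use only union and concatenation. -/
def starFreeClass (B : ℕ → ℝ) (n : ℕ) : Set ((Fin n → Bool) → Bool) :=
  {c | ∃ R : RegularExpression Bool,
    REStarFree R ∧ (reSize R : ℝ) ≤ B n ∧ Represents R.matches' c}

/-- The same with expressions that use only union, concatenation and counting. -/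
def starFreeCountClass (B : ℕ → ℝ) (n : ℕ) : Set ((Fin n → Bool) → Bool) :=
  {c | ∃ R : CountRE, R.StarFree ∧ (R.size : ℝ) ≤ B n ∧ Represents R.lang c}

end PACRE

/-! A weak learner would break Goldreich's generator. Put N = 2 ^ b and n = N ^ e, and read the
first k * b bits of a word of length n as a k-tuple of vertices, the remaining bits being padding.
For a seed x, `concept` applies P to the labels that x gives to the vertices of the tuple, and is
true on tuples with a repeated vertex. A hyperedge together with the corresponding output bit of the
generator is then a labelled example, but its tuple never has a repetition. To obtain exactly
uniform examples, a uniform word w is drawn and its tuple is replaced by the hyperedge only if it is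
free of repetitions. Otherwise w is kept with label true, which needs no knowledge of x. The
replacement is one component of an involution (`swapTuple_involutive`), hence preserves the uniform
distribution.

The distinguisher trains the learner on q such examples with δ = 1/10, tests the hypothesis on M
further ones and accepts if there are at most θ errors, where θ is about (1/2 - γ/2) * M. On a
pseudorandom string this is exactly the learning experiment, and acceptance has probability at least
17/20 (`errs_pseudo`, `prob_pseudo_le`). On a random string the test labels are fresh coin tosses
unless some test tuple has a repetition, which has probability at most M * k ^ 2 / N; acceptance
then has probability at most 1/10 (`prob_random_le`). The advantage of at least 3/4 contradicts the
assumption in `not_weaklyLearns`; the stretch of the generator is chosen large enough to supply q +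
M output bits.

The tuples accepted by a concept form a union of at most 2 ^ k + k * k * N boxes: one for each
accepting assignment of P, one for each way in which a vertex can be repeated
(`exists_mem_conceptBoxes`). This gives a star-free expression of size at most N ^ 4 for large b.
The padding is matched by a star, by a sequence of wildcards or by one counting operator. A large e
makes the size at most n ^ ε; with e = 5 the wildcards dominate and the size is linear in n.

The remaining work is to realise the distinguisher as a `Prog` that halts in polynomial time on
every input, although the learner is only known to succeed with high probability and may run forever
otherwise. Hence arbitrary programs are run against a clock (`RExec.clocked`,
`RProg.clocked_halts`), and polynomial-time blocks are composed through the relation `Reach`, up to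
`DistParams.exists_prog`. -/

namespace PACRE

/-! ### Programs over an arbitrary register type -/

/-- Programs whose registers are indexed by an arbitrary type. -/
inductive RProg (ι : Type) : Type
  | skip : RProg ι
  | push (r : ι) (b : Bool) : RProg ι
  | pop (r : ι) : RProg ι
  | seq (c₁ c₂ : RProg ι) : RProg ι
  | branch (r : ι) (cEmpty cFalse cTrue : RProg ι) : RProg ι
  | loop (r : ι) (body : RProg ι) : RProg ι

/-- The operational semantics of `RProg`, with step count. -/
inductive RExec {ι : Type} [DecidableEq ι] :
    RProg ι → (ι → List Bool) → ℕ → (ι → List Bool) → Prop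
  | skip (σ) : RExec .skip σ 1 σ
  | push (σ) (r : ι) (b : Bool) : RExec (.push r b) σ 1 (Function.update σ r (b :: σ r))
  | pop (σ) (r : ι) : RExec (.pop r) σ 1 (Function.update σ r (σ r).tail)
  | seq {c₁ c₂ σ σ₁ σ₂ t₁ t₂} :
      RExec c₁ σ t₁ σ₁ → RExec c₂ σ₁ t₂ σ₂ → RExec (.seq c₁ c₂) σ (t₁ + t₂) σ₂
  | branch_empty {r c₀ c₁ c₂ σ σ' t} :
      σ r = [] → RExec c₀ σ t σ' → RExec (.branch r c₀ c₁ c₂) σ (t + 1) σ'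
  | branch_false {r c₀ c₁ c₂ σ σ' t} :
      (σ r).head? = some false → RExec c₁ σ t σ' → RExec (.branch r c₀ c₁ c₂) σ (t + 1) σ'
  | branch_true {r c₀ c₁ c₂ σ σ' t} :
      (σ r).head? = some true → RExec c₂ σ t σ' → RExec (.branch r c₀ c₁ c₂) σ (t + 1) σ'
  | loop_done {r c σ} : σ r = [] → RExec (.loop r c) σ 1 σ
  | loop_step {r c σ σ₁ σ₂ t₁ t₂} :
      σ r ≠ [] → RExec c σ t₁ σ₁ → RExec (.loop r c) σ₁ t₂ σ₂ →
      RExec (.loop r c) σ (t₁ + t₂ + 1) σ₂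

/-- A program over registers `ℕ`, as an instance of the generic type. -/
def RProg.ofProg : Prog → RProg ℕ
  | .skip => .skip
  | .push r b => .push r b
  | .pop r => .pop r
  | .seq a b => .seq (ofProg a) (ofProg b)
  | .branch r a b c => .branch r (ofProg a) (ofProg b) (ofProg c)
  | .loop r a => .loop r (ofProg a)

theorem RExec.ofProg {c : Prog} {σ σ' : Store} {t : ℕ} (h : Exec c σ t σ') :
    RExec (RProg.ofProg c) σ t σ' := by
  induction h with
  | skip => exact .skip _
  | push => exact .push _ _ _
  | pop => exact .pop _ _
  | seq _ _ h₁ h₂ => exact .seq h₁ h₂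
  | branch_empty h _ ih => exact .branch_empty h ih
  | branch_false h _ ih => exact .branch_false h ih
  | branch_true h _ ih => exact .branch_true h ih
  | loop_done h => exact .loop_done h
  | loop_step h _ _ h₁ h₂ => exact .loop_step h h₁ h₂

/-- Compile a generic program to registers in `ℕ`. -/
def RProg.toProg {ι : Type} (f : ι → ℕ) : RProg ι → Prog
  | .skip => .skip
  | .push r b => .push (f r) b
  | .pop r => .pop (f r)
  | .seq a b => .seq (a.toProg f) (b.toProg f)
  | .branch r a b c => .branch (f r) (a.toProg f) (b.toProg f) (c.toProg f)
  | .loop r a => .loop (f r) (a.toProg f)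

/-- Rename the registers of a program. -/
def RProg.map {ι κ : Type} (f : ι → κ) : RProg ι → RProg κ
  | .skip => .skip
  | .push r b => .push (f r) b
  | .pop r => .pop (f r)
  | .seq a b => .seq (a.map f) (b.map f)
  | .branch r a b c => .branch (f r) (a.map f) (b.map f) (c.map f)
  | .loop r a => .loop (f r) (a.map f)

section
variable {ι : Type} [DecidableEq ι]

theorem update_comp_inj {κ : Type} [DecidableEq κ] {f : ι → κ} (hf : Function.Injective f) (τ : κ → List Bool) (r : ι)
    (l : List Bool) : Function.update τ (f r) l ∘ f = Function.update (τ ∘ f) r l := by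
  funext x
  by_cases h : x = r
  · subst h; simp
  · simp [h, hf.eq_iff]

/-- The simulation relation is that the store read through f is the abstract store. Injectivity of f
keeps a write to one register from showing up in another. -/
theorem RExec.toProg {f : ι → ℕ} (hf : Function.Injective f) {c : RProg ι}
    {σ σ' : ι → List Bool} {t : ℕ} (h : RExec c σ t σ') :
    ∀ τ : Store, τ ∘ f = σ → ∃ τ' : Store, Exec (c.toProg f) τ t τ' ∧ τ' ∘ f = σ' := by
  induction h with
  | skip => intro τ e; exact ⟨τ, .skip _, e⟩
  | push σ r b =>
    rintro τ rfl
    exact ⟨_, .push _ _ _, by simp [update_comp_inj hf]⟩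
  | pop σ r =>
    rintro τ rfl
    exact ⟨_, .pop _ _, by simp [update_comp_inj hf]⟩
  | seq _ _ h₁ h₂ =>
    intro τ e
    obtain ⟨τ₁, x₁, e₁⟩ := h₁ τ e
    obtain ⟨τ₂, x₂, e₂⟩ := h₂ τ₁ e₁
    exact ⟨τ₂, .seq x₁ x₂, e₂⟩
  | branch_empty h _ ih =>
    rintro τ rfl
    obtain ⟨τ₁, x₁, e₁⟩ := ih τ rfl
    exact ⟨τ₁, .branch_empty h x₁, e₁⟩
  | branch_false h _ ih =>
    rintro τ rfl
    obtain ⟨τ₁, x₁, e₁⟩ := ih τ rfl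
    exact ⟨τ₁, .branch_false h x₁, e₁⟩
  | branch_true h _ ih =>
    rintro τ rfl
    obtain ⟨τ₁, x₁, e₁⟩ := ih τ rfl
    exact ⟨τ₁, .branch_true h x₁, e₁⟩
  | loop_done h => rintro τ rfl; exact ⟨τ, .loop_done h, rfl⟩
  | loop_step h _ _ h₁ h₂ =>
    rintro τ rfl
    obtain ⟨τ₁, x₁, e₁⟩ := h₁ τ rfl
    obtain ⟨τ₂, x₂, e₂⟩ := h₂ τ₁ e₁
    exact ⟨τ₂, .loop_step h x₁ x₂, e₂⟩

/-- The frame condition on registers outside the range of f is what allows a foreign program to be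
embedded as a subroutine in a bank of its own. -/
theorem RExec.map {κ : Type} [DecidableEq κ] {f : ι → κ} (hf : Function.Injective f) {c : RProg ι}
    {σ σ' : ι → List Bool} {t : ℕ} (h : RExec c σ t σ') :
    ∀ τ : κ → List Bool, τ ∘ f = σ →
      ∃ τ', RExec (c.map f) τ t τ' ∧ τ' ∘ f = σ' ∧ ∀ r ∉ Set.range f, τ' r = τ r := by
  induction h with
  | skip => intro τ e; exact ⟨τ, .skip _, e, fun _ _ => rfl⟩
  | push σ r b =>
    rintro τ rfl
    refine ⟨_, .push _ _ _, by simp [update_comp_inj hf], fun x hx => ?_⟩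
    rw [Function.update_of_ne]; rintro rfl; exact hx ⟨r, rfl⟩
  | pop σ r =>
    rintro τ rfl
    refine ⟨_, .pop _ _, by simp [update_comp_inj hf], fun x hx => ?_⟩
    rw [Function.update_of_ne]; rintro rfl; exact hx ⟨r, rfl⟩
  | seq _ _ h₁ h₂ =>
    intro τ e
    obtain ⟨τ₁, x₁, e₁, f₁⟩ := h₁ τ e
    obtain ⟨τ₂, x₂, e₂, f₂⟩ := h₂ τ₁ e₁
    exact ⟨τ₂, .seq x₁ x₂, e₂, fun r hr => (f₂ r hr).trans (f₁ r hr)⟩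
  | branch_empty h _ ih =>
    rintro τ rfl
    obtain ⟨τ₁, x₁, e₁, f₁⟩ := ih τ rfl
    exact ⟨τ₁, .branch_empty h x₁, e₁, f₁⟩
  | branch_false h _ ih =>
    rintro τ rfl
    obtain ⟨τ₁, x₁, e₁, f₁⟩ := ih τ rfl
    exact ⟨τ₁, .branch_false h x₁, e₁, f₁⟩
  | branch_true h _ ih =>
    rintro τ rfl
    obtain ⟨τ₁, x₁, e₁, f₁⟩ := ih τ rfl
    exact ⟨τ₁, .branch_true h x₁, e₁, f₁⟩
  | loop_done h => rintro τ rfl; exact ⟨τ, .loop_done h, rfl, fun _ _ => rfl⟩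
  | loop_step h _ _ h₁ h₂ =>
    rintro τ rfl
    obtain ⟨τ₁, x₁, e₁, f₁⟩ := h₁ τ rfl
    obtain ⟨τ₂, x₂, e₂, f₂⟩ := h₂ τ₁ e₁
    exact ⟨τ₂, .loop_step h x₁ x₂, e₂, fun r hr => (f₂ r hr).trans (f₁ r hr)⟩

/-! ### Running a program against a clock -/

/-- The clocked version of a program: every loop iteration consumes one symbol of the clock
register `inr 0`, and all loops are left when the clock is empty. The register `inr (d + 1)` is the
flag that keeps a loop of nesting depth `d` going. -/
def RProg.clocked : RProg ι → ℕ → RProg (ι ⊕ ℕ)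
  | .skip, _ => .skip
  | .push r b, _ => .push (.inl r) b
  | .pop r, _ => .pop (.inl r)
  | .seq a b, d => .seq (a.clocked d) (b.clocked d)
  | .branch r a b c, d => .branch (.inl r) (a.clocked d) (b.clocked d) (c.clocked d)
  | .loop r a, d =>
    let body := RProg.seq (.pop (.inr 0))
      (.branch (.inl r) (.pop (.inr (d + 1))) (a.clocked (d + 1)) (a.clocked (d + 1)))
    .seq (.push (.inr (d + 1)) true)
      (.loop (.inr (d + 1)) (.branch (.inr 0) (.pop (.inr (d + 1))) body body))

theorem RExec.branch_same {r : ι} {c₀ c : RProg ι} {σ σ' : ι → List Bool} {t : ℕ}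
    (hr : σ r ≠ []) (h : RExec c σ t σ') : RExec (.branch r c₀ c c) σ (t + 1) σ' := by
  rcases hl : σ r with _ | ⟨b, l⟩
  · exact absurd hl hr
  · cases b
    · exact .branch_false (by simp [hl]) h
    · exact .branch_true (by simp [hl]) h

/-- A clocked program whose running time does not exceed the clock simulates the program. -/
theorem RExec.clocked {c : RProg ι} {σ σ' : ι → List Bool} {t : ℕ} (h : RExec c σ t σ') :
    ∀ (d : ℕ) (τ : ι ⊕ ℕ → List Bool), τ ∘ Sum.inl = σ → t ≤ (τ (.inr 0)).length →
      (∀ e, d < e → τ (.inr e) = []) →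
      ∃ T τ', RExec (c.clocked d) τ T τ' ∧ τ' ∘ Sum.inl = σ' ∧
        (τ (.inr 0)).length ≤ (τ' (.inr 0)).length + t ∧
        ∀ e, 0 < e → τ' (.inr e) = τ (.inr e) := by
  induction h with
  | skip => intro d τ e _ _; exact ⟨_, τ, .skip _, e, by omega, fun _ _ => rfl⟩
  | push σ r b =>
    rintro d τ rfl _ _
    exact ⟨_, _, .push _ _ _, by simp [update_comp_inj Sum.inl_injective], by simp,
      fun _ _ => by simp⟩
  | pop σ r =>
    rintro d τ rfl _ _
    exact ⟨_, _, .pop _ _, by simp [update_comp_inj Sum.inl_injective], by simp,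
      fun _ _ => by simp⟩
  | seq _ _ h₁ h₂ =>
    intro d τ e ht hf
    obtain ⟨T₁, τ₁, x₁, e₁, l₁, f₁⟩ := h₁ d τ e (by omega) hf
    obtain ⟨T₂, τ₂, x₂, e₂, l₂, f₂⟩ := h₂ d τ₁ e₁ (by omega)
      fun e he => (f₁ e (by omega)).trans (hf e he)
    exact ⟨_, τ₂, .seq x₁ x₂, e₂, by omega, fun r hr => (f₂ r hr).trans (f₁ r hr)⟩
  | branch_empty h _ ih =>
    rintro d τ rfl ht hf
    obtain ⟨T₁, τ₁, x₁, e₁, l₁, f₁⟩ := ih d τ rfl (by omega) hf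
    exact ⟨_, τ₁, .branch_empty h x₁, e₁, by omega, f₁⟩
  | branch_false h _ ih =>
    rintro d τ rfl ht hf
    obtain ⟨T₁, τ₁, x₁, e₁, l₁, f₁⟩ := ih d τ rfl (by omega) hf
    exact ⟨_, τ₁, .branch_false h x₁, e₁, by omega, f₁⟩
  | branch_true h _ ih =>
    rintro d τ rfl ht hf
    obtain ⟨T₁, τ₁, x₁, e₁, l₁, f₁⟩ := ih d τ rfl (by omega) hf
    exact ⟨_, τ₁, .branch_true h x₁, e₁, by omega, f₁⟩
  -- Leaving a loop also costs one clock symbol, since the guard is inspected only after the pop;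
  -- the single step of the original run pays for it.
  | @loop_done r c σ h =>
    rintro d τ rfl ht hf
    have hf' := hf (d + 1) (by omega)
    refine ⟨_, _, .seq (.push _ _ _) (.loop_step (by simp) (.branch_same ?_
      (.seq (.pop _ _) (.branch_empty ?_ (.pop _ _)))) (.loop_done ?_)), ?_, ?_, ?_⟩
    · intro h0; simp at h0; simp [h0] at ht
    · simpa using h
    · simp [hf']
    · funext x; simp
    · simp; omega
    · intro e he
      rcases eq_or_ne e (d + 1) with rfl | hne
      · simp [hf']
      · simp [hne, he.ne']
  | @loop_step r c σ σ₁ σ₂ t₁ t₂ h _ _ h₁ h₂ =>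
    rintro d τ rfl ht hf
    have hf' := hf (d + 1) (by omega)
    set τ₀ := Function.update (Function.update τ (.inr (d + 1)) [true]) (.inr 0)
      (τ (.inr 0)).tail with hτ₀
    obtain ⟨T₁, τ₁, x₁, e₁, l₁, f₁⟩ := h₁ (d + 1) τ₀ (by funext x; simp [hτ₀])
      (by simp [hτ₀]; omega)
      (fun e he => by
        have : e ≠ 0 := by omega
        have : e ≠ d + 1 := by omega
        simp [*]; exact hf e (by omega))
    have g₁ : τ₁ (.inr (d + 1)) = [true] := by rw [f₁ _ (by omega)]; simp [hτ₀]
    have l₁' : (τ (.inr 0)).length ≤ (τ₁ (.inr 0)).length + t₁ + 1 := by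
      have : (τ₀ (.inr 0)).length = (τ (.inr 0)).length - 1 := by simp [hτ₀]
      omega
    -- The induction hypothesis concerns a complete clocked loop, including the initial push of the
    -- flag. It is therefore applied to the store with the flag cleared; inverting the sequence
    -- below removes the push and gives back τ₁.
    obtain ⟨T₂, τ₂, x₂, e₂, l₂, f₂⟩ := h₂ d (Function.update τ₁ (.inr (d + 1)) [])
      (by rw [← e₁]; funext x; simp) (by simp; omega)
      (fun e he => by
        rcases eq_or_ne e (d + 1) with rfl | hne
        · simp
        · have : e ≠ 0 := by omega
          simp [hne]; rw [f₁ e (by omega)]; simp [hτ₀, hne, this]; exact hf e he)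
    cases x₂ with
    | seq p q =>
      cases p
      simp only [Function.update_self, Function.update_idem] at q
      rw [← g₁, Function.update_eq_self] at q
      refine ⟨_, τ₂, .seq (.push _ _ _) (.loop_step (by simp) (.branch_same ?_
        (.seq (.pop _ _) (.branch_same ?_ (by
          simpa [hf', ← hτ₀] using x₁)))) q), e₂, ?_, ?_⟩
      · intro h0; simp at h0; simp [h0] at ht
      · simpa using h
      · simp at l₂; omega
      · intro e he
        rw [f₂ e he]
        rcases eq_or_ne e (d + 1) with rfl | hne
        · simp [hf']
        · simp [hne]; rw [f₁ e he]; simp [hτ₀, hne, he.ne']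

/-- A clocked program halts within a time that is linear in the clock. -/
theorem RProg.clocked_halts (c : RProg ι) : ∃ A : ℕ, ∀ (d : ℕ) (τ : ι ⊕ ℕ → List Bool),
    (∀ e, d < e → τ (.inr e) = []) →
    ∃ T x τ', RExec (c.clocked d) τ T τ' ∧ (τ' (.inr 0)).length + x = (τ (.inr 0)).length ∧
      T ≤ A * (1 + x) ∧ ∀ e, 0 < e → τ' (.inr e) = τ (.inr e) := by
  induction c with
  | skip => exact ⟨1, fun d τ _ => ⟨_, 0, _, .skip _, rfl, le_rfl, fun _ _ => rfl⟩⟩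
  | push r b =>
    exact ⟨1, fun d τ _ => ⟨_, 0, _, .push _ _ _, by simp, le_rfl, fun _ _ => by simp⟩⟩
  | pop r => exact ⟨1, fun d τ _ => ⟨_, 0, _, .pop _ _, by simp, le_rfl, fun _ _ => by simp⟩⟩
  | seq a b iha ihb =>
    obtain ⟨A, ha⟩ := iha
    obtain ⟨B, hb⟩ := ihb
    refine ⟨A + B, fun d τ hf => ?_⟩
    obtain ⟨T₁, x₁, τ₁, e₁, l₁, t₁, f₁⟩ := ha d τ hf
    obtain ⟨T₂, x₂, τ₂, e₂, l₂, t₂, f₂⟩ := hb d τ₁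
      fun e he => (f₁ e (by omega)).trans (hf e he)
    refine ⟨_, x₁ + x₂, τ₂, .seq e₁ e₂, by omega, ?_, fun r hr => (f₂ r hr).trans (f₁ r hr)⟩
    nlinarith [Nat.zero_le (A * x₂), Nat.zero_le (B * x₁)]
  | branch r a b c iha ihb ihc =>
    obtain ⟨A, ha⟩ := iha
    obtain ⟨B, hb⟩ := ihb
    obtain ⟨C, hc⟩ := ihc
    refine ⟨A + B + C + 1, fun d τ hf => ?_⟩
    rcases hl : τ (.inl r) with _ | ⟨_ | _, l⟩
    · obtain ⟨T₁, x₁, τ₁, e₁, l₁, t₁, f₁⟩ := ha d τ hf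
      exact ⟨_, x₁, τ₁, .branch_empty hl e₁, l₁, by nlinarith, f₁⟩
    · obtain ⟨T₁, x₁, τ₁, e₁, l₁, t₁, f₁⟩ := hb d τ hf
      exact ⟨_, x₁, τ₁, .branch_false (by simp [hl]) e₁, l₁, by nlinarith, f₁⟩
    · obtain ⟨T₁, x₁, τ₁, e₁, l₁, t₁, f₁⟩ := hc d τ hf
      exact ⟨_, x₁, τ₁, .branch_true (by simp [hl]) e₁, l₁, by nlinarith, f₁⟩
  | loop r a ih =>
    obtain ⟨A, ha⟩ := ih
    -- Induction on a bound N for the clock. Every iteration entered with a nonempty clock consumes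
    -- a symbol, and the time is charged to the consumed symbols x; the extra 8 pays for the
    -- bookkeeping of an iteration.
    have key : ∀ (d N : ℕ) (τ : ι ⊕ ℕ → List Bool), (τ (.inr 0)).length ≤ N →
        τ (.inr (d + 1)) = [true] → (∀ e, d + 1 < e → τ (.inr e) = []) →
        ∃ T x τ', RExec (.loop (.inr (d + 1)) (.branch (.inr 0) (.pop (.inr (d + 1)))
            (.seq (.pop (.inr 0)) (.branch (.inl r) (.pop (.inr (d + 1)))
              (a.clocked (d + 1)) (a.clocked (d + 1))))
            (.seq (.pop (.inr 0)) (.branch (.inl r) (.pop (.inr (d + 1)))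
              (a.clocked (d + 1)) (a.clocked (d + 1)))))) τ T τ' ∧
          (τ' (.inr 0)).length + x = (τ (.inr 0)).length ∧ T ≤ (A + 8) * (1 + x) ∧
          τ' (.inr (d + 1)) = [] ∧
          ∀ e, 0 < e → e ≠ d + 1 → τ' (.inr e) = τ (.inr e) := by
      intro d N
      induction N with
      | zero =>
        intro τ hN hd hf
        have h0 : τ (.inr 0) = [] := List.eq_nil_of_length_eq_zero (by omega)
        refine ⟨_, 0, _, .loop_step (by simp [hd]) (.branch_empty h0 (.pop _ _))
          (.loop_done (by simp [hd])), by simp, by omega, by simp [hd], fun e _ he => by simp [he]⟩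
      | succ N ih =>
        intro τ hN hd hf
        by_cases h0 : τ (.inr 0) = []
        · refine ⟨_, 0, _, .loop_step (by simp [hd]) (.branch_empty h0 (.pop _ _))
            (.loop_done (by simp [hd])), by simp, by omega, by simp [hd],
            fun e _ he => by simp [he]⟩
        · have hpos : 0 < (τ (.inr 0)).length := List.length_pos_iff.2 h0
          by_cases hr : τ (.inl r) = []
          · refine ⟨_, 1, _, .loop_step (by simp [hd]) (.branch_same h0
              (.seq (.pop _ _) (.branch_empty (by simp [hr]) (.pop _ _))))
              (.loop_done (by simp [hd])), by simp; omega, by omega, by simp [hd],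
              fun e h1 he => by simp [he, h1.ne']⟩
          · set τ₀ := Function.update τ (.inr 0) (τ (.inr 0)).tail with hτ₀
            obtain ⟨T₁, x₁, τ₁, e₁, l₁, t₁, f₁⟩ := ha (d + 1) τ₀
              (fun e he => by
                have : e ≠ 0 := by omega
                simp [hτ₀, this]; exact hf e he)
            have l₁' : (τ₀ (.inr 0)).length = (τ (.inr 0)).length - 1 := by simp [hτ₀]
            obtain ⟨T₂, x₂, τ₂, e₂, l₂, t₂, g₂, f₂⟩ := ih τ₁ (by omega)
              (by rw [f₁ _ (by omega)]; simp [hτ₀, hd])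
              (fun e he => by
                have : e ≠ 0 := by omega
                rw [f₁ _ (by omega)]; simp [hτ₀, this]; exact hf e he)
            refine ⟨_, 1 + x₁ + x₂, τ₂, .loop_step (by simp [hd]) (.branch_same h0
              (.seq (.pop _ _) (.branch_same (by simpa using hr) e₁))) e₂, by omega, by nlinarith,
              g₂, fun e h1 he => ?_⟩
            rw [f₂ e h1 he, f₁ e h1]; simp [hτ₀, h1.ne']
    refine ⟨A + 9, fun d τ hf => ?_⟩
    have hf' := hf (d + 1) (by omega)
    obtain ⟨T, x, τ', e₁, l₁, t₁, g₁, f₁⟩ := key d _ (Function.update τ (.inr (d + 1)) [true]) le_rfl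
      (by simp) (fun e he => by
        have : e ≠ d + 1 := by omega
        simp [this]; exact hf e (by omega))
    refine ⟨_, x, τ', .seq (.push _ _ _) (by simpa [hf'] using e₁), by simpa using l₁,
      by nlinarith, fun e he => ?_⟩
    rcases eq_or_ne e (d + 1) with rfl | hne
    · rw [g₁, hf']
    · rw [f₁ e he hne]; simp [hne]

end
end PACRE

namespace PACRE

section
variable {ι : Type} [DecidableEq ι]

theorem RExec.cast {c : RProg ι} {σ σ' σ'' : ι → List Bool} {t t' : ℕ} (h : RExec c σ t σ')
    (ht : t = t') (e : σ' = σ'') : RExec c σ t' σ'' := ht ▸ e ▸ h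

theorem RExec.unique {c : RProg ι} {σ σ₁ σ₂ : ι → List Bool} {t₁ t₂ : ℕ}
    (h₁ : RExec c σ t₁ σ₁) (h₂ : RExec c σ t₂ σ₂) : t₁ = t₂ ∧ σ₁ = σ₂ := by
  induction h₁ generalizing t₂ σ₂ with
  | skip => cases h₂; exact ⟨rfl, rfl⟩
  | push => cases h₂; exact ⟨rfl, rfl⟩
  | pop => cases h₂; exact ⟨rfl, rfl⟩
  | seq _ _ ih₁ ih₂ =>
    cases h₂ with
    | seq a b =>
      obtain ⟨rfl, rfl⟩ := ih₁ a
      obtain ⟨rfl, rfl⟩ := ih₂ b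
      exact ⟨rfl, rfl⟩
  | branch_empty h _ ih =>
    cases h₂ with
    | branch_empty _ a => obtain ⟨rfl, rfl⟩ := ih a; exact ⟨rfl, rfl⟩
    | branch_false h' _ => simp [h] at h'
    | branch_true h' _ => simp [h] at h'
  | branch_false h _ ih =>
    cases h₂ with
    | branch_empty h' _ => simp [h'] at h
    | branch_false _ a => obtain ⟨rfl, rfl⟩ := ih a; exact ⟨rfl, rfl⟩
    | branch_true h' _ => simp [h] at h'
  | branch_true h _ ih =>
    cases h₂ with
    | branch_empty h' _ => simp [h'] at h
    | branch_false h' _ => simp [h] at h'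
    | branch_true _ a => obtain ⟨rfl, rfl⟩ := ih a; exact ⟨rfl, rfl⟩
  | loop_done h =>
    cases h₂ with
    | loop_done => exact ⟨rfl, rfl⟩
    | loop_step h' => exact absurd h h'
  | loop_step h _ _ ih₁ ih₂ =>
    cases h₂ with
    | loop_done h' => exact absurd h' h
    | loop_step _ a b =>
      obtain ⟨rfl, rfl⟩ := ih₁ a
      obtain ⟨rfl, rfl⟩ := ih₂ b
      exact ⟨rfl, rfl⟩

/-! ### Outputs of clocked programs -/

open Classical in
/-- The final store of the clocked version of a program. -/
noncomputable def clockedFinal (c : Prog) (τ : ℕ ⊕ ℕ → List Bool) : ℕ ⊕ ℕ → List Bool :=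
  if h : ∃ τ' T, RExec ((RProg.ofProg c).clocked 0) τ T τ' then h.choose else τ

/-- The initial store of a clocked program. -/
def clockedInit (inputs : List (List Bool)) (T : ℕ) : ℕ ⊕ ℕ → List Bool :=
  Sum.elim (initStore inputs) fun e => if e = 0 then unary T else []

/-- The output of a program, if it halts within `T` steps. -/
noncomputable def clockedOut (c : Prog) (inputs : List (List Bool)) (T : ℕ) : List Bool :=
  clockedFinal c (clockedInit inputs T) (.inl 0)

/-- By determinism the chosen final store is the only one. -/
theorem clockedFinal_eq {c : Prog} {τ τ' : ℕ ⊕ ℕ → List Bool} {T : ℕ}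
    (h : RExec ((RProg.ofProg c).clocked 0) τ T τ') : clockedFinal c τ = τ' := by
  have h' : ∃ τ' T, RExec ((RProg.ofProg c).clocked 0) τ T τ' := ⟨τ', T, h⟩
  rw [clockedFinal, dif_pos h']
  obtain ⟨T', e⟩ := h'.choose_spec
  exact (RExec.unique e h).2

/-- A clock at least as long as the running time never interrupts the program, so clocking loses
none of the successful runs. -/
theorem clockedOut_eq {c : Prog} {inputs : List (List Bool)} {T T' : ℕ} {out : List Bool}
    (h : OutputsWithin c inputs T out) (hT : T ≤ T') : clockedOut c inputs T' = out := by
  obtain ⟨t, ht, σ, hσ, rfl⟩ := h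
  obtain ⟨S, τ', hx, he, -, -⟩ := (RExec.ofProg hσ).clocked 0 (clockedInit inputs T') rfl
    (by simp [clockedInit, unary]; omega) (by
      intro e he; simp [clockedInit, he.ne'])
  rw [clockedOut, clockedFinal_eq hx, ← he]; rfl

/-- No termination of c is assumed: this turns an arbitrary program into a total subroutine whose
cost is linear in the clock. -/
theorem clocked_runs (c : Prog) : ∃ A : ℕ, ∀ inputs T, ∃ t ≤ A * (1 + T),
    RExec ((RProg.ofProg c).clocked 0) (clockedInit inputs T) t
      (clockedFinal c (clockedInit inputs T)) := by
  obtain ⟨A, hA⟩ := (RProg.ofProg c).clocked_halts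
  refine ⟨A, fun inputs T => ?_⟩
  obtain ⟨t, x, τ', hx, hl, ht, -⟩ := hA 0 (clockedInit inputs T) (by
      intro e he; simp [clockedInit, he.ne'])
  refine ⟨t, ht.trans (Nat.mul_le_mul_left _ ?_), ?_⟩
  · simp [clockedInit, unary] at hl; omega
  · rwa [clockedFinal_eq hx]

/-! ### Basic program blocks -/

/-- Counted loops are verified by giving a closed form σ j for the store after j rounds; what
remains is one round and the value of the guard. -/
theorem RExec.loop_count {r : ι} {c : RProg ι} {τ : ℕ} : ∀ (m : ℕ) (σ : ℕ → ι → List Bool),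
    (∀ j < m, σ j r ≠ []) → σ m r = [] →
    (∀ j < m, ∃ t ≤ τ, RExec c (σ j) t (σ (j + 1))) →
    ∃ t ≤ m * (τ + 1) + 1, RExec (.loop r c) (σ 0) t (σ m)
  | 0, σ, _, h, _ => ⟨1, by omega, .loop_done h⟩
  | m + 1, σ, hne, h, hs => by
    obtain ⟨t, ht, e⟩ := hs 0 (by omega)
    obtain ⟨t', ht', e'⟩ := RExec.loop_count m (fun j => σ (j + 1))
      (fun j hj => hne _ (by omega)) h (fun j hj => hs _ (by omega))
    exact ⟨_, by nlinarith, .loop_step (hne 0 (by omega)) e e'⟩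

/-- Push the bit `b` onto each of the registers of a list. -/
def RProg.pushAll (b : Bool) : List ι → RProg ι
  | [] => .skip
  | r :: l => .seq (.push r b) (pushAll b l)

theorem RExec.pushAll (b : Bool) : ∀ (l : List ι) (_ : l.Nodup) (σ : ι → List Bool),
    RExec (.pushAll b l) σ (l.length + 1) fun r => if r ∈ l then b :: σ r else σ r
  | [], _, σ => (RExec.skip σ).cast rfl (by simp)
  | a :: l, hl, σ => by
    have hl' := List.nodup_cons.1 hl
    refine (RExec.seq (.push σ a b) (RExec.pushAll b l hl'.2 _)).cast (by simp; omega) ?_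
    funext r
    by_cases h : r = a
    · subst h; simp [hl'.1]
    · simp [h]

/-- Empty the register `src`, pushing its contents bit by bit onto all registers in `dsts`. -/
def RProg.pour (src : ι) (dsts : List ι) : RProg ι :=
  .loop src (.branch src .skip (.seq (.pop src) (.pushAll false dsts))
    (.seq (.pop src) (.pushAll true dsts)))

/-- The effect of `RProg.pour`. -/
def pourStore (src : ι) (dsts : List ι) (σ : ι → List Bool) : ι → List Bool :=
  fun r => if r = src then [] else if r ∈ dsts then (σ src).reverse ++ σ r else σ r

/-- Pouring reverses. With no destination it erases and with several it copies; two pours in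
succession preserve the order, and on unary numbers the reversal is invisible. -/
theorem RExec.pour {src : ι} {dsts : List ι} (hs : src ∉ dsts) (hd : dsts.Nodup) :
    ∀ (l : List Bool) (σ : ι → List Bool), σ src = l →
    RExec (.pour src dsts) σ (l.length * (dsts.length + 4) + 1) (pourStore src dsts σ)
  | [], σ, h => (RExec.loop_done h).cast (by simp) (by
      funext r; simp only [pourStore]; split_ifs <;> simp_all)
  | b :: l, σ, h => by
    have key : RExec (.branch src .skip (.seq (.pop src) (.pushAll false dsts))
        (.seq (.pop src) (.pushAll true dsts))) σ (dsts.length + 3)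
        (fun r => if r ∈ dsts then b :: σ r else Function.update σ src l r) := by
      have hx := RExec.seq (.pop σ src) (RExec.pushAll b dsts hd _)
      cases b
      · refine (RExec.branch_false (by simp [h]) hx).cast (by omega) ?_
        funext r; by_cases hr : r = src <;> simp [h, hr, hs]
      · refine (RExec.branch_true (by simp [h]) hx).cast (by omega) ?_
        funext r; by_cases hr : r = src <;> simp [h, hr, hs]
    refine (RExec.loop_step (by simp [h]) key (RExec.pour hs hd l _ (by simp [hs]))).cast
      (by simp; ring) ?_
    funext r
    by_cases hr : r = src
    · simp [pourStore, hr]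
    · by_cases hr' : r ∈ dsts <;> simp [pourStore, hr, hr', hs, h]

/-- Move as many bits as there are symbols in the register `cnt` from `src` to all registers in
`dsts`. The register `tmp` is used to restore `cnt`. -/
def RProg.take (cnt src tmp : ι) (dsts : List ι) : RProg ι :=
  .seq (.loop cnt (.seq (.pop cnt) (.seq (.push tmp true)
    (.branch src .skip (.seq (.pop src) (.pushAll false dsts))
      (.seq (.pop src) (.pushAll true dsts)))))) (.pour tmp [cnt])

/-- The effect of `RProg.take`. -/
def takeStore (m : ℕ) (src : ι) (dsts : List ι) (σ : ι → List Bool) : ι → List Bool :=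
  fun r => if r = src then (σ src).drop m
    else if r ∈ dsts then ((σ src).take m).reverse ++ σ r else σ r

theorem unary_succ (n : ℕ) : unary (n + 1) = true :: unary n := rfl
@[simp] theorem unary_zero : unary 0 = [] := rfl
@[simp] theorem length_unary (n : ℕ) : (unary n).length = n := by simp [unary]
@[simp] theorem reverse_unary (n : ℕ) : (unary n).reverse = unary n := by simp [unary]
@[simp] theorem unary_append (m n : ℕ) : unary m ++ unary n = unary (m + n) := by
  simp [unary]
@[simp] theorem tail_unary (n : ℕ) : (unary n).tail = unary (n - 1) := by simp [unary]
@[simp] theorem unary_eq_nil (n : ℕ) : unary n = [] ↔ n = 0 := by simp [unary]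

theorem RExec.take {cnt src tmp : ι} {dsts : List ι} (h1 : cnt ≠ src) (h2 : cnt ≠ tmp)
    (h3 : src ≠ tmp) (h4 : src ∉ dsts) (h5 : cnt ∉ dsts) (h6 : tmp ∉ dsts) (hd : dsts.Nodup)
    {m : ℕ} {σ : ι → List Bool} (hc : σ cnt = unary m) (ht : σ tmp = []) :
    ∃ t ≤ m * (dsts.length + 11) + 2,
      RExec (.take cnt src tmp dsts) σ t (takeStore m src dsts σ) := by
  -- Closed form after j rounds: the symbols removed from cnt are kept in tmp, from which the final
  -- pour restores cnt.
  set S : ℕ → ι → List Bool := fun j r => if r = cnt then unary (m - j) else if r = tmp then unary j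
    else takeStore j src dsts σ r with hS
  have hS0 : S 0 = σ := by
    funext r; simp only [hS, takeStore]; split_ifs <;> simp_all
  obtain ⟨t, htm, hx⟩ := RExec.loop_count (r := cnt) (c := .seq (.pop cnt) (.seq (.push tmp true)
    (.branch src .skip (.seq (.pop src) (.pushAll false dsts))
      (.seq (.pop src) (.pushAll true dsts))))) (τ := dsts.length + 5) m S
    (by intro j hj; simp [hS]; omega) (by simp [hS]) (by
      intro j hj
      set σ₁ := Function.update (Function.update (S j) cnt (S j cnt).tail) tmp (true :: S j tmp)
        with hσ₁
      have hst : RExec (.push tmp true) (Function.update (S j) cnt (S j cnt).tail) 1 σ₁ := by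
        refine (RExec.push _ _ _).cast rfl ?_
        rw [hσ₁, Function.update_of_ne h2.symm]
      have hsrc : σ₁ src = (σ src).drop j := by
        simp [hσ₁, hS, takeStore, h3, h1.symm]
      -- The source may run dry before the counter does. From then on only the count moves, in
      -- agreement with the saturation of `List.take` and `List.drop`.
      rcases hl : (σ src).drop j with _ | ⟨b, l⟩
      · refine ⟨_, ?_, (RExec.seq (.pop _ _) (.seq hst
          (.branch_empty (by rw [hsrc, hl]) (.skip _)))).cast rfl ?_⟩
        · omega
        · have hle : (σ src).length ≤ j := by simpa using hl
          funext r
          by_cases hr1 : r = cnt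
          · subst hr1; simp [hσ₁, hS, h2]; congr 1
          by_cases hr2 : r = tmp
          · subst hr2; simp [hσ₁, hS, h2.symm, unary_succ]
          simp only [hσ₁, hS, Function.update_of_ne hr1, Function.update_of_ne hr2, if_neg hr1,
            if_neg hr2, takeStore]
          rw [List.drop_of_length_le hle, List.drop_of_length_le (by omega),
            List.take_of_length_le hle, List.take_of_length_le (by omega)]
      · have hbr : RExec (.branch src .skip (.seq (.pop src) (.pushAll false dsts))
            (.seq (.pop src) (.pushAll true dsts))) σ₁ (dsts.length + 3)
            (fun r => if r ∈ dsts then b :: σ₁ r else Function.update σ₁ src l r) := by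
          have hx := RExec.seq (.pop σ₁ src) (RExec.pushAll b dsts hd _)
          cases b
          · refine (RExec.branch_false (by simp [hsrc, hl]) hx).cast (by omega) ?_
            funext r; by_cases hr : r = src <;> simp [hsrc, hl, hr, h4]
          · refine (RExec.branch_true (by simp [hsrc, hl]) hx).cast (by omega) ?_
            funext r; by_cases hr : r = src <;> simp [hsrc, hl, hr, h4]
        refine ⟨_, ?_, (RExec.seq (.pop _ _) (.seq hst hbr)).cast rfl ?_⟩
        · omega
        · have hlt : j < (σ src).length := by
            by_contra hcon
            rw [List.drop_of_length_le (by omega)] at hl; simp at hl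
          have hdr : (σ src).drop (j + 1) = l := by
            rw [← List.tail_drop, hl]; rfl
          have htk : (σ src).take (j + 1) = (σ src).take j ++ [b] := by
            have : (σ src)[j] = b := by
              have := List.drop_eq_getElem_cons hlt
              rw [hl] at this; simpa using (List.cons.inj this).1.symm
            rw [List.take_succ_eq_append_getElem hlt, this]
          funext r
          by_cases hr1 : r = cnt
          · subst hr1; simp [hσ₁, hS, h2, h5, h1]; congr 1
          by_cases hr2 : r = tmp
          · subst hr2; simp [hσ₁, hS, h2.symm, h6, h3.symm, unary_succ]
          by_cases hr3 : r = src
          · subst hr3; simp [hS, hr1, hr2, takeStore, hdr, h4]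
          by_cases hr4 : r ∈ dsts
          · simp [hS, hσ₁, hr1, hr2, hr3, hr4, takeStore, htk]
          · simp [hS, hσ₁, hr1, hr2, hr3, hr4, takeStore])
  rw [hS0] at hx
  have hp := RExec.pour (src := tmp) (dsts := [cnt]) (by simpa using h2.symm) (by simp) (unary m) (S m)
    (by simp [hS, h2.symm])
  refine ⟨_, ?_, (RExec.seq hx hp).cast rfl ?_⟩
  · simp; nlinarith
  · funext r
    by_cases hr2 : r = tmp
    · subst hr2; simp [pourStore, takeStore, h3.symm, h6, ht]
    by_cases hr1 : r = cnt
    · subst hr1; simp [pourStore, hS, h2, h2.symm, takeStore, h1, h5, hc]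
    simp [pourStore, hS, hr1, hr2]

end
end PACRE

/-! ### Comparison of registers -/

namespace PACRE

section
variable {ι : Type} [DecidableEq ι]

/-- Compare the contents of the registers `a` and `b`, emptying both; afterwards something has been
pushed onto `ne` if and only if they were different. -/
def RProg.eqTest (a b ne : ι) : RProg ι :=
  .seq (.loop a (.seq (.branch a .skip (.branch b (.push ne true) .skip (.push ne true))
      (.branch b (.push ne true) (.push ne true) .skip)) (.seq (.pop a) (.pop b))))
    (.branch b .skip (.seq (.push ne true) (.pour b [])) (.seq (.push ne true) (.pour b [])))

/-- Each position where b differs from u, or has already ended, contributes one symbol to l. Thus l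
is empty exactly when u is a prefix of the contents of b; a surplus in b is left for `RExec.eqTest`
to detect. -/
theorem RExec.eqTest_loop {a b ne : ι} (h1 : a ≠ b) (h2 : a ≠ ne) (h3 : b ≠ ne) :
    ∀ (u : List Bool) (σ : ι → List Bool), σ a = u → ∃ l : List Bool,
      (l = [] ↔ (σ b).take u.length = u) ∧ l.length ≤ u.length ∧
      ∃ t ≤ u.length * 6 + 1, RExec (.loop a (.seq (.branch a .skip (.branch b (.push ne true) .skip (.push ne true))
      (.branch b (.push ne true) (.push ne true) .skip)) (.seq (.pop a) (.pop b)))) σ t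
      (fun r => if r = a then [] else if r = b then (σ b).drop u.length else
        if r = ne then l ++ σ ne else σ r)
  | [], σ, h => ⟨[], by simp, by simp, 1, by simp, (RExec.loop_done h).cast rfl (by
      funext r; split_ifs <;> simp_all)⟩
  | c :: u, σ, h => by
    obtain ⟨l₀, hl₀, hlen₀, hx⟩ : ∃ l₀ : List Bool, (l₀ = [] ↔ (σ b).head? = some c) ∧ l₀.length ≤ 1 ∧
        ∃ t ≤ 3, RExec (.branch a .skip (.branch b (.push ne true) .skip (.push ne true))
      (.branch b (.push ne true) (.push ne true) .skip)) σ t (Function.update σ ne (l₀ ++ σ ne)) := by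
      rcases hb : σ b with _ | ⟨_ | _, v⟩ <;> cases c
      · exact ⟨[true], by simp, by simp, 3, le_rfl, .branch_false (by simp [h]) (.branch_empty hb (.push _ _ _))⟩
      · exact ⟨[true], by simp, by simp, 3, le_rfl, .branch_true (by simp [h]) (.branch_empty hb (.push _ _ _))⟩
      · exact ⟨[], by simp, by simp, 3, le_rfl, (RExec.branch_false (by simp [h]) (.branch_false (by simp [hb]) (.skip _))).cast
          rfl (by simp)⟩
      · exact ⟨[true], by simp, by simp, 3, le_rfl, .branch_true (by simp [h]) (.branch_false (by simp [hb]) (.push _ _ _))⟩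
      · exact ⟨[true], by simp, by simp, 3, le_rfl, .branch_false (by simp [h]) (.branch_true (by simp [hb]) (.push _ _ _))⟩
      · exact ⟨[], by simp, by simp, 3, le_rfl, (RExec.branch_true (by simp [h]) (.branch_true (by simp [hb]) (.skip _))).cast
          rfl (by simp)⟩
    obtain ⟨t, ht, hx⟩ := hx
    set σ₁ := Function.update (Function.update (Function.update σ ne (l₀ ++ σ ne)) a u) b (σ b).tail
      with hσ₁
    have hx₁ := (RExec.seq hx (.seq (.pop _ a) (.pop _ b))).cast rfl (show _ = σ₁ by
      simp [hσ₁, h2, h, h3, h1.symm])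
    obtain ⟨l, hl, hlen, t', ht', hx'⟩ := RExec.eqTest_loop h1 h2 h3 u σ₁ (by simp [hσ₁, h1])
    refine ⟨l ++ l₀, ?_, by simp; omega, _, ?_, (RExec.loop_step (by simp [h]) hx₁ hx').cast rfl ?_⟩
    · rw [List.append_eq_nil_iff, hl, hl₀]
      simp only [hσ₁, Function.update_self]
      rcases σ b with _ | ⟨d, v⟩
      · simp
      · simp [and_comm]
    · simp; omega
    · funext r
      by_cases r1 : r = a
      · simp [r1]
      by_cases r2 : r = b
      · subst r2; simp [r1, hσ₁, List.drop_tail]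
      by_cases r3 : r = ne
      · subst r3; simp [hσ₁, h3.symm, h2.symm]
      simp [hσ₁, r1, r2, r3]

theorem RExec.eqTest {a b ne : ι} (h1 : a ≠ b) (h2 : a ≠ ne) (h3 : b ≠ ne) (σ : ι → List Bool) :
    ∃ l : List Bool, (l = [] ↔ σ a = σ b) ∧ l.length ≤ (σ a).length + 1 ∧
      ∃ t ≤ (σ a).length * 6 + (σ b).length * 4 + 4, RExec (.eqTest a b ne) σ t
      (fun r => if r = a ∨ r = b then [] else if r = ne then l ++ σ ne else σ r) := by
  obtain ⟨l, hl, hlen, t, ht, hx⟩ := RExec.eqTest_loop h1 h2 h3 _ σ rfl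
  by_cases hb : (σ b).drop (σ a).length = []
  · refine ⟨l, ?_, by omega, _, ?_, (RExec.seq hx (.branch_empty (by simpa [h1.symm] using hb)
      (.skip _))).cast rfl ?_⟩
    · rw [hl, List.take_of_length_le (by simpa using hb), eq_comm]
    · omega
    · funext r
      by_cases r1 : r = a
      · simp [r1]
      by_cases r2 : r = b
      · simp [r2, hb]
      simp [r1, r2]
  · refine ⟨true :: l, ?_, by simp; omega, _, ?_, (RExec.seq hx (.branch_same (by simpa [h1.symm] using hb)
      (.seq (.push _ _ _) (RExec.pour (by simp) (by simp) ((σ b).drop (σ a).length) _ ?_)))).cast rfl ?_⟩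
    · simp only [reduceCtorEq, false_iff]
      intro h; simp [h] at hb
    · simp; omega
    · simp [h3, h1.symm]
    · funext r
      by_cases r1 : r = a
      · subst r1; simp [pourStore, h1, h2]
      by_cases r2 : r = b
      · simp [r2, pourStore]
      by_cases r3 : r = ne
      · subst r3; simp [pourStore, r1, r2]
      simp [pourStore, r1, r2, r3]

/-- Empty the registers `a` and `b`; push `true` onto `f` if the truth value of the equality of
their contents was `onEq`. -/
def RProg.cmpPush (onEq : Bool) (a b ne f : ι) : RProg ι :=
  .seq (.eqTest a b ne) (.branch ne (bif onEq then .push f true else .skip)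
    (.seq (.pour ne []) (bif onEq then .skip else .push f true))
    (.seq (.pour ne []) (bif onEq then .skip else .push f true)))

/-- The effect of `RProg.cmpPush`. -/
def cmpStore (onEq : Bool) (a b f : ι) (σ : ι → List Bool) : ι → List Bool := fun r =>
  if r = a ∨ r = b then [] else
    if r = f then (if decide (σ a = σ b) = onEq then true :: σ f else σ f) else σ r

theorem RExec.cmpPush (onEq : Bool) {a b ne f : ι} (h1 : a ≠ b) (h2 : a ≠ ne) (h3 : b ≠ ne)
    (h4 : f ≠ a) (h5 : f ≠ b) (h6 : f ≠ ne) (σ : ι → List Bool) (hne : σ ne = []) :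
    ∃ t ≤ (σ a).length * 10 + (σ b).length * 4 + 12,
      RExec (.cmpPush onEq a b ne f) σ t (cmpStore onEq a b f σ) := by
  obtain ⟨l, hl, hlen, t, ht, hx⟩ := RExec.eqTest h1 h2 h3 σ
  have hne' : ∀ r, r = ne → σ r = [] := by rintro r rfl; exact hne
  by_cases hab : σ a = σ b
  · have h0 := hl.2 hab
    subst h0
    refine ⟨t + (1 + 1), by omega, (RExec.seq hx (.branch_empty (by simp [h2.symm, h3.symm, hne]) ?_)).cast rfl rfl⟩
    cases onEq
    · refine (RExec.skip _).cast rfl ?_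
      funext r
      simp only [cmpStore, hab]; split_ifs <;> simp_all
    · refine (RExec.push _ _ _).cast rfl ?_
      funext r
      by_cases rf : r = f
      · subst rf; simp [cmpStore, hab, h4, h5, h6]
      · simp only [cmpStore, Function.update_of_ne rf]; split_ifs <;> simp_all
  · have h0 : l ≠ [] := fun h => hab (hl.1 h)
    have hp := RExec.pour (src := ne) (dsts := []) (by simp) (by simp) l
      (fun r => if r = a ∨ r = b then [] else if r = ne then l ++ σ ne else σ r)
      (by simp [h2.symm, h3.symm, hne])
    refine ⟨t + (l.length * 4 + 1 + 1 + 1), by omega, (RExec.seq hx (.branch_same (by simp [h2.symm, h3.symm, hne, h0])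
      (.seq hp ?_))).cast rfl rfl⟩
    cases onEq
    · refine (RExec.push _ _ _).cast rfl ?_
      funext r
      by_cases rf : r = f
      · subst rf; simp [cmpStore, hab, h4, h5, h6, pourStore]
      · simp only [cmpStore, Function.update_of_ne rf, pourStore]; split_ifs <;> simp_all
    · refine (RExec.skip _).cast rfl ?_
      funext r
      by_cases rf : r = f
      · subst rf; simp [cmpStore, hab, h4, h5, h6, pourStore]
      · simp only [cmpStore, pourStore]; split_ifs <;> simp_all

/-! ### Arithmetic in unary -/

/-- Halve the unary number in `a`, rounding down, until it is zero; count the rounds in `cnt`. -/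
def RProg.log (a tmp cnt : ι) : RProg ι :=
  .loop a (.seq (.loop a (.seq (.pop a) (.branch a .skip (.seq (.pop a) (.push tmp true))
    (.seq (.pop a) (.push tmp true))))) (.seq (.pour tmp [a]) (.push cnt true)))

/-- Two symbols are removed for each one pushed onto tmp; the last symbol of an odd number is
dropped, because the inner branch then finds a empty. -/
theorem RExec.halve {a tmp : ι} (h : a ≠ tmp) : ∀ (m : ℕ) (σ : ι → List Bool), σ a = unary m →
    ∃ t ≤ m * 8 + 1, RExec (.loop a (.seq (.pop a) (.branch a .skip (.seq (.pop a) (.push tmp true))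
    (.seq (.pop a) (.push tmp true))))) σ t
      (Function.update (Function.update σ a []) tmp (unary (m / 2) ++ σ tmp)) := by
  intro m
  induction m using Nat.strong_induction_on with
  | _ m ih =>
    intro σ hσ
    match m with
    | 0 =>
      refine ⟨1, by omega, (RExec.loop_done (by simpa using hσ)).cast rfl ?_⟩
      rw [show Function.update σ a [] = σ by rw [← unary_zero, ← hσ, Function.update_eq_self]]
      simp
    | 1 =>
      refine ⟨_, ?_, (RExec.loop_step (by simp [hσ]) (.seq (.pop _ _) (.branch_empty
        (by simp [hσ]) (.skip _))) (.loop_done (by simp [hσ]))).cast rfl ?_⟩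
      · omega
      · simp [hσ]
        simp [Function.update_of_ne h.symm]
    | m + 2 =>
      obtain ⟨t, ht, hx⟩ := ih m (by omega) (Function.update (Function.update σ a (unary m)) tmp
        (true :: σ tmp)) (by simp [h])
      have hb : RExec (.seq (.pop a) (.branch a .skip (.seq (.pop a) (.push tmp true))
          (.seq (.pop a) (.push tmp true)))) σ 4
          (Function.update (Function.update σ a (unary m)) tmp (true :: σ tmp)) :=
        (RExec.seq (.pop _ _) (.branch_true (by simp [hσ]; simp [unary, List.replicate_succ])
          (.seq (.pop _ _) (.push _ _ _)))).cast rfl (by simp [hσ, h.symm])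
      refine ⟨_, ?_, (RExec.loop_step (by simp [hσ]) hb hx).cast rfl ?_⟩
      · omega
      · funext r
        by_cases r1 : r = tmp
        · subst r1
          have : (m + 2) / 2 = m / 2 + 1 := by omega
          simp only [Function.update_self, this]
          rw [← unary_append]; simp [unary]
        by_cases r2 : r = a
        · subst r2; simp [r1]
        simp [r1, r2]

/-- The form 2 ^ b - 1 is stable under halving: (2 ^ j - 1) / 2 = 2 ^ (j - 1) - 1. So exactly b
rounds empty the register. -/
theorem RExec.log {a tmp cnt : ι} (h1 : a ≠ tmp) (h2 : a ≠ cnt) (h3 : tmp ≠ cnt) :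
    ∀ (b : ℕ) (σ : ι → List Bool), σ a = unary (2 ^ b - 1) → σ tmp = [] → σ cnt = [] →
    ∃ t ≤ b * (2 ^ b * 13 + 4) + 1, RExec (.log a tmp cnt) σ t
      (Function.update (Function.update σ a []) cnt (unary b)) := by
  intro b σ ha htmp hcnt
  set S : ℕ → ι → List Bool := fun j =>
    Function.update (Function.update σ a (unary (2 ^ (b - j) - 1))) cnt (unary j) with hS
  have h0 : S 0 = σ := by simp [hS, ← ha, ← hcnt]
  have hb : S b = Function.update (Function.update σ a []) cnt (unary b) := by simp [hS]
  rw [← hb]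
  conv => enter [1, t, 2, 1]
  suffices ∃ t ≤ b * (2 ^ b * 13 + 3 + 1) + 1, RExec (.log a tmp cnt) (S 0) t (S b) by rwa [h0] at this
  refine RExec.loop_count b S ?_ (by simp [hS, h2]) ?_
  · intro j hj
    have : 1 < 2 ^ (b - j) := Nat.one_lt_two_pow (by omega)
    simp [hS, h2]; omega
  · intro j hj
    obtain ⟨t, ht, hx⟩ := RExec.halve h1 (2 ^ (b - j) - 1) (S j) (by simp [hS, h2])
    have hdiv : (2 ^ (b - j) - 1) / 2 = 2 ^ (b - (j + 1)) - 1 := by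
      rw [show b - j = (b - (j + 1)) + 1 by omega, pow_succ]
      have := Nat.two_pow_pos (b - (j + 1)); omega
    have hle : 2 ^ (b - j) ≤ 2 ^ b := Nat.pow_le_pow_right (by norm_num) (by omega)
    have hle' : 2 ^ (b - (j + 1)) ≤ 2 ^ b := Nat.pow_le_pow_right (by norm_num) (by omega)
    rw [hdiv] at hx
    have hp := RExec.pour (src := tmp) (dsts := [a]) (by simpa using h1.symm) (by simp)
      (unary (2 ^ (b - (j + 1)) - 1)) _ (show Function.update (Function.update (S j) a []) tmp
        (unary (2 ^ (b - (j + 1)) - 1) ++ S j tmp) tmp = _ by simp [hS, h3, h1.symm, htmp])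
    refine ⟨_, ?_, (RExec.seq hx (.seq hp (.push _ _ _))).cast rfl ?_⟩
    · simp; omega
    · funext r
      by_cases r1 : r = cnt
      · subst r1; simp [pourStore, h3.symm, h2.symm, hS, unary_succ]
      by_cases r2 : r = a
      · subst r2; simp [pourStore, h1, hS, r1, htmp, h1.symm, h3]
      by_cases r3 : r = tmp
      · subst r3; simp [pourStore, hS, r1, r2, htmp]
      simp [pourStore, hS, r1, r2, r3]

theorem monotone_poly_eval (p : Polynomial ℕ) : Monotone fun n => p.eval n := by
  intro a b h
  simp only [Polynomial.eval_eq_sum, Polynomial.sum]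
  exact Finset.sum_le_sum fun i _ => Nat.mul_le_mul_left _ (Nat.pow_le_pow_left h i)

theorem RExec.pushUnary (r : ι) : ∀ (a : ℕ) , ∃ c : RProg ι, ∀ σ : ι → List Bool,
    RExec c σ (a + 1) (Function.update σ r (unary a ++ σ r))
  | 0 => ⟨.skip, fun σ => (RExec.skip σ).cast rfl (by simp)⟩
  | a + 1 => by
    obtain ⟨c, hc⟩ := RExec.pushUnary r a
    exact ⟨.seq c (.push r true), fun σ => (RExec.seq (hc σ) (.push _ _ _)).cast rfl
      (by simp [unary_succ])⟩

/-- Polynomials can be evaluated in unary. -/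
theorem exists_polyUnary {src acc tmp dst : ι} (h1 : src ≠ acc) (h2 : src ≠ tmp) (h3 : src ≠ dst)
    (h4 : acc ≠ tmp) (h5 : acc ≠ dst) (h6 : tmp ≠ dst) (p : Polynomial ℕ) :
    ∃ (c : RProg ι) (τ : Polynomial ℕ), ∀ (σ : ι → List Bool) (N : ℕ), σ src = unary N →
      σ acc = [] → σ tmp = [] → σ dst = [] →
      ∃ t ≤ τ.eval N, RExec c σ t (Function.update σ dst (unary (p.eval N))) := by
  induction p using Polynomial.recOnHorner with
  | M0 =>
    refine ⟨.skip, 1, fun σ N hs ha ht hd => ⟨1, by simp, (RExec.skip σ).cast rfl ?_⟩⟩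
    simp [← hd]
  | MC p a _ _ ih =>
    obtain ⟨c, τ, hc⟩ := ih
    obtain ⟨c', hc'⟩ := RExec.pushUnary dst a
    refine ⟨.seq c c', τ + Polynomial.C (a + 1), fun σ N hs ha ht hd => ?_⟩
    obtain ⟨t, hle, hx⟩ := hc σ N hs ha ht hd
    refine ⟨_, ?_, (RExec.seq hx (hc' _)).cast rfl ?_⟩
    · simp only [Polynomial.eval_add, Polynomial.eval_C]; omega
    · simp [add_comm]
  -- A Horner step. For each symbol of dst a copy of src is added to acc, with tmp used to restore
  -- src; pouring acc back leaves the product in dst.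
  | MX p _ ih =>
    obtain ⟨c, τ, hc⟩ := ih
    refine ⟨.seq c (.seq (.loop dst (.seq (.pop dst) (.seq (.pour src [acc, tmp]) (.pour tmp [src]))))
      (.pour acc [dst])), τ + (p * (Polynomial.X * 11 + 4) + 1) + (p * Polynomial.X * 5 + 1),
      fun σ N hs ha ht hd => ?_⟩
    obtain ⟨t, hle, hx⟩ := hc σ N hs ha ht hd
    set S : ℕ → ι → List Bool := fun j => Function.update (Function.update σ dst
      (unary (p.eval N - j))) acc (unary (j * N)) with hS
    have h0 : S 0 = Function.update σ dst (unary (p.eval N)) := by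
      simp only [hS]; rw [Function.update_comm h5.symm]; simp [← ha]
    rw [← h0] at hx
    obtain ⟨t', ht', hx'⟩ := RExec.loop_count (r := dst) (c := .seq (.pop dst)
      (.seq (.pour src [acc, tmp]) (.pour tmp [src]))) (τ := N * 11 + 3) (p.eval N) S
      (by intro j hj; simp [hS, h5.symm]; omega) (by simp [hS, h5.symm]) (by
        intro j hj
        have e1 := RExec.pour (src := src) (dsts := [acc, tmp]) (by simp [h1, h2]) (by simp [h4])
          (unary N) (Function.update (S j) dst (S j dst).tail) (by simp [hS, h1, h3, hs])
        have e2 := RExec.pour (src := tmp) (dsts := [src]) (by simp [h2.symm]) (by simp)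
          (unary N) _ (show pourStore src [acc, tmp] (Function.update (S j) dst (S j dst).tail) tmp
            = _ by simp [pourStore, hS, h2.symm, h6, h4.symm, ht, h3, h1, hs])
        refine ⟨_, ?_, (RExec.seq (.pop _ _) (.seq e1 e2)).cast rfl ?_⟩
        · simp; omega
        · funext r
          by_cases r1 : r = src
          · subst r1; simp [pourStore, hS, h1, h2, h3, hs, h6, h4.symm, ht, h2.symm]
          by_cases r2 : r = acc
          · subst r2; simp [pourStore, hS, h4, r1, h5, h3, h1, hs]; ring_nf
          by_cases r3 : r = tmp
          · subst r3; simp [pourStore, hS, h4.symm, h6, ht]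
          by_cases r4 : r = dst
          · subst r4; simp [pourStore, hS, r1, r2, r3]; congr 1
          simp [pourStore, hS, r1, r2, r3, r4])
    have e3 := RExec.pour (src := acc) (dsts := [dst]) (by simp [h5]) (by simp) (unary (p.eval N * N))
      (S (p.eval N)) (by simp [hS])
    refine ⟨_, ?_, (RExec.seq hx (.seq hx' e3)).cast rfl ?_⟩
    · simp at ht' ⊢; nlinarith
    · funext r
      by_cases r2 : r = acc
      · subst r2; simp [pourStore, h5, ha]
      by_cases r4 : r = dst
      · subst r4; simp [pourStore, hS, r2]
      simp [pourStore, hS, r2, r4]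

end
end PACRE

namespace PACRE

/-! ### Polynomially bounded reachability -/

section
variable {ι : Type} [DecidableEq ι] {I : Type} {H : I → Prop} {sz : I → ℕ}

/-- `f` is bounded by a polynomial in the size of the instance, on the instances satisfying `H`. -/
def PolyBounded (H : I → Prop) (sz f : I → ℕ) : Prop :=
  ∃ p : Polynomial ℕ, ∀ i, H i → f i ≤ p.eval (sz i)

theorem PolyBounded.mono {f g : I → ℕ} (hg : PolyBounded H sz g) (h : ∀ i, H i → f i ≤ g i) :
    PolyBounded H sz f :=
  let ⟨p, hp⟩ := hg
  ⟨p, fun i hi => (h i hi).trans (hp i hi)⟩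

theorem PolyBounded.const (a : ℕ) : PolyBounded H sz fun _ => a :=
  ⟨Polynomial.C a, fun i _ => by simp⟩

theorem PolyBounded.eval (p : Polynomial ℕ) : PolyBounded H sz fun i => p.eval (sz i) :=
  ⟨p, fun _ _ => le_rfl⟩

theorem PolyBounded.size : PolyBounded H sz sz := ⟨Polynomial.X, fun i _ => by simp⟩

theorem PolyBounded.add {f g : I → ℕ} (hf : PolyBounded H sz f) (hg : PolyBounded H sz g) :
    PolyBounded H sz fun i => f i + g i :=
  let ⟨p, hp⟩ := hf
  let ⟨q, hq⟩ := hg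
  ⟨p + q, fun i hi => by rw [Polynomial.eval_add]; exact add_le_add (hp i hi) (hq i hi)⟩

theorem PolyBounded.mul {f g : I → ℕ} (hf : PolyBounded H sz f) (hg : PolyBounded H sz g) :
    PolyBounded H sz fun i => f i * g i :=
  let ⟨p, hp⟩ := hf
  let ⟨q, hq⟩ := hg
  ⟨p * q, fun i hi => by rw [Polynomial.eval_mul]; exact Nat.mul_le_mul (hp i hi) (hq i hi)⟩

/-- Some program leads from the stores `σ i` to the stores `σ' i` in polynomial time, for all
instances `i` satisfying `H`. -/
def Reach (H : I → Prop) (sz : I → ℕ) (σ σ' : I → ι → List Bool) : Prop :=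
  ∃ c : RProg ι, ∃ p : Polynomial ℕ, ∀ i, H i → ∃ t ≤ p.eval (sz i), RExec c (σ i) t (σ' i)

theorem Reach.of_bound {σ σ' : I → ι → List Bool} {f : I → ℕ} (c : RProg ι)
    (hf : PolyBounded H sz f) (h : ∀ i, H i → ∃ t ≤ f i, RExec c (σ i) t (σ' i)) :
    Reach H sz σ σ' :=
  let ⟨p, hp⟩ := hf
  ⟨c, p, fun i hi => let ⟨t, ht, hx⟩ := h i hi; ⟨t, ht.trans (hp i hi), hx⟩⟩

/-- Since `Reach` hides both the program and its time bound, the construction of a program becomes a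
chain of store descriptions. -/
theorem Reach.trans {σ σ' σ'' : I → ι → List Bool} (h : Reach H sz σ σ') (h' : Reach H sz σ' σ'') :
    Reach H sz σ σ'' := by
  obtain ⟨c, p, hc⟩ := h
  obtain ⟨c', p', hc'⟩ := h'
  refine ⟨.seq c c', p + p', fun i hi => ?_⟩
  obtain ⟨t, ht, hx⟩ := hc i hi
  obtain ⟨t', ht', hx'⟩ := hc' i hi
  exact ⟨_, by rw [Polynomial.eval_add]; omega, .seq hx hx'⟩

theorem Reach.congr {σ σ' τ τ' : I → ι → List Bool} (h : Reach H sz σ σ')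
    (e : ∀ i, H i → σ i = τ i) (e' : ∀ i, H i → σ' i = τ' i) : Reach H sz τ τ' :=
  let ⟨c, p, hc⟩ := h
  ⟨c, p, fun i hi => by rw [← e i hi, ← e' i hi]; exact hc i hi⟩

theorem Reach.congr_right {σ σ' τ' : I → ι → List Bool} (h : Reach H sz σ σ')
    (e' : ∀ i, H i → σ' i = τ' i) : Reach H sz σ τ' := h.congr (fun _ _ => rfl) e'

theorem Reach.refl (σ : I → ι → List Bool) : Reach H sz σ σ :=
  ⟨.skip, 1, fun _ _ => ⟨1, by simp, .skip _⟩⟩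

theorem Reach.push (σ : I → ι → List Bool) (r : ι) (b : Bool) :
    Reach H sz σ fun i => Function.update (σ i) r (b :: σ i r) :=
  ⟨.push r b, 1, fun _ _ => ⟨1, by simp, .push _ _ _⟩⟩

theorem Reach.pop (σ : I → ι → List Bool) (r : ι) :
    Reach H sz σ fun i => Function.update (σ i) r (σ i r).tail :=
  ⟨.pop r, 1, fun _ _ => ⟨1, by simp, .pop _ _⟩⟩

/-- All branches aim at the same target, and what the test reveals is added to the hypothesis on the
instances. -/
theorem Reach.branch {σ σ' : I → ι → List Bool} (r : ι)
    (h₀ : Reach (fun i => H i ∧ σ i r = []) sz σ σ')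
    (h₁ : Reach (fun i => H i ∧ (σ i r).head? = some false) sz σ σ')
    (h₂ : Reach (fun i => H i ∧ (σ i r).head? = some true) sz σ σ') : Reach H sz σ σ' := by
  obtain ⟨c₀, p₀, hc₀⟩ := h₀
  obtain ⟨c₁, p₁, hc₁⟩ := h₁
  obtain ⟨c₂, p₂, hc₂⟩ := h₂
  refine ⟨.branch r c₀ c₁ c₂, p₀ + p₁ + p₂ + 1, fun i hi => ?_⟩
  simp only [Polynomial.eval_add, Polynomial.eval_one]
  rcases hr : σ i r with _ | ⟨_ | _, l⟩
  · obtain ⟨t, ht, hx⟩ := hc₀ i ⟨hi, hr⟩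
    exact ⟨_, by omega, .branch_empty hr hx⟩
  · obtain ⟨t, ht, hx⟩ := hc₁ i ⟨hi, by simp [hr]⟩
    exact ⟨_, by omega, .branch_false (by simp [hr]) hx⟩
  · obtain ⟨t, ht, hx⟩ := hc₂ i ⟨hi, by simp [hr]⟩
    exact ⟨_, by omega, .branch_true (by simp [hr]) hx⟩

theorem Reach.imp {H' : I → Prop} {σ σ' : I → ι → List Bool} (h : Reach H sz σ σ')
    (hH : ∀ i, H' i → H i) : Reach H' sz σ σ' :=
  let ⟨c, p, hc⟩ := h
  ⟨c, p, fun i hi => hc i (hH i hi)⟩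

/-- Here the number m of stages is the same for all instances, so the program is unrolled and
different stages may use different registers. -/
theorem Reach.range {S : ℕ → I → ι → List Bool} :
    ∀ m : ℕ, (∀ t < m, Reach H sz (S t) (S (t + 1))) → Reach H sz (S 0) (S m)
  | 0, _ => .refl _
  | m + 1, h => (Reach.range m fun t ht => h t (by omega)).trans (h m (by omega))

/-- Change of instances. -/
theorem Reach.reindex {J : Type} {H' : J → Prop} {sz' : J → ℕ} {σ σ' : I → ι → List Bool}
    (h : Reach H sz σ σ') (f : J → I) (hH : ∀ j, H' j → H (f j))
    (hs : PolyBounded H' sz' fun j => sz (f j)) :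
    Reach H' sz' (fun j => σ (f j)) fun j => σ' (f j) := by
  obtain ⟨c, p, hc⟩ := h
  obtain ⟨q, hq⟩ := hs
  refine ⟨c, p.comp q, fun j hj => ?_⟩
  obtain ⟨t, ht, hx⟩ := hc (f j) (hH j hj)
  exact ⟨t, ht.trans (by rw [Polynomial.eval_comp]; exact monotone_poly_eval p (hq j hj)), hx⟩

/-- In contrast to `Reach.range`, the number of rounds depends on the instance. One body must serve
all rounds, so it is treated as a `Reach` over pairs of an instance and a round, with size measured
on the instance alone. -/
theorem Reach.loop {S : I → ℕ → ι → List Bool} {m : I → ℕ} (r : ι) (hm : PolyBounded H sz m)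
    (hne : ∀ i, H i → ∀ j < m i, S i j r ≠ []) (h0 : ∀ i, H i → S i (m i) r = [])
    (h : Reach (fun x : I × ℕ => H x.1 ∧ x.2 < m x.1) (fun x => sz x.1) (fun x => S x.1 x.2)
      fun x => S x.1 (x.2 + 1)) :
    Reach H sz (fun i => S i 0) fun i => S i (m i) := by
  obtain ⟨c, p, hc⟩ := h
  refine .of_bound (.loop r c) (f := fun i => m i * (p.eval (sz i) + 1) + 1)
    ((hm.mul ((PolyBounded.eval p).add (.const 1))).add (.const 1)) fun i hi => ?_
  exact RExec.loop_count (m i) (S i) (hne i hi) (h0 i hi) fun j hj => hc (i, j) ⟨hi, hj⟩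

theorem Reach.pour {σ σ' : I → ι → List Bool} (src : ι) (dsts : List ι)
    (hs : src ∉ dsts) (hd : dsts.Nodup) (hl : PolyBounded H sz fun i => (σ i src).length)
    (e : ∀ i, H i → pourStore src dsts (σ i) = σ' i) : Reach H sz σ σ' :=
  .of_bound (.pour src dsts) ((hl.mul (.const (dsts.length + 4))).add (.const 1)) fun i hi =>
    ⟨_, le_rfl, (RExec.pour hs hd _ (σ i) rfl).cast rfl (e i hi)⟩

theorem Reach.take {σ σ' : I → ι → List Bool} {m : I → ℕ} (cnt src tmp : ι) (dsts : List ι)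
    (h1 : cnt ≠ src) (h2 : cnt ≠ tmp) (h3 : src ≠ tmp) (h4 : src ∉ dsts) (h5 : cnt ∉ dsts)
    (h6 : tmp ∉ dsts) (hd : dsts.Nodup) (hm : PolyBounded H sz m)
    (hc : ∀ i, H i → σ i cnt = unary (m i)) (ht : ∀ i, H i → σ i tmp = [])
    (e : ∀ i, H i → takeStore (m i) src dsts (σ i) = σ' i) : Reach H sz σ σ' :=
  .of_bound (.take cnt src tmp dsts) ((hm.mul (.const (dsts.length + 11))).add (.const 2))
    fun i hi => by
      obtain ⟨t, ht, hx⟩ := RExec.take h1 h2 h3 h4 h5 h6 hd (hc i hi) (ht i hi)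
      exact ⟨t, ht, hx.cast rfl (e i hi)⟩

theorem Reach.cmpPush {σ σ' : I → ι → List Bool} (onEq : Bool) (a b ne f : ι) (h1 : a ≠ b)
    (h2 : a ≠ ne) (h3 : b ≠ ne) (h4 : f ≠ a) (h5 : f ≠ b) (h6 : f ≠ ne)
    (hla : PolyBounded H sz fun i => (σ i a).length)
    (hlb : PolyBounded H sz fun i => (σ i b).length) (hne : ∀ i, H i → σ i ne = [])
    (e : ∀ i, H i → cmpStore onEq a b f (σ i) = σ' i) : Reach H sz σ σ' :=
  .of_bound (.cmpPush onEq a b ne f) (((hla.mul (.const 10)).add (hlb.mul (.const 4))).add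
    (.const 12)) fun i hi => by
      obtain ⟨t, ht, hx⟩ := RExec.cmpPush onEq h1 h2 h3 h4 h5 h6 (σ i) (hne i hi)
      exact ⟨t, ht, hx.cast rfl (e i hi)⟩

theorem Reach.polyUnary {σ : I → ι → List Bool} (src acc tmp dst : ι) (h1 : src ≠ acc)
    (h2 : src ≠ tmp) (h3 : src ≠ dst) (h4 : acc ≠ tmp) (h5 : acc ≠ dst) (h6 : tmp ≠ dst)
    (p : Polynomial ℕ) (hs : ∀ i, H i → σ i src = unary (sz i)) (ha : ∀ i, H i → σ i acc = [])
    (ht : ∀ i, H i → σ i tmp = []) (hd : ∀ i, H i → σ i dst = []) :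
    Reach H sz σ fun i => Function.update (σ i) dst (unary (p.eval (sz i))) :=
  let ⟨c, τ, hc⟩ := exists_polyUnary h1 h2 h3 h4 h5 h6 p
  ⟨c, τ, fun i hi => hc (σ i) (sz i) (hs i hi) (ha i hi) (ht i hi) (hd i hi)⟩

/-- A step adds at most one bit. This bounds the hypothesis and the predictions of an unknown
learner by its clock. -/
theorem RExec.length_le {c : RProg ι} {σ σ' : ι → List Bool} {t : ℕ} (h : RExec c σ t σ') (r : ι) :
    (σ' r).length ≤ (σ r).length + t := by
  induction h with
  | skip => omega
  | push σ a b => by_cases h : r = a <;> simp [h]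
  | pop σ a => by_cases h : r = a <;> simp [h]; omega
  | seq _ _ h₁ h₂ => omega
  | branch_empty _ _ ih => omega
  | branch_false _ _ ih => omega
  | branch_true _ _ ih => omega
  | loop_done => omega
  | loop_step _ _ _ h₁ h₂ => omega

/-- Run the clocked version of a program on the registers in the range of `f`. -/
theorem Reach.clocked {σ σ' : I → ι → List Bool} {inputs : I → List (List Bool)} {T : I → ℕ}
    (c : Prog) (f : ℕ ⊕ ℕ → ι) (hf : Function.Injective f) (hT : PolyBounded H sz T)
    (hin : ∀ i, H i → σ i ∘ f = clockedInit (inputs i) (T i))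
    (e₁ : ∀ i, H i → σ' i ∘ f = clockedFinal c (clockedInit (inputs i) (T i)))
    (e₂ : ∀ i, H i → ∀ r ∉ Set.range f, σ' i r = σ i r) : Reach H sz σ σ' := by
  obtain ⟨A, hA⟩ := clocked_runs c
  refine .of_bound (((RProg.ofProg c).clocked 0).map f)
    ((PolyBounded.const A).mul ((PolyBounded.const 1).add hT)) fun i hi => ?_
  obtain ⟨t, ht, hx⟩ := hA (inputs i) (T i)
  obtain ⟨τ', hx', g₁, g₂⟩ := hx.map hf (σ i) (hin i hi)
  refine ⟨t, ht, hx'.cast rfl ?_⟩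
  funext r
  by_cases hr : r ∈ Set.range f
  · obtain ⟨s, rfl⟩ := hr
    exact congrFun (g₁.trans (e₁ i hi).symm) s
  · rw [g₂ r hr, e₂ i hi r hr]

theorem clockedOut_length (c : Prog) : ∃ A : ℕ, ∀ inputs T,
    (clockedOut c inputs T).length ≤ (initStore inputs 0).length + A * (1 + T) := by
  obtain ⟨A, hA⟩ := clocked_runs c
  refine ⟨A, fun inputs T => ?_⟩
  obtain ⟨t, ht, hx⟩ := hA inputs T
  have := hx.length_le (.inl 0)
  simp only [clockedInit, Sum.elim_inl] at this
  exact this.trans (by omega)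

end

/-! ### Simulation of a labelled example -/

/-- The registers of the distinguisher. -/
inductive Reg : Type
  | nv | gr | yy | co | bb | lg | pp | qq | tmp | tmp2 | ne | cf | cw | ce | out | lab | er
  | w (i j : ℕ)
  | lb (t : ℕ)
  | lr (s : ℕ ⊕ ℕ)
  | pr (t : ℕ) (s : ℕ ⊕ ℕ)
  deriving DecidableEq, Countable

/-- The `i`-th block of length `b` of a list. -/
def blk (b : ℕ) (l : List Bool) (i : ℕ) : List Bool := (l.drop (i * b)).take b

/-- The number of pairs of equal blocks among the first `k` blocks. -/
def collNum (k b : ℕ) (l : List Bool) : ℕ :=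
  ∑ j ∈ Finset.range k, ∑ i ∈ Finset.range j, if blk b l i = blk b l j then 1 else 0

/-- The simulated point: the coins `W` if these describe a tuple with a repetition; otherwise the
description of the tuple is replaced by `E`. -/
def simPoint (k b : ℕ) (W E : List Bool) : List Bool :=
  (if collNum k b W = 0 then E else W.take (k * b)) ++ W.drop (k * b)

/-- The label of the simulated point. -/
def simLabel (k b : ℕ) (W : List Bool) (y : Bool) : Bool :=
  if collNum k b W = 0 then y else true

theorem blk_take {b n i : ℕ} {l : List Bool} (h : (i + 1) * b ≤ n) :
    blk b (l.take n) i = blk b l i := by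
  rw [blk, blk, List.drop_take, List.take_take, min_eq_left]
  rw [add_mul] at h; omega

theorem collNum_take {k b n : ℕ} {l : List Bool} (h : k * b ≤ n) :
    collNum k b (l.take n) = collNum k b l := by
  refine Finset.sum_congr rfl fun j hj => Finset.sum_congr rfl fun i hi => ?_
  rw [Finset.mem_range] at hi hj
  rw [blk_take ((Nat.mul_le_mul_right b (by omega)).trans h),
    blk_take ((Nat.mul_le_mul_right b (by omega)).trans h)]

/-- Instances for the simulation of an example: a store, the block length and the number of
padding bits. -/
structure SimInst (k : ℕ) (x : (Reg → List Bool) × ℕ × ℕ) : Prop where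
  bb : x.1 .bb = unary x.2.1
  pp : x.1 .pp = unary x.2.2
  yy : x.1 .yy ≠ []
  tmp : x.1 .tmp = []
  ne : x.1 .ne = []
  cf : x.1 .cf = []
  cw : x.1 .cw = []
  ce : x.1 .ce = []
  lab : x.1 .lab = []
  w : ∀ i j, x.1 (.w i j) = []

/-- The store after the simulation of an example. -/
def simStore (k : ℕ) (x : (Reg → List Bool) × ℕ × ℕ) : Reg → List Bool
  | .co => (x.1 .co).drop (k * x.2.1 + x.2.2)
  | .gr => (x.1 .gr).drop (k * x.2.1)
  | .yy => (x.1 .yy).tail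
  | .out => (simPoint k x.2.1 ((x.1 .co).take (k * x.2.1 + x.2.2))
      ((x.1 .gr).take (k * x.2.1))).reverse ++ x.1 .out
  | .lab => [simLabel k x.2.1 ((x.1 .co).take (k * x.2.1 + x.2.2)) ((x.1 .yy).headD false)]
  | r => x.1 r

/-- The store after splitting off `i` blocks of the coins. -/
def simStoreA (k i : ℕ) (x : (Reg → List Bool) × ℕ × ℕ) : Reg → List Bool
  | .co => (x.1 .co).drop (i * x.2.1)
  | .cw => ((x.1 .co).take (i * x.2.1)).reverse
  | .w i' j => if i' < i ∧ j < k ∧ j ≠ i' then (blk x.2.1 (x.1 .co) i').reverse else []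
  | r => x.1 r

/-- The store after splitting off `i` blocks of the hyperedge. -/
def simStoreB (k i : ℕ) (x : (Reg → List Bool) × ℕ × ℕ) : Reg → List Bool
  | .gr => (x.1 .gr).drop (i * x.2.1)
  | .ce => ((x.1 .gr).take (i * x.2.1)).reverse
  | r => simStoreA k k x r

/-- The store after comparing the block `j` with the blocks up to `i`, and all earlier pairs of
blocks. -/
def simStoreC (k j i : ℕ) (x : (Reg → List Bool) × ℕ × ℕ) : Reg → List Bool
  | .cf => unary (collNum j x.2.1 (x.1 .co) + ∑ i' ∈ Finset.range i,
      if blk x.2.1 (x.1 .co) i' = blk x.2.1 (x.1 .co) j then 1 else 0)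
  | .w i' j' => if (i' < j ∧ j' < j) ∨ (i' = j ∧ j' < i) ∨ (i' < i ∧ j' = j) then []
      else simStoreB k k x (.w i' j')
  | r => simStoreB k k x r

/-- Comparisons destroy their operands, so block i is copied to every `w i j` with j ≠ i, one copy
per comparison. A further copy in `cw` keeps the coins themselves. -/
theorem reach_simStoreA (k : ℕ) : Reach (SimInst k) (fun x => x.2.1 + x.2.2) (fun x => x.1)
    (simStoreA k k) := by
  refine (Reach.range (S := simStoreA k) k fun i hi => ?_).congr (fun x hx => ?_) fun _ _ => rfl
  · refine .take (m := fun x => x.2.1) .bb .co .tmp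
      (.cw :: ((List.range k).filter (· ≠ i)).map (.w i)) (by simp) (by simp) (by simp) (by simp)
      (by simp) (by simp) ?_ (PolyBounded.size.mono fun _ _ => by simp) (fun x hx => hx.bb)
      (fun x hx => hx.tmp) fun x hx => ?_
    · refine List.nodup_cons.2 ⟨by simp, ?_⟩
      exact ((List.nodup_range).filter _).map fun a b h => by simpa using h
    · funext r
      cases r <;> simp [takeStore, simStoreA, add_mul, List.take_add]
      case w i' j =>
        by_cases h1 : i = i'
        · subst h1
          by_cases h2 : j < k ∧ j ≠ i
          · simp [h2.1, h2.2, blk]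
          · have h3 : ¬ (j < k ∧ ¬ j = i) := h2
            simp [h3]
        · have h2 : i' ≤ i ↔ i' < i := by omega
          simp [h1, h2]
  · funext r
    cases r <;> simp [simStoreA, hx.cw, hx.w]

theorem reach_simStoreB (k : ℕ) : Reach (SimInst k) (fun x => x.2.1 + x.2.2) (simStoreA k k)
    (simStoreB k k) := by
  refine (Reach.range (S := simStoreB k) k fun i hi => ?_).congr (fun x hx => ?_) fun _ _ => rfl
  · refine .take (m := fun x => x.2.1) .bb .gr .tmp [.ce] (by simp) (by simp) (by simp) (by simp)
      (by simp) (by simp) (by simp) (PolyBounded.size.mono fun _ _ => by simp) (fun x hx => hx.bb)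
      (fun x hx => hx.tmp) fun x hx => ?_
    funext r
    cases r <;> simp [takeStore, simStoreB, simStoreA, add_mul, List.take_add]
  · funext r
    cases r <;> simp [simStoreB, simStoreA, hx.ce]

theorem length_blk_le (b : ℕ) (l : List Bool) (i : ℕ) : (blk b l i).length ≤ b := by
  simp [blk]

/-- The pairs i < j are compared row by row, each consuming `w i j` and `w j i` and leaving a symbol
in `cf` on equality. The blocks are stored reversed, which does not affect equality; the end of row
j is the start of row j + 1. -/
theorem reach_simStoreC (k : ℕ) : Reach (SimInst k) (fun x => x.2.1 + x.2.2) (simStoreB k k)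
    (simStoreC k k 0) := by
  have hlen : ∀ (x : (Reg → List Bool) × ℕ × ℕ) i j j' i',
      (simStoreC k j i x (.w i' j')).length ≤ x.2.1 + x.2.2 := by
    intro x i j j' i'
    have := length_blk_le x.2.1 (x.1 .co) i'
    simp only [simStoreC, simStoreB, simStoreA]
    split_ifs <;> simp <;> omega
  refine (Reach.range (S := fun j => simStoreC k j 0) k fun j hj => ?_).congr (fun x hx => ?_)
    fun _ _ => rfl
  · refine (Reach.range (S := fun i => simStoreC k j i) j fun i hi => ?_).congr_right
      fun x hx => ?_
    · refine .cmpPush true (.w i j) (.w j i) .ne .cf (by simp; omega) (by simp) (by simp) (by simp)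
        (by simp) (by simp) (PolyBounded.size.mono fun _ _ => hlen ..)
        (PolyBounded.size.mono fun _ _ => hlen ..) (fun x hx => hx.ne) fun x hx => ?_
      funext r
      cases r
      case cf =>
        have e1 : ¬ i = j := by omega
        have e2 : ¬ j = i := by omega
        have e3 : i < k := by omega
        simp only [cmpStore, simStoreC, simStoreB, simStoreA, Finset.sum_range_succ]
        simp only [lt_irrefl, and_false, false_and, or_self, not_false_eq_true, ne_eq, and_self,
          if_true, if_false, hj, true_and, List.reverse_inj, and_true, reduceCtorEq, e1, e2, e3, decide_eq_true_eq]
        split_ifs <;> simp [← add_assoc, unary_succ]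
      case w i' j' =>
        simp only [cmpStore, simStoreC, reduceCtorEq, Reg.w.injEq, if_false]
        by_cases c1 : i' = i ∧ j' = j ∨ i' = j ∧ j' = i
        · rw [if_pos c1, if_pos (by omega)]
        · rw [if_neg c1]
          congr 1
          simp only [eq_iff_iff]
          omega
      all_goals simp [cmpStore, simStoreC]
    · funext r
      cases r
      case cf =>
        simp only [simStoreC, collNum, Finset.sum_range_succ, Finset.sum_range_zero, add_zero]
      case w i' j' =>
        simp only [simStoreC, simStoreB, simStoreA]
        by_cases e : i' = j ∧ j' = j
        · simp [e.1, e.2]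
        · congr 1
          simp only [eq_iff_iff]
          omega
      all_goals simp [simStoreC]
  · funext r
    cases r <;> simp [simStoreC, simStoreB, simStoreA, collNum, hx.cf]

end PACRE

/-! ### Choice between the coins and the hyperedge -/

namespace PACRE

theorem collNum_le (k b : ℕ) (l : List Bool) : collNum k b l ≤ k * k := by
  calc collNum k b l ≤ ∑ j ∈ Finset.range k, k := by
        refine Finset.sum_le_sum fun j hj => ?_
        calc _ ≤ ∑ i ∈ Finset.range j, 1 := Finset.sum_le_sum fun i _ => by split_ifs <;> simp
          _ ≤ k := by simpa using (Finset.mem_range.1 hj).le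
    _ = k * k := by simp

/-- The store after the decision between the coins and the hyperedge. -/
def simStoreD (k : ℕ) (x : (Reg → List Bool) × ℕ × ℕ) : Reg → List Bool
  | .tmp => if collNum k x.2.1 (x.1 .co) = 0 then (x.1 .gr).take (k * x.2.1)
      else (x.1 .co).take (k * x.2.1)
  | .co => (x.1 .co).drop (k * x.2.1)
  | .gr => (x.1 .gr).drop (k * x.2.1)
  | .lab => [simLabel k x.2.1 (x.1 .co) ((x.1 .yy).headD false)]
  | r => x.1 r

theorem simStoreC_w (k : ℕ) (x : (Reg → List Bool) × ℕ × ℕ) (i j : ℕ) :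
    simStoreC k k 0 x (.w i j) = [] := by
  simp only [simStoreC, simStoreB, simStoreA]
  split_ifs
  · rfl
  · omega
  · rfl

theorem polyBounded_mul_blk (k : ℕ) {H : (Reg → List Bool) × ℕ × ℕ → Prop}
    {f : (Reg → List Bool) × ℕ × ℕ → ℕ} (h : ∀ x, H x → f x ≤ k * x.2.1) :
    PolyBounded H (fun x => x.2.1 + x.2.2) f :=
  ((PolyBounded.const k).mul .size).mono fun x hx =>
    (h x hx).trans (Nat.mul_le_mul_left k (Nat.le_add_right _ _))

theorem reach_simStoreD (k : ℕ) : Reach (SimInst k) (fun x => x.2.1 + x.2.2) (simStoreC k k 0)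
    (simStoreD k) := by
  have hcf : ∀ x, simStoreC k k 0 x .cf = unary (collNum k x.2.1 (x.1 .co)) := by
    intro x; simp [simStoreC]
  -- The case of a repetition: the coins are kept, the hyperedge is discarded, the label is true. It
  -- serves both nonempty branches on `cf`, although `cf` only ever holds the symbol true.
  have hX : Reach (fun x => SimInst k x ∧ collNum k x.2.1 (x.1 .co) ≠ 0)
      (fun x => x.2.1 + x.2.2) (simStoreC k k 0) (simStoreD k) := by
    refine (Reach.pour .cw [.tmp] (by simp) (by simp) (polyBounded_mul_blk k fun x _ => ?_)
      fun _ _ => rfl).trans ((Reach.pour .ce [] (by simp) (by simp)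
        (polyBounded_mul_blk k fun x _ => ?_) fun _ _ => rfl).trans ((Reach.pour .cf [] (by simp)
          (by simp) ((PolyBounded.const (k * k)).mono fun x _ => ?_) fun _ _ => rfl).trans
            ((Reach.push _ .lab true).congr_right fun x hx => ?_)))
    · simp [simStoreC, simStoreB, simStoreA]
    · simp [pourStore, simStoreC, simStoreB]
    · simpa [pourStore, simStoreC] using collNum_le ..
    · obtain ⟨hx, hc⟩ := hx
      funext r
      cases r
      case w i j => simpa [pourStore, simStoreD, hx.w] using simStoreC_w ..
      all_goals simp [pourStore, simStoreC, simStoreB, simStoreA, simStoreD, simLabel, hc, hx.lab,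
        hx.tmp, hx.cw, hx.ce, hx.cf]
  refine .branch .cf ?_ (hX.imp fun x hx => ⟨hx.1, ?_⟩) (hX.imp fun x hx => ⟨hx.1, ?_⟩)
  · have hL : ∀ b : Bool, Reach (fun x => (SimInst k x ∧ simStoreC k k 0 x .cf = []) ∧
        (x.1 .yy).head? = some b)
        (fun x => x.2.1 + x.2.2)
        (fun x => pourStore .cw [] (pourStore .ce [.tmp] (simStoreC k k 0 x))) (simStoreD k) := by
      intro b
      refine (Reach.push _ .lab b).congr_right fun x hx => ?_
      obtain ⟨⟨hx, hc⟩, hy⟩ := hx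
      rw [hcf, unary_eq_nil] at hc
      have hy' : (x.1 .yy).head?.getD false = b := by rw [hy]; rfl
      funext r
      cases r
      case w i j => simpa [pourStore, simStoreD, hx.w] using simStoreC_w ..
      all_goals simp [pourStore, simStoreC, simStoreB, simStoreA, simStoreD, simLabel, hc, hx.lab,
        hx.tmp, hx.cw, hx.ce, hx.cf, hy']
    refine (Reach.pour .ce [.tmp] (by simp) (by simp) (polyBounded_mul_blk k fun x _ => ?_)
      fun _ _ => rfl).trans ((Reach.pour .cw [] (by simp) (by simp)
        (polyBounded_mul_blk k fun x _ => ?_) fun _ _ => rfl).trans (.branch .yy ?_ ?_ ?_))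
    · simp [simStoreC, simStoreB]
    · simp [pourStore, simStoreC, simStoreB, simStoreA]
    · refine (Reach.refl _).congr_right fun x hx => absurd ?_ hx.1.1.yy
      simpa [pourStore, simStoreC, simStoreB, simStoreA] using hx.2
    · exact (hL false).imp fun x hx => by
        simpa [pourStore, simStoreC, simStoreB, simStoreA] using hx
    · exact (hL true).imp fun x hx => by
        simpa [pourStore, simStoreC, simStoreB, simStoreA] using hx
  · intro h0; simp [hcf, h0] at hx
  · intro h0; simp [hcf, h0] at hx

/-- Whether or not there is a repetition, the same numbers of coins, hyperedge bits and label bits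
are consumed. Hence the j-th example depends on fixed windows of the input. -/
theorem reach_simStore (k : ℕ) : Reach (SimInst k) (fun x => x.2.1 + x.2.2) (fun x => x.1)
    (simStore k) := by
  refine (reach_simStoreA k).trans ((reach_simStoreB k).trans ((reach_simStoreC k).trans
    ((reach_simStoreD k).trans ((Reach.pop _ .yy).trans ((Reach.pour .tmp [.out] (by simp) (by simp)
    (polyBounded_mul_blk k fun x _ => ?_) fun _ _ => rfl).trans (Reach.take (m := fun x => x.2.2)
    .pp .co .tmp [.out] (by simp) (by simp) (by simp) (by simp) (by simp) (by simp) (by simp)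
    (PolyBounded.size.mono fun _ _ => by simp) (fun x hx => ?_) (fun x hx => ?_)
    fun x hx => ?_))))))
  · simp [simStoreD]; split_ifs <;> simp
  · simp [pourStore, simStoreD, hx.pp]
  · simp [pourStore]
  · have hW : collNum k x.2.1 ((x.1 .co).take (k * x.2.1 + x.2.2)) =
      collNum k x.2.1 (x.1 .co) := collNum_take (by omega)
    funext r
    cases r
    case out =>
      by_cases hc : collNum k x.2.1 (x.1 .co) = 0 <;>
        simp [takeStore, pourStore, simStoreD, simStore, simPoint, hW, hc, List.take_take,
          List.drop_take]
    case lab =>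
      simp [takeStore, pourStore, simStoreD, simStore, simLabel, hW]
    all_goals simp [takeStore, pourStore, simStoreD, simStore, hx.tmp]

end PACRE

namespace PACRE

/-! ### The distinguisher on well-formed inputs -/

theorem Reach.simulate {I : Type} {H : I → Prop} {sz : I → ℕ} (k : ℕ) (σ : I → Reg → List Bool)
    (b p : I → ℕ) (h : ∀ i, H i → SimInst k (σ i, b i, p i))
    (hb : PolyBounded H sz b) (hp : PolyBounded H sz p) :
    Reach H sz σ fun i => simStore k (σ i, b i, p i) :=
  (reach_simStore k).reindex (fun i => (σ i, b i, p i)) h (hb.add hp)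

/-- Filling the next input register amounts to appending an input, so the learner's bank can be
prepared in stages. -/
theorem update_clockedInit (l : List (List Bool)) (T : ℕ) (a : List Bool) :
    Function.update (clockedInit l T) (.inl l.length) a = clockedInit (l ++ [a]) T := by
  funext s
  rcases s with j | e
  · by_cases h : j = l.length
    · subst h; simp [clockedInit, initStore]
    · simp only [clockedInit, initStore, Function.update_apply, Sum.inl.injEq, h, if_false,
        Sum.elim_inl, List.getD_eq_getElem?_getD]
      rcases Nat.lt_or_gt_of_ne h with h | h
      · rw [List.getElem?_append_left h]
      · rw [List.getElem?_eq_none h.le, List.getElem?_eq_none (by simpa using h)]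
  · simp [clockedInit]

theorem update_clockedInit_zero (x a : List Bool) (l : List (List Bool)) (T : ℕ) :
    Function.update (clockedInit (x :: l) T) (.inl 0) a = clockedInit (a :: l) T := by
  funext s
  rcases s with (_ | j) | e <;> simp [clockedInit, initStore]

/-- The data that determine the distinguisher: the programs of the learner, the cardinality of the
hyperedges, the number of tests and of admissible errors, the confidence parameter, and polynomials
for the length of the examples, the size of the sample and the time bound. -/
structure DistParams where
  (learn predict : Prog)
  (k M θ d : ℕ)
  (nP qP tP cP : Polynomial ℕ)

/-- An input of the distinguisher: `2 ^ b` vertices, the hypergraph, the string to be judged and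
the coins. -/
structure DistInst where
  b : ℕ
  (gr yy co : List Bool)

namespace DistParams
variable (P : DistParams) (i : DistInst)

/-- The number of bits of an example. -/
def n : ℕ := P.nP.eval (2 ^ i.b)
/-- The number of examples. -/
def q : ℕ := P.qP.eval (2 ^ i.b)
/-- The time bound of the learner. -/
def T : ℕ := P.tP.eval (2 ^ i.b)

/-- The input has the required lengths. -/
structure Good : Prop where
  kb : P.k * i.b ≤ P.n i
  co : (P.q i + P.M) * P.n i ≤ i.co.length
  co' : i.co.length ≤ P.cP.eval (2 ^ i.b)
  gr : (P.q i + P.M) * (P.k * i.b) ≤ i.gr.length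
  yy : P.q i + P.M ≤ i.yy.length

/-- The `j`-th simulated point. -/
def point (j : ℕ) : List Bool :=
  simPoint P.k i.b ((i.co.drop (j * P.n i)).take (P.n i))
    ((i.gr.drop (j * (P.k * i.b))).take (P.k * i.b))

/-- The label of the `j`-th simulated point. -/
def label (j : ℕ) : Bool :=
  simLabel P.k i.b ((i.co.drop (j * P.n i)).take (P.n i)) ((i.yy.drop j).headD false)

/-- The first `j` simulated examples. -/
def sample (j : ℕ) : List Bool :=
  ((List.range j).map fun j' => P.point i j' ++ [P.label i j']).flatten

/-- The coins of the learner. -/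
def restCoins : List Bool := i.co.drop ((P.q i + P.M) * P.n i)

/-- The input of the learner. -/
def learnIn : List (List Bool) :=
  [unary (P.n i), unary P.d, P.sample i (P.q i), P.restCoins i]

/-- The hypothesis of the learner. -/
noncomputable def hyp : List Bool := clockedOut P.learn (P.learnIn i) (P.T i)

/-- The prediction of the hypothesis in the `t`-th test. -/
noncomputable def pred (t : ℕ) : List Bool :=
  clockedOut P.predict [P.hyp i, P.point i (P.q i + t)] (P.T i)

/-- The number of errors in the first `m` tests. -/
noncomputable def errs (m : ℕ) : ℕ :=
  ∑ t ∈ Finset.range m, if P.pred i t = [P.label i (P.q i + t)] then 0 else 1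

/-- The initial store. -/
def storeInit : Reg → List Bool
  | .nv => unary (2 ^ i.b)
  | .gr => i.gr
  | .yy => i.yy
  | .co => i.co
  | _ => []

/-- The store after the initialisation of the first `t` clocks. -/
def storeClocks (t : ℕ) : Reg → List Bool
  | .pr t' s => if t' < t then clockedInit [] (P.T i) s else []
  | r => storeInit i r

/-- The store after the initial computations. -/
def storeA : Reg → List Bool
  | .bb => unary i.b
  | .pp => unary (P.n i - P.k * i.b)
  | .qq => unary (P.q i)
  | .lr s => clockedInit [unary (P.n i), unary P.d] (P.T i) s
  | r => P.storeClocks i P.M r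

/-- The store after the simulation of `j` examples. -/
def storeB (j : ℕ) : Reg → List Bool
  | .co => i.co.drop (j * P.n i)
  | .gr => i.gr.drop (j * (P.k * i.b))
  | .yy => i.yy.drop j
  | .qq => unary (P.q i - j)
  | .out => (P.sample i j).reverse
  | r => P.storeA i r

/-- The store after the simulation of the sample and of `t` tests. -/
def storeC (t : ℕ) : Reg → List Bool
  | .co => i.co.drop ((P.q i + t) * P.n i)
  | .gr => i.gr.drop ((P.q i + t) * (P.k * i.b))
  | .yy => i.yy.drop (P.q i + t)
  | .qq => []
  | .lb t' => if t' < t then [P.label i (P.q i + t')] else []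
  | .lr s => clockedInit [unary (P.n i), unary P.d, P.sample i (P.q i)] (P.T i) s
  | .pr t' s => if t' < t then clockedInit [[], P.point i (P.q i + t')] (P.T i) s
      else if t' < P.M then clockedInit [] (P.T i) s else []
  | r => P.storeA i r

/-- The store after learning. -/
noncomputable def storeD : Reg → List Bool
  | .co => []
  | .lr s => clockedFinal P.learn (clockedInit (P.learnIn i) (P.T i)) s
  | r => P.storeC i P.M r

/-- The store after `t` predictions. -/
noncomputable def storeE (t : ℕ) : Reg → List Bool
  | .lr s => Function.update (clockedFinal P.learn (clockedInit (P.learnIn i) (P.T i))) (.inl 0) [] s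
  | .pr t' s => if t' < t then Function.update (clockedFinal P.predict
        (clockedInit [P.hyp i, P.point i (P.q i + t')] (P.T i))) (.inl 0) [] s
      else if t' < P.M then clockedInit [P.hyp i, P.point i (P.q i + t')] (P.T i) s else []
  | .lb t' => if t' < t then [] else if t' < P.M then [P.label i (P.q i + t')] else []
  | .er => unary (P.errs i t)
  | r => P.storeD i r

variable {P i}

theorem polyBounded_b : PolyBounded P.Good (fun i => 2 ^ i.b) fun i => i.b :=
  PolyBounded.size.mono fun _ _ => Nat.lt_two_pow_self.le

theorem polyBounded_n : PolyBounded P.Good (fun i => 2 ^ i.b) P.n := PolyBounded.eval P.nP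

theorem length_simPoint {k b n : ℕ} {W E : List Bool} (hW : W.length = n) (hE : E.length = k * b)
    (h : k * b ≤ n) : (simPoint k b W E).length = n := by
  rw [simPoint]; split_ifs <;> simp [hW, hE] <;> omega

theorem Good.length_point (h : P.Good i) {j : ℕ} (hj : j < P.q i + P.M) :
    (P.point i j).length = P.n i := by
  have h1 := Nat.mul_le_mul_right (P.n i) hj
  have h2 := Nat.mul_le_mul_right (P.k * i.b) hj
  have h3 := h.co
  have h4 := h.gr
  rw [Nat.succ_mul] at h1 h2
  refine length_simPoint ?_ ?_ h.kb
  · simp; omega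
  · simp; omega

theorem Good.length_sample (h : P.Good i) : ∀ {j : ℕ}, j ≤ P.q i + P.M →
    (P.sample i j).length = j * (P.n i + 1)
  | 0, _ => by simp [sample]
  | j + 1, hj => by
    have := h.length_sample (j := j) (by omega)
    rw [sample] at this ⊢
    rw [List.range_succ, List.map_append, List.flatten_append, List.length_append, this]
    simp [h.length_point (j := j) (by omega)]; ring

/-- Each of the M tests has its own bank of predictor registers, so nothing has to be cleaned up
between tests. The clocks of all banks are set here. -/
theorem reach_storeClocks : Reach P.Good (fun i => 2 ^ i.b) storeInit (fun i => P.storeClocks i P.M) := by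
  refine (Reach.range (S := fun t i => P.storeClocks i t) P.M fun t ht => ?_).congr
    (fun i _ => ?_) fun _ _ => rfl
  · refine (Reach.polyUnary Reg.nv .tmp .tmp2 (.pr t (.inr 0)) (by simp) (by simp) (by simp) (by simp)
      (by simp) (by simp) P.tP (fun i _ => rfl) (fun i _ => rfl) (fun i _ => rfl)
      (fun i _ => by simp [storeClocks])).congr_right fun i _ => ?_
    funext r
    cases r
    case pr t' s =>
      rcases lt_trichotomy t' t with h | rfl | h
      · simp [storeClocks, h, h.ne, Nat.lt_succ_of_lt h]
      · rcases s with j | (_ | e) <;> simp [storeClocks, clockedInit, initStore, T]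
      · have h' : ¬ t' < t + 1 := by omega
        have h'' : ¬ t' ≤ t := by omega
        simp [storeClocks, h.not_gt, h.ne', h'']
    all_goals simp [storeClocks]
  · funext r
    cases r <;> simp [storeClocks, storeInit]

theorem reach_storeA : Reach P.Good (fun i => 2 ^ i.b) storeInit P.storeA := by
  refine reach_storeClocks.trans (
    (Reach.polyUnary Reg.nv .tmp .tmp2 (.lr (.inl 0)) (by simp) (by simp) (by simp) (by simp)
      (by simp) (by simp) P.nP (fun i _ => rfl) (fun i _ => rfl) (fun i _ => rfl)
      (fun i _ => rfl)).trans (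
    (Reach.polyUnary Reg.nv .tmp .tmp2 (.lr (.inl 1)) (by simp) (by simp) (by simp) (by simp)
      (by simp) (by simp) (Polynomial.C P.d) (fun i _ => rfl) (fun i _ => rfl) (fun i _ => rfl)
      (fun i _ => rfl)).trans (
    (Reach.polyUnary Reg.nv .tmp .tmp2 (.lr (.inr 0)) (by simp) (by simp) (by simp) (by simp)
      (by simp) (by simp) P.tP (fun i _ => rfl) (fun i _ => rfl) (fun i _ => rfl)
      (fun i _ => rfl)).trans (
    (Reach.polyUnary Reg.nv .tmp .tmp2 .qq (by simp) (by simp) (by simp) (by simp)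
      (by simp) (by simp) P.qP (fun i _ => rfl) (fun i _ => rfl) (fun i _ => rfl)
      (fun i _ => rfl)).trans (
    (Reach.polyUnary Reg.nv .tmp .tmp2 .pp (by simp) (by simp) (by simp) (by simp)
      (by simp) (by simp) P.nP (fun i _ => rfl) (fun i _ => rfl) (fun i _ => rfl)
      (fun i _ => rfl)).trans (
    -- `lg` receives 2 ^ b and then loses one symbol, since `RExec.log` starts from 2 ^ b - 1.
    (Reach.polyUnary Reg.nv .tmp .tmp2 .lg (by simp) (by simp) (by simp) (by simp)
      (by simp) (by simp) Polynomial.X (fun i _ => rfl) (fun i _ => rfl) (fun i _ => rfl)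
      (fun i _ => rfl)).trans ((Reach.pop _ Reg.lg).trans ((Reach.of_bound (.log Reg.lg .tmp .bb)
      ((polyBounded_b.mul ((PolyBounded.size.mul (.const 13)).add (.const 4))).add (.const 1))
      fun i _ => RExec.log (by simp) (by simp) (by simp) i.b _ ?_ ?_ ?_).trans ?_))))))))
  · simp
  · simp [storeClocks, storeInit]
  · simp [storeClocks, storeInit]
  -- Taking b symbols without a destination subtracts b; k repetitions leave the padding length n -
  -- k * b in `pp`.
  · refine (Reach.range (S := fun m i r => if r = .pp then unary (P.n i - m * i.b) else P.storeA i r)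
      P.k fun m hm => ?_).congr (fun i _ => ?_) fun i _ => ?_
    · refine Reach.take (m := fun i => i.b) .bb .pp .tmp [] (by simp) (by simp) (by simp) (by simp)
        (by simp) (by simp) (by simp) polyBounded_b (fun i _ => rfl) (fun i _ => rfl) fun i _ => ?_
      funext r
      by_cases hr : r = .pp
      · simp [hr, takeStore, unary, add_mul, Nat.sub_sub]
      · simp [hr, takeStore]
    · funext r
      cases r
      case lr s =>
        rcases s with (_ | _ | j) | (_ | e) <;> simp [storeA, clockedInit, initStore, n, T, storeClocks, storeInit]
      all_goals simp [storeA, n, q, storeClocks, storeInit]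
    · funext r
      by_cases hr : r = .pp
      · simp [hr, storeA]
      · simp [hr]

theorem Good.simInst (h : P.Good i) {j : ℕ} (hj : j < P.q i + P.M) {σ : Reg → List Bool}
    (hσ : ∀ r ∈ [Reg.bb, .pp, .tmp, .ne, .cf, .cw, .ce, .lab], σ r = P.storeA i r)
    (hw : ∀ a b, σ (.w a b) = []) (hyy : σ .yy = i.yy.drop j) :
    SimInst P.k (σ, i.b, P.n i - P.k * i.b) := by
  have h6 := h.yy
  constructor <;> try (simp [hσ]; rfl)
  · simp [hyy]; omega
  · exact hw

theorem reach_storeB : Reach P.Good (fun i => 2 ^ i.b) P.storeA (fun i => P.storeB i (P.q i)) := by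
  refine (Reach.loop (S := P.storeB) (m := P.q) .qq (PolyBounded.eval P.qP)
    (fun i _ j hj => by simp [storeB]; omega) (fun i _ => by simp [storeB]) ?_).congr (fun i _ => ?_)
    fun _ _ => rfl
  -- A push has a fixed bit, so appending the label to the sample takes one program for each of its
  -- two values.
  · have hL : ∀ c : Bool, Reach (fun x : DistInst × ℕ => (P.Good x.1 ∧ x.2 < P.q x.1) ∧
        P.label x.1 x.2 = c) (fun x => 2 ^ x.1.b)
        (fun x => simStore P.k (Function.update (P.storeB x.1 x.2) .qq (P.storeB x.1 x.2 .qq).tail,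
          x.1.b, P.n x.1 - P.k * x.1.b)) fun x => P.storeB x.1 (x.2 + 1) := by
      intro c
      refine (Reach.push _ Reg.out c).trans ((Reach.pop _ Reg.lab).congr_right fun x hx => ?_)
      obtain ⟨⟨hg, hj⟩, hl⟩ := hx
      have hkb := hg.kb
      have e : P.k * x.1.b + (P.n x.1 - P.k * x.1.b) = P.n x.1 := by omega
      funext r
      cases r
      case out =>
        simp [simStore, storeB, sample, List.range_succ, e, point, label, ← hl]
      case lr s => simp [simStore, storeB]
      all_goals simp [simStore, storeB, e, storeA, storeClocks, storeInit, add_mul, Nat.sub_sub]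
    have hs : ∀ x : DistInst × ℕ, P.Good x.1 ∧ x.2 < P.q x.1 → SimInst P.k
        (Function.update (P.storeB x.1 x.2) .qq (P.storeB x.1 x.2 .qq).tail, x.1.b,
          P.n x.1 - P.k * x.1.b) := by
      intro x hx
      refine hx.1.simInst (j := x.2) (by omega) ?_ ?_ ?_
      · simp [storeB]
      · simp [storeB, storeA, storeClocks, storeInit]
      · simp [storeB]
    have hlab : ∀ x : DistInst × ℕ, P.Good x.1 → simStore P.k (Function.update (P.storeB x.1 x.2)
        .qq (P.storeB x.1 x.2 .qq).tail, x.1.b, P.n x.1 - P.k * x.1.b) .lab =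
          [P.label x.1 x.2] := by
      intro x hx
      have hkb := hx.kb
      have e : P.k * x.1.b + (P.n x.1 - P.k * x.1.b) = P.n x.1 := by omega
      simp [simStore, storeB, e, label]
    refine (Reach.pop (fun x : DistInst × ℕ => P.storeB x.1 x.2) Reg.qq).trans ((Reach.simulate P.k _ (fun x : DistInst × ℕ => x.1.b)
      (fun x => P.n x.1 - P.k * x.1.b) hs (PolyBounded.size.mono fun x _ => Nat.lt_two_pow_self.le)
      ((PolyBounded.eval P.nP).mono fun x _ => Nat.sub_le _ _)).trans (Reach.branch .lab
        ((Reach.refl _).congr_right fun x hx => absurd hx.2 (by simp [simStore]))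
        ((hL false).imp fun x hx => ⟨hx.1, ?_⟩) ((hL true).imp fun x hx => ⟨hx.1, ?_⟩)))
    · have := hx.2
      rw [hlab x hx.1.1] at this
      simpa using this
    · have := hx.2
      rw [hlab x hx.1.1] at this
      simpa using this
  · funext r
    cases r <;> simp [storeB, sample, storeA, storeClocks, storeInit]

theorem polyBounded_sample : PolyBounded P.Good (fun i => 2 ^ i.b)
    fun i => (P.sample i (P.q i)).length :=
  ((PolyBounded.eval P.qP).mul ((PolyBounded.eval P.nP).add (.const 1))).mono fun i hi => by
    rw [hi.length_sample (by omega)]; rfl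

/-- The sample has been accumulated in reverse; pouring it into the learner's input register
restores the order. -/
theorem reach_storeC_zero : Reach P.Good (fun i => 2 ^ i.b) (fun i => P.storeB i (P.q i))
    (fun i => P.storeC i 0) := by
  refine Reach.pour Reg.out [.lr (.inl 2)] (by simp) (by simp) (polyBounded_sample.mono fun i _ => ?_)
    fun i _ => ?_
  · simp [storeB]
  · funext r
    cases r
    case lr s =>
      have := congrFun (update_clockedInit [unary (P.n i), unary P.d] (P.T i) (P.sample i (P.q i))) s
      simp only [List.cons_append, List.nil_append, List.length_cons, List.length_nil] at this
      simp only [storeC, ← this]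
      by_cases h : s = .inl 2
      · subst h; simp [pourStore, storeB, storeA, clockedInit, initStore]
      · simp [pourStore, h, storeB, storeA]
    all_goals simp [pourStore, storeB, storeC, storeA, storeClocks, storeInit]

/-- The test points are prepared before the learner runs, because the coins that are left over are
handed to it as a whole. The labels wait in the registers `lb`. -/
theorem reach_storeC : Reach P.Good (fun i => 2 ^ i.b) (fun i => P.storeC i 0)
    (fun i => P.storeC i P.M) := by
  refine Reach.range (S := fun t i => P.storeC i t) P.M fun t ht => ?_
  have e : ∀ {i}, P.Good i → P.k * i.b + (P.n i - P.k * i.b) = P.n i := fun hi => by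
    have := hi.kb; omega
  have hs : ∀ x : DistInst, P.Good x → SimInst P.k (P.storeC x t, x.b, P.n x - P.k * x.b) := by
    intro x hx
    refine hx.simInst (j := P.q x + t) (by omega) ?_ ?_ ?_
    · simp [storeC]
    · simp [storeC, storeA, storeClocks, storeInit]
    · simp [storeC]
  refine (Reach.simulate P.k _ (fun x => x.b) (fun x => P.n x - P.k * x.b) hs
      polyBounded_b (polyBounded_n.mono fun x _ => Nat.sub_le _ _)).trans
      ((Reach.pour Reg.out [.pr t (.inl 1)] (by simp) (by simp) (polyBounded_n.mono fun i hi => ?_)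
        fun _ _ => rfl).trans (Reach.pour Reg.lab [.lb t] (by simp) (by simp) ((PolyBounded.const 1).mono
        fun i hi => ?_) fun i hi => ?_))
  · have := hi.length_point (j := P.q i + t) (by omega)
    rw [point] at this
    simp [simStore, e hi, storeC, this, storeA, storeClocks, storeInit]
  · simp [pourStore, simStore]
  · funext r
    cases r
    case lb t' =>
      rcases lt_trichotomy t' t with h | rfl | h
      · simp [pourStore, simStore, storeC, h, h.ne, Nat.lt_succ_of_lt h]
      · simp [pourStore, simStore, storeC, label, e hi]
      · have h'' : ¬ t' ≤ t := by omega
        simp [pourStore, simStore, storeC, h.not_gt, h.ne', h'']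
    case pr t' s =>
      rcases lt_trichotomy t' t with h | rfl | h
      · simp [pourStore, simStore, storeC, h, h.ne, Nat.lt_succ_of_lt h]
      · rcases s with (_ | _ | j) | _ <;>
        simp [pourStore, simStore, storeC, point, e hi, ht, clockedInit, initStore, storeA,
          storeClocks, storeInit]
      · have h'' : ¬ t' ≤ t := by omega
        simp [pourStore, simStore, storeC, h.not_gt, h.ne', h'']
    all_goals simp [pourStore, simStore, storeC, storeA, storeClocks, storeInit, e hi]
    all_goals ring_nf

end DistParams
end PACRE

/-! ### Learning, prediction and the verdict -/

namespace PACRE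
namespace DistParams
variable {P : DistParams} {i : DistInst}

theorem polyBounded_hyp : PolyBounded P.Good (fun i => 2 ^ i.b) fun i => (P.hyp i).length := by
  obtain ⟨A, hA⟩ := clockedOut_length P.learn
  refine ((PolyBounded.eval P.nP).add ((PolyBounded.const A).mul ((PolyBounded.const 1).add
    (PolyBounded.eval P.tP)))).mono fun i _ => (hA _ _).trans ?_
  simp [learnIn, initStore, n, T]

theorem polyBounded_pred (t : ℕ) :
    PolyBounded P.Good (fun i => 2 ^ i.b) fun i => (P.pred i t).length := by
  obtain ⟨A, hA⟩ := clockedOut_length P.predict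
  refine (polyBounded_hyp.add ((PolyBounded.const A).mul ((PolyBounded.const 1).add
    (PolyBounded.eval P.tP)))).mono fun i _ => (hA _ _).trans ?_
  simp [initStore, T]

theorem reach_storeD : Reach P.Good (fun i => 2 ^ i.b) (fun i => P.storeC i P.M) P.storeD := by
  refine (Reach.pour Reg.co [.tmp] (by simp) (by simp) ((PolyBounded.eval P.cP).mono fun i hi => ?_)
    fun _ _ => rfl).trans ((Reach.pour Reg.tmp [.lr (.inl 3)] (by simp) (by simp)
    ((PolyBounded.eval P.cP).mono fun i hi => ?_) fun _ _ => rfl).trans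
    (Reach.clocked (inputs := P.learnIn) (T := P.T) P.learn Reg.lr (fun a b h => by simpa using h)
      (PolyBounded.eval P.tP) (fun i hi => ?_) (fun i hi => ?_) fun i hi r hr => ?_))
  · have := hi.co'
    simp [storeC]; omega
  · have := hi.co'
    simp [pourStore, storeC, storeA, storeClocks, storeInit]; omega
  · have := update_clockedInit [unary (P.n i), unary P.d, P.sample i (P.q i)] (P.T i) (P.restCoins i)
    simp only [List.cons_append, List.nil_append, List.length_cons, List.length_nil] at this
    rw [learnIn, ← this]
    funext s
    by_cases h : s = .inl 3
    · subst h
      simp [pourStore, storeC, storeA, storeClocks, storeInit, clockedInit, initStore, restCoins]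
    · simp [pourStore, storeC, h]
  · rfl
  · cases r
    case lr s => exact absurd ⟨s, rfl⟩ hr
    all_goals simp [pourStore, storeD, storeC, storeA, storeClocks, storeInit]

/-- One pour distributes the hypothesis to all predictor banks at once; the detour through `tmp`
cancels the reversal. -/
theorem reach_storeE_zero : Reach P.Good (fun i => 2 ^ i.b) P.storeD (fun i => P.storeE i 0) := by
  refine (Reach.pour (.lr (.inl 0)) [.tmp] (by simp) (by simp)
    (polyBounded_hyp.mono fun i _ => le_rfl) fun _ _ => rfl).trans (Reach.pour Reg.tmp
    ((List.range P.M).map fun t => .pr t (.inl 0)) (by simp)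
    (List.nodup_range.map fun a b h => by simpa using h) (polyBounded_hyp.mono fun i hi => ?_)
    fun i hi => ?_)
  · simp [pourStore, storeD, storeC, storeA, storeClocks, storeInit, hyp, clockedOut]
  · funext r
    cases r
    case lr s =>
      by_cases h : s = .inl 0
      · subst h; simp [pourStore, storeE]
      · simp [pourStore, storeE, h, storeD]
    case pr t s =>
      by_cases ht : t < P.M
      · have := congrFun (update_clockedInit_zero [] (P.hyp i) [P.point i (P.q i + t)] (P.T i)) s
        by_cases h : s = .inl 0
        · subst h
          simp [pourStore, storeE, storeD, storeC, storeA, storeClocks, storeInit, hyp, clockedOut, ht,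
            clockedInit, initStore]
        · have h' : ¬ Sum.inl 0 = s := fun e => h e.symm
          simpa [pourStore, storeE, storeD, storeC, h, h', ht] using this
      · simp [pourStore, storeE, storeD, storeC, ht]
    case lb t => simp [pourStore, storeE, storeD, storeC]
    case er => simp [pourStore, storeE, storeD, storeC, storeA, storeClocks, storeInit, errs]
    all_goals simp [pourStore, storeE, storeD, storeC, storeA, storeClocks, storeInit]

/-- The store after `t` complete tests and the prediction in the next one. -/
noncomputable def storeF (P : DistParams) (t : ℕ) (i : DistInst) : Reg → List Bool
  | .pr t' s => if t' = t then clockedFinal P.predict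
      (clockedInit [P.hyp i, P.point i (P.q i + t')] (P.T i)) s else P.storeE i t (.pr t' s)
  | r => P.storeE i t r

theorem reach_storeE : Reach P.Good (fun i => 2 ^ i.b) (fun i => P.storeE i 0)
    (fun i => P.storeE i P.M) := by
  refine Reach.range (S := fun t i => P.storeE i t) P.M fun t ht => ?_
  refine (Reach.clocked (inputs := fun i => [P.hyp i, P.point i (P.q i + t)]) (T := P.T)
    (σ' := P.storeF t) P.predict (Reg.pr t) (fun a b h => by simpa using h)
      (PolyBounded.eval P.tP) (fun i hi => ?_) (fun i hi => ?_) fun i hi r hr => ?_).trans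
    (.cmpPush false (.pr t (.inl 0)) (.lb t) .ne .er (by simp) (by simp) (by simp) (by simp)
      (by simp) (by simp) ((polyBounded_pred t).mono fun i _ => ?_)
      ((PolyBounded.const 1).mono fun i _ => ?_) (fun i _ => ?_) fun i hi => ?_)
  · funext s; simp [storeE, ht]
  · funext s; simp [storeF]
  · cases r
    case pr t' s =>
      have : t' ≠ t := by rintro rfl; exact hr ⟨s, rfl⟩
      simp [storeF, this]
    all_goals rfl
  · simp [storeF, pred, clockedOut]
  · simp [storeF, storeE, ht]
  · simp [storeF, storeE, storeD, storeC, storeA, storeClocks, storeInit]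
  · funext r
    cases r
    case er =>
      by_cases h : P.pred i t = [P.label i (P.q i + t)]
      · have h' := h
        simp only [pred, clockedOut] at h'
        simp [cmpStore, storeF, storeE, h', ht, errs, Finset.sum_range_succ, h]
      · have h' := h
        simp only [pred, clockedOut] at h'
        simp [cmpStore, storeF, storeE, h', ht, errs, Finset.sum_range_succ, h, unary_succ]
    case lb t' =>
      rcases lt_trichotomy t' t with h | rfl | h
      · simp [cmpStore, storeF, storeE, h, h.ne, Nat.lt_succ_of_lt h]
      · simp [cmpStore, storeE]
      · have h'' : ¬ t' ≤ t := by omega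
        simp [cmpStore, storeF, storeE, h.not_gt, h.ne', h'']
    case pr t' s =>
      rcases lt_trichotomy t' t with h | rfl | h
      · simp [cmpStore, storeF, storeE, h, h.ne, Nat.lt_succ_of_lt h]
      · by_cases hs : s = .inl 0
        · simp [cmpStore, storeE, hs]
        · simp [cmpStore, storeE, hs, storeF]
      · have h'' : ¬ t' ≤ t := by omega
        simp [cmpStore, storeF, storeE, h.not_gt, h.ne', h'']
    all_goals simp [cmpStore, storeF, storeE, storeD]

/-- The final store. -/
noncomputable def storeG (P : DistParams) (i : DistInst) : Reg → List Bool
  | .nv => if P.errs i P.M ≤ P.θ then [true] else []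
  | .er => unary (P.errs i P.M - P.θ)
  | r => P.storeE i P.M r

/-- Popping `er` θ times performs a truncated subtraction, so `er` ends up empty exactly when the
errors do not exceed θ. The verdict goes to `nv`, which becomes the output register 0. -/
theorem reach_storeG : Reach P.Good (fun i => 2 ^ i.b) (fun i => P.storeE i P.M) P.storeG := by
  have h1 : Reach P.Good (fun i => 2 ^ i.b) (fun i => P.storeE i P.M)
      fun i => Function.update (P.storeE i P.M) .er (unary (P.errs i P.M - P.θ)) := by
    refine (Reach.range (S := fun t i => Function.update (P.storeE i P.M) .er
      (unary (P.errs i P.M - t))) P.θ fun t _ => ?_).congr (fun i _ => ?_) fun i _ => rfl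
    · exact (Reach.pop _ Reg.er).congr_right fun i _ => by simp [Nat.sub_sub]
    · rw [Nat.sub_zero, Function.update_eq_iff]; exact ⟨rfl, fun _ _ => rfl⟩
  have h2 : Reach (fun i => P.Good i ∧ ¬ P.errs i P.M ≤ P.θ) (fun i => 2 ^ i.b)
      (fun i => pourStore .nv [] (Function.update (P.storeE i P.M) .er
        (unary (P.errs i P.M - P.θ)))) P.storeG := by
    refine (Reach.refl _).congr_right fun i hi => ?_
    funext r
    cases r <;> simp [pourStore, storeG, hi.2]
  refine h1.trans ((Reach.pour Reg.nv [] (by simp) (by simp) (PolyBounded.size.mono fun i _ => ?_)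
    fun _ _ => rfl).trans (Reach.branch .er ((Reach.push _ Reg.nv true).congr_right fun i hi => ?_)
      (h2.imp fun i hi => ⟨hi.1, ?_⟩) (h2.imp fun i hi => ⟨hi.1, ?_⟩)))
  · simp [storeE, storeD, storeC, storeA, storeClocks, storeInit]
  · have h0 : P.errs i P.M ≤ P.θ := by
      have := hi.2
      simp [pourStore] at this
      omega
    funext r
    cases r <;> simp [pourStore, storeG, h0]
  all_goals
    intro h0
    have := hi.2
    rw [← Nat.sub_eq_zero_iff_le] at h0
    simp [pourStore, h0] at this

theorem exists_program (P : DistParams) : ∃ (c : RProg Reg) (p : Polynomial ℕ), ∀ i, P.Good i →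
    ∃ t ≤ p.eval (2 ^ i.b), RExec c (storeInit i) t (P.storeG i) :=
  reach_storeA.trans (reach_storeB.trans (reach_storeC_zero.trans (reach_storeC.trans
    (reach_storeD.trans (reach_storeE_zero.trans (reach_storeE.trans reach_storeG))))))

end DistParams
end PACRE

/-! ### Compilation to a program that halts on all inputs -/

namespace PACRE

/-- There is an injective numbering of the registers under which the inputs have the numbers
`0, 1, 2, 3`. -/
theorem exists_numbering : ∃ e : Reg ⊕ ℕ → ℕ, Function.Injective e ∧ e (.inl .nv) = 0 ∧
    e (.inl .gr) = 1 ∧ e (.inl .yy) = 2 ∧ e (.inl .co) = 3 := by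
  obtain ⟨g, hg⟩ := exists_injective_nat (Reg ⊕ ℕ)
  refine ⟨fun
    | .inl .nv => 0
    | .inl .gr => 1
    | .inl .yy => 2
    | .inl .co => 3
    | x => g x + 4, ?_, rfl, rfl, rfl, rfl⟩
  intro x y h
  by_contra hne
  have hg' := hg.ne hne
  rcases x with x | x <;> rcases y with y | y
  · cases x <;> cases y <;> simp_all
  · cases x <;> simp_all
  · cases y <;> simp_all
  · simp_all

namespace DistParams

/-- The program of the distinguisher. -/
theorem exists_prog (P : DistParams) : ∃ (c : Prog) (p : Polynomial ℕ),
    (∀ N gr yy co, HaltsWithin c [unary N, gr, yy, co] (p.eval N)) ∧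
    ∀ i : DistInst, P.Good i → (OutputsWithin c [unary (2 ^ i.b), i.gr, i.yy, i.co]
      (p.eval (2 ^ i.b)) [true] ↔ P.errs i P.M ≤ P.θ) := by
  obtain ⟨c, p, hc⟩ := P.exists_program
  obtain ⟨A, hA⟩ := c.clocked_halts
  obtain ⟨e, he, h0, h1, h2, h3⟩ := exists_numbering
  -- A preliminary program computes the time bound p of c in unary, directly into the clock register
  -- of the clocked version of c.
  obtain ⟨c', p', hc'⟩ := exists_polyUnary (ι := Reg ⊕ ℕ) (src := .inl .nv) (acc := .inl .tmp)
    (tmp := .inl .tmp2) (dst := .inr 0) (by simp) (by simp) (by simp) (by simp) (by simp) (by simp) p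
  have hinit : ∀ N gr yy co, ∃ st : Reg ⊕ ℕ → List Bool,
      initStore [unary N, gr, yy, co] ∘ e = st ∧ st (.inl .nv) = unary N ∧ st (.inl .gr) = gr ∧
      st (.inl .yy) = yy ∧ st (.inl .co) = co ∧ ∀ x, x ≠ .inl .nv → x ≠ .inl .gr → x ≠ .inl .yy →
        x ≠ .inl .co → st x = [] := by
    intro N gr yy co
    refine ⟨_, rfl, by simp [h0, initStore], by simp [h1, initStore], by simp [h2, initStore],
      by simp [h3, initStore], fun x n0 n1 n2 n3 => ?_⟩
    have k0 := he.ne n0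
    have k1 := he.ne n1
    have k2 := he.ne n2
    have k3 := he.ne n3
    rw [h0] at k0; rw [h1] at k1; rw [h2] at k2; rw [h3] at k3
    have : 4 ≤ e x := by omega
    simp [initStore, this]
  -- Termination is obtained for every N and all strings, whereas the correctness of c is only known
  -- on good instances.
  have hrun : ∀ N gr yy co, ∃ t x st' τ', RExec (.seq c' (c.clocked 0))
      (initStore [unary N, gr, yy, co] ∘ e) (t + x) τ' ∧ t ≤ p'.eval N ∧ x ≤ A * (1 + p.eval N) ∧
      RExec (c.clocked 0) st' x τ' ∧
      st' = Function.update (initStore [unary N, gr, yy, co] ∘ e) (.inr 0) (unary (p.eval N)) := by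
    intro N gr yy co
    obtain ⟨st, hst, g0, g1, g2, g3, g4⟩ := hinit N gr yy co
    rw [hst]
    obtain ⟨t, ht, hx⟩ := hc' st N g0 (g4 _ (by simp) (by simp) (by simp) (by simp))
      (g4 _ (by simp) (by simp) (by simp) (by simp)) (g4 _ (by simp) (by simp) (by simp) (by simp))
    obtain ⟨T, x, τ', hx', hl, hT, -⟩ := hA 0 (Function.update st (.inr 0) (unary (p.eval N)))
      (by
        intro e he
        rw [Function.update_of_ne (by simpa using he.ne')]
        exact g4 _ (by simp) (by simp) (by simp) (by simp))
    refine ⟨t, T, _, τ', .seq hx hx', ht, hT.trans (Nat.mul_le_mul_left _ ?_), hx', rfl⟩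
    simp at hl; omega
  refine ⟨(RProg.seq c' (c.clocked 0)).toProg e, p' + Polynomial.C A * (1 + p), ?_, ?_⟩
  · intro N gr yy co
    obtain ⟨t, x, st', τ', hx, ht, hxA, -⟩ := hrun N gr yy co
    obtain ⟨σ, hσ, -⟩ := hx.toProg he _ rfl
    exact ⟨_, by simp; omega, σ, hσ⟩
  · intro i hi
    obtain ⟨t, x, st', τ', hx, ht, hxA, hx', hst'⟩ := hrun (2 ^ i.b) i.gr i.yy i.co
    obtain ⟨σ, hσ, hσe⟩ := hx.toProg he _ rfl
    obtain ⟨s, hs, hD⟩ := hc i hi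
    obtain ⟨st, hst, g0, g1, g2, g3, g4⟩ := hinit (2 ^ i.b) i.gr i.yy i.co
    rw [hst] at hst'
    -- On a good instance the clock suffices, so the clocked run ends with the verdict of c;
    -- determinism identifies it with the run found above.
    obtain ⟨T, τ'', hx'', hl, -, -⟩ := hD.clocked 0 st' (by
        rw [hst']
        funext r
        cases r <;> simp [storeInit, g0, g1, g2, g3]
        all_goals exact g4 _ (by simp) (by simp) (by simp) (by simp))
      (by simpa [hst'] using hs)
      (by
        intro e he
        rw [hst', Function.update_of_ne (by simpa using he.ne')]
        exact g4 _ (by simp) (by simp) (by simp) (by simp))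
    have hout : σ 0 = if P.errs i P.M ≤ P.θ then [true] else [] := by
      have e1 : σ 0 = τ' (.inl .nv) := by rw [← hσe, ← h0]; rfl
      rw [e1, (hx'.unique hx'').2]
      exact congrFun hl .nv
    constructor
    · rintro ⟨t', -, σ', hσ', h⟩
      rw [← (hσ.unique hσ').2, hout] at h
      by_contra hn
      simp [hn] at h
    · intro h
      exact ⟨_, by simp; omega, σ, hσ, by rw [hout, if_pos h]⟩

end DistParams
end PACRE

namespace PACRE

/-! ### Uniform probabilities -/

section
variable {α β : Type} [Fintype α] [Fintype β]

open Classical in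
theorem prob_eq_sum (p : α → Prop) :
    prob p = (∑ a, if p a then (1 : ℝ) else 0) / Fintype.card α := by
  rw [prob, Finset.sum_boole, Nat.card_eq_fintype_card, Fintype.card_subtype]

theorem prob_nonneg (p : α → Prop) : 0 ≤ prob p := by unfold prob; positivity

theorem prob_mono {p q : α → Prop} (h : ∀ a, p a → q a) : prob p ≤ prob q := by
  classical
  rw [prob_eq_sum, prob_eq_sum]
  gcongr with a
  split_ifs with h1 h2
  · rfl
  · exact absurd (h a h1) h2
  · norm_num
  · rfl

theorem prob_congr {p q : α → Prop} (h : ∀ a, p a ↔ q a) : prob p = prob q :=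
  congrArg prob (funext fun a => propext (h a))

theorem prob_or_le (p q : α → Prop) : prob (fun a => p a ∨ q a) ≤ prob p + prob q := by
  classical
  rw [prob_eq_sum, prob_eq_sum, prob_eq_sum, ← add_div, ← Finset.sum_add_distrib]
  gcongr with a
  by_cases h1 : p a <;> by_cases h2 : q a <;> simp [h1, h2]

theorem prob_exists_le (m : ℕ) (p : ℕ → α → Prop) {ε : ℝ} (h : ∀ t < m, prob (p t) ≤ ε) :
    prob (fun a => ∃ t < m, p t a) ≤ m * ε := by
  induction m with
  | zero => simp [prob]
  | succ m ih =>
    calc prob (fun a => ∃ t < m + 1, p t a)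
        ≤ prob (fun a => (∃ t < m, p t a) ∨ p m a) := prob_mono fun a ⟨t, ht, hp⟩ => by
          rcases Nat.lt_succ_iff_lt_or_eq.1 ht with h | rfl
          · exact .inl ⟨t, h, hp⟩
          · exact .inr hp
      _ ≤ _ := prob_or_le _ _
      _ ≤ m * ε + ε := add_le_add (ih fun t ht => h t (by omega)) (h m (by omega))
      _ = _ := by push_cast; ring

theorem prob_not [Nonempty α] (p : α → Prop) : prob (fun a => ¬ p a) = 1 - prob p := by
  classical
  have hc : (Fintype.card α : ℝ) ≠ 0 := by positivity
  rw [eq_sub_iff_add_eq, prob_eq_sum, prob_eq_sum, ← add_div, ← Finset.sum_add_distrib,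
    div_eq_one_iff_eq hc, Finset.sum_congr rfl (g := fun _ => (1 : ℝ)) fun a _ => by
      by_cases h : p a <;> simp [h]]
  simp

theorem prob_equiv (e : α ≃ β) (p : β → Prop) : prob (fun a => p (e a)) = prob p := by
  rw [prob, prob, Nat.card_congr (e.subtypeEquiv (p := fun a => p (e a)) (q := p) fun _ => Iff.rfl),
    Fintype.card_congr e]

theorem prob_prod (p : α × β → Prop) :
    prob p = (∑ a, prob fun b => p (a, b)) / Fintype.card α := by
  classical
  simp only [prob_eq_sum]
  rw [Fintype.sum_prod_type, ← Finset.sum_div, Fintype.card_prod, div_div, Nat.cast_mul, mul_comm]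

/-- Conditioning on the first component: a bound valid on every fibre is valid on the product. -/
theorem prob_prod_le {p : α × β → Prop} {ε : ℝ} (hε : 0 ≤ ε)
    (h : ∀ a, prob (fun b => p (a, b)) ≤ ε) : prob p ≤ ε := by
  rw [prob_prod]
  refine div_le_of_le_mul₀ (by positivity) hε ?_
  calc _ ≤ ∑ _a : α, ε := Finset.sum_le_sum fun a _ => h a
    _ = _ := by simp [mul_comm]

theorem prob_fst [Nonempty β] (p : α → Prop) : prob (fun x : α × β => p x.1) = prob p := by
  classical
  have hc : (Fintype.card β : ℝ) ≠ 0 := by positivity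
  rw [prob_prod, prob_eq_sum p]
  congr 1
  refine Finset.sum_congr rfl fun a _ => ?_
  by_cases h : p a <;> simp [prob_eq_sum, h, hc]

theorem prob_snd [Nonempty α] (p : β → Prop) : prob (fun x : α × β => p x.2) = prob p :=
  (prob_equiv (Equiv.prodComm α β) fun x => p x.1).trans (prob_fst p)

theorem prob_eval {ι : Type} [Fintype ι] [DecidableEq ι] [Nonempty α] (i : ι) (p : α → Prop) :
    prob (fun v : ι → α => p (v i)) = prob p :=
  (prob_equiv (Equiv.funSplitAt i α) fun x => p x.1).trans (prob_fst p)

/-- The second moment of a sum of independent centred variables. In the induction step the cross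
term vanishes because g has sum zero. -/
theorem sum_sq_le [Nonempty α] (g : α → ℝ) (h0 : ∑ a, g a = 0) (h1 : ∀ a, g a ^ 2 ≤ 1) : ∀ m : ℕ,
    ∑ v : Fin m → α, (∑ t, g (v t)) ^ 2 ≤ m * (Fintype.card α : ℝ) ^ m
  | 0 => by simp
  | m + 1 => by
    have ih := sum_sq_le g h0 h1 m
    have hs : ∑ a, g a ^ 2 ≤ Fintype.card α := by
      calc _ ≤ ∑ _a : α, (1 : ℝ) := Finset.sum_le_sum fun a _ => h1 a
        _ = _ := by simp
    rw [← (Fin.consEquiv fun _ => α).sum_comp, Fintype.sum_prod_type]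
    simp only [Fin.consEquiv, Equiv.coe_fn_mk, Fin.sum_univ_succ, Fin.cons_zero, Fin.cons_succ]
    calc ∑ a, ∑ v : Fin m → α, (g a + ∑ t, g (v t)) ^ 2
        = ∑ a, (g a ^ 2 * (Fintype.card α : ℝ) ^ m + g a * (2 * ∑ v : Fin m → α, ∑ t, g (v t))
            + ∑ v : Fin m → α, (∑ t, g (v t)) ^ 2) := by
          refine Finset.sum_congr rfl fun a _ => ?_
          simp only [add_sq, Finset.sum_add_distrib]
          simp only [← Finset.mul_sum, Finset.sum_const, Finset.card_univ, nsmul_eq_mul, Fintype.card_fun, Fintype.card_fin]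
          push_cast
          ring
      _ = (∑ a, g a ^ 2) * (Fintype.card α : ℝ) ^ m
            + Fintype.card α * ∑ v : Fin m → α, (∑ t, g (v t)) ^ 2 := by
          rw [Finset.sum_add_distrib, Finset.sum_add_distrib, ← Finset.sum_mul, ← Finset.sum_mul, h0]
          simp
      _ ≤ Fintype.card α * (Fintype.card α : ℝ) ^ m
            + Fintype.card α * (m * (Fintype.card α : ℝ) ^ m) := by gcongr
      _ = _ := by push_cast; ring

open Classical in
/-- Chebyshev's inequality for independent repetitions of an experiment. -/
theorem prob_deviation_le [Nonempty α] (S : α → Prop) (m : ℕ) {a : ℝ} (ha : 0 < a) :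
    prob (fun v : Fin m → α => a ≤ |(∑ t, if S (v t) then (1 : ℝ) else 0) - m * prob S|) ≤
      m / a ^ 2 := by
  set g : α → ℝ := fun x => (if S x then 1 else 0) - prob S with hg
  have hc : (Fintype.card α : ℝ) ≠ 0 := by positivity
  have hp0 := prob_nonneg S
  have hp1 : prob S ≤ 1 := by
    have := prob_not S
    have := prob_nonneg fun a => ¬ S a
    linarith
  have h0 : ∑ x, g x = 0 := by
    simp only [hg, Finset.sum_sub_distrib]
    rw [prob_eq_sum S]
    simp only [Finset.sum_const, Finset.card_univ, nsmul_eq_mul]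
    field_simp
    simp
  have h1 : ∀ x, g x ^ 2 ≤ 1 := by
    intro x
    simp only [hg]
    split_ifs <;> nlinarith
  have key := sum_sq_le g h0 h1 m
  have hS : ∀ v : Fin m → α, (∑ t, if S (v t) then (1 : ℝ) else 0) - m * prob S = ∑ t, g (v t) := by
    intro v; simp [hg, Finset.sum_sub_distrib]
  rw [prob_eq_sum, div_le_div_iff₀ (by positivity) (by positivity), Finset.sum_mul]
  calc _ ≤ ∑ v : Fin m → α, (∑ t, g (v t)) ^ 2 := by
        refine Finset.sum_le_sum fun v _ => ?_
        rw [hS]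
        split_ifs with h
        · rw [one_mul, ← sq_abs (∑ t, g (v t))]; gcongr
        · rw [zero_mul]; positivity
    _ ≤ _ := key
    _ = _ := by simp

end
end PACRE

namespace PACRE

/-! ### Blocks of bits as vertices -/

section
variable {b k n : ℕ}

/-- The vertex described by the `i`-th block of `b` bits of `w`. -/
def bitVertex (b : ℕ) {n : ℕ} (w : Fin n → Bool) (i : ℕ) : Fin (2 ^ b) :=
  ⟨Nat.ofBits fun l : Fin b => if h : i * b + l < n then w ⟨i * b + l, h⟩ else false,
    Nat.ofBits_lt_two_pow _⟩

/-- The tuple of vertices described by the first `k` blocks of `w`. -/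
def bitTuple (b k : ℕ) {n : ℕ} (w : Fin n → Bool) : Fin k → Fin (2 ^ b) := fun i => bitVertex b w i

/-- Replace the first `k` blocks of `w` by the description of the tuple `v`. -/
def setBlocks (v : Fin k → Fin (2 ^ b)) (w : Fin n → Bool) : Fin n → Bool := fun j =>
  if h : (j : ℕ) / b < k then (v ⟨j / b, h⟩ : ℕ).testBit (j % b) else w j

theorem testBit_bitVertex (w : Fin n → Bool) {i l : ℕ} (hl : l < b) (h : i * b + l < n) :
    (bitVertex b w i : ℕ).testBit l = w ⟨i * b + l, h⟩ := by
  simp only [bitVertex]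
  rw [Nat.testBit_ofBits_lt _ _ hl]
  simp [h]

theorem fin_two_pow_ext {u v : Fin (2 ^ b)}
    (h : ∀ l < b, (u : ℕ).testBit l = (v : ℕ).testBit l) : u = v := by
  refine Fin.ext (Nat.eq_of_testBit_eq fun l => ?_)
  by_cases hl : l < b
  · exact h l hl
  · have hle : 2 ^ b ≤ 2 ^ l := Nat.pow_le_pow_right (by norm_num) (by omega)
    rw [Nat.testBit_lt_two_pow (u.2.trans_le hle), Nat.testBit_lt_two_pow (v.2.trans_le hle)]

theorem block_index_lt {i l : ℕ} (hi : i < k) (hl : l < b) (h : k * b ≤ n) : i * b + l < n := by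
  have := Nat.mul_le_mul_right b hi
  rw [Nat.succ_mul] at this; omega

theorem bitTuple_setBlocks (h : k * b ≤ n) (v : Fin k → Fin (2 ^ b)) (w : Fin n → Bool) :
    bitTuple b k (setBlocks v w) = v := by
  funext i
  refine fin_two_pow_ext fun l hl => ?_
  have hd : (i * b + l) / b = i := by
    rw [mul_comm, Nat.mul_add_div (by omega), Nat.div_eq_of_lt hl, add_zero]
  have hm : (i * b + l) % b = l := by
    rw [mul_comm, Nat.mul_add_mod, Nat.mod_eq_of_lt hl]
  rw [bitTuple, testBit_bitVertex _ hl (block_index_lt i.2 hl h)]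
  simp [setBlocks, hd, hm]

theorem setBlocks_bitTuple (hb : 0 < b) (w : Fin n → Bool) : setBlocks (bitTuple b k w) w = w := by
  funext j
  simp only [setBlocks, bitTuple]
  split_ifs with h
  · have hj : j / b * b + j % b = (j : ℕ) := Nat.div_add_mod' j b
    rw [testBit_bitVertex _ (Nat.mod_lt _ hb) (by rw [hj]; exact j.2)]
    congr 1
    exact Fin.ext hj
  · rfl

theorem setBlocks_setBlocks (u v : Fin k → Fin (2 ^ b)) (w : Fin n → Bool) :
    setBlocks u (setBlocks v w) = setBlocks u w := by
  funext j
  simp only [setBlocks]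
  split_ifs <;> rfl

open Classical in
/-- Exchange a tuple of distinct vertices and the tuple described by `w`, if the latter consists of
distinct vertices. -/
noncomputable def swapTuple (x : (Fin k ↪ Fin (2 ^ b)) × (Fin n → Bool)) :
    (Fin k ↪ Fin (2 ^ b)) × (Fin n → Bool) :=
  if h : Function.Injective (bitTuple b k x.2) then (⟨_, h⟩, setBlocks x.1 x.2) else x

/-- Writing E into w makes E the tuple of the new word, which is again free of repetitions; a second
exchange therefore takes the same branch and undoes the first. As a bijection of a finite set, the
exchange preserves the uniform distribution, so the simulated point is uniform. -/
theorem swapTuple_involutive (hb : 0 < b) (h : k * b ≤ n) :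
    Function.Involutive (swapTuple (b := b) (k := k) (n := n)) := by
  rintro ⟨E, w⟩
  by_cases hw : Function.Injective (bitTuple b k w)
  · have h1 : swapTuple (E, w) = (⟨_, hw⟩, setBlocks E w) := dif_pos hw
    have h2 : Function.Injective (bitTuple b k (setBlocks E w)) := by
      rw [bitTuple_setBlocks h]; exact E.injective
    rw [h1, swapTuple, dif_pos h2]
    simp only [bitTuple_setBlocks h, setBlocks_setBlocks, Prod.mk.injEq]
    exact ⟨rfl, setBlocks_bitTuple hb w⟩
  · have h1 : swapTuple (E, w) = (E, w) := dif_neg hw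
    rw [h1, h1]

/-- The simulated points, exchanged with the hyperedges. -/
noncomputable def swapEquiv (hb : 0 < b) (h : k * b ≤ n) (Q : ℕ) :
    Hypergraph (2 ^ b) Q k × (Fin Q → Fin n → Bool) ≃
      Hypergraph (2 ^ b) Q k × (Fin Q → Fin n → Bool) :=
  (Equiv.arrowProdEquivProdArrow _ _ _).symm.trans (((Equiv.refl (Fin Q)).arrowCongr
    (swapTuple_involutive hb h).toPerm).trans (Equiv.arrowProdEquivProdArrow _ _ _))

/-- Exchanging an arbitrary tuple with the tuple written in w is an involution, so the tuple of a
uniform word is uniform. -/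
theorem prob_bitTuple (hb : 0 < b) (h : k * b ≤ n) (p : (Fin k → Fin (2 ^ b)) → Prop) :
    prob (fun w : Fin n → Bool => p (bitTuple b k w)) = prob p := by
  have hinv : Function.Involutive fun x : (Fin k → Fin (2 ^ b)) × (Fin n → Bool) =>
      (bitTuple b k x.2, setBlocks x.1 x.2) := fun x => by
    simp only [bitTuple_setBlocks h, setBlocks_setBlocks, setBlocks_bitTuple hb]
  rw [← prob_snd (α := Fin k → Fin (2 ^ b)), ← prob_fst (β := Fin n → Bool) p]
  exact prob_equiv hinv.toPerm fun x => p x.1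

/-- A birthday bound. With N = 2 ^ b and k ≤ N, the falling factorial is at least (N + 1 - k) ^ k,
and Bernoulli's inequality bounds the failure by k * (k - 1) / N. For k > N the right-hand side
exceeds 1. -/
theorem prob_not_injective_le (hb : 0 < b) (h : k * b ≤ n) :
    prob (fun w : Fin n → Bool => ¬ Function.Injective (bitTuple b k w)) ≤ k ^ 2 / 2 ^ b := by
  rw [prob_not, prob_bitTuple hb h Function.Injective]
  have hN : (0 : ℝ) < 2 ^ b := by positivity
  have hN1 : (1 : ℝ) ≤ 2 ^ b := one_le_pow₀ (by norm_num)
  by_cases hk : k ≤ 2 ^ b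
  · have hcard : prob (Function.Injective : (Fin k → Fin (2 ^ b)) → Prop) =
        ((2 ^ b).descFactorial k : ℝ) / (2 ^ b) ^ k := by
      rw [prob, Nat.card_congr (Equiv.subtypeInjectiveEquivEmbedding _ _), Nat.card_eq_fintype_card,
        Fintype.card_embedding_eq]
      simp
    have h1 : ((2 ^ b + 1 - k : ℝ)) ^ k ≤ ((2 ^ b).descFactorial k : ℝ) := by
      have := Nat.pow_sub_le_descFactorial (2 ^ b) k
      have hc : ((2 ^ b + 1 - k : ℕ) : ℝ) = 2 ^ b + 1 - k := by
        rw [Nat.cast_sub (by omega)]; push_cast; rfl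
      rw [← hc]
      exact_mod_cast this
    have hk' : (k : ℝ) ≤ 2 ^ b := by exact_mod_cast hk
    have h2 := one_add_mul_le_pow (a := (1 - k : ℝ) / 2 ^ b) (by
      rw [le_div_iff₀ hN]; linarith) k
    have h3 : (1 + (1 - k : ℝ) / 2 ^ b) ^ k = (2 ^ b + 1 - k : ℝ) ^ k / (2 ^ b) ^ k := by
      rw [← div_pow]; congr 1; field_simp; ring
    have h4 : (2 ^ b + 1 - k : ℝ) ^ k / (2 ^ b) ^ k ≤
        ((2 ^ b).descFactorial k : ℝ) / (2 ^ b) ^ k := by gcongr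
    have h5 : (k : ℝ) * ((1 - k) / 2 ^ b) = k / 2 ^ b - k ^ 2 / 2 ^ b := by ring
    have h6 : (0 : ℝ) ≤ k / 2 ^ b := by positivity
    rw [hcard]
    linarith
  · have h0 := prob_nonneg (Function.Injective : (Fin k → Fin (2 ^ b)) → Prop)
    have : (1 : ℝ) ≤ k ^ 2 / 2 ^ b := by
      rw [one_le_div hN]
      have hk' : (2 ^ b : ℝ) ≤ k := by exact_mod_cast (not_le.1 hk).le
      nlinarith
    linarith

/-! ### Lists of blocks -/

theorem blk_ofFn (h : k * b ≤ n) (w : Fin n → Bool) {i : ℕ} (hi : i < k) :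
    blk b (List.ofFn w) i = binary b (bitVertex b w i) := by
  refine List.ext_getElem ?_ fun l h1 h2 => ?_
  · have := Nat.mul_le_mul_right b hi
    rw [Nat.succ_mul] at this
    simp [blk, binary]; omega
  · have hl : l < b := by simpa [binary] using h2
    simp [blk, binary, testBit_bitVertex w hl (block_index_lt hi hl h)]

theorem binary_injective {u v : Fin (2 ^ b)} (h : binary b u = binary b v) : u = v := by
  refine fin_two_pow_ext fun l hl => ?_
  have := congrFun (List.ofFn_injective h) ⟨l, hl⟩
  simpa using this

theorem collNum_ofFn (h : k * b ≤ n) (w : Fin n → Bool) :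
    collNum k b (List.ofFn w) = 0 ↔ Function.Injective (bitTuple b k w) := by
  have key : collNum k b (List.ofFn w) = 0 ↔
      ∀ j < k, ∀ i < j, bitVertex b w i ≠ bitVertex b w j := by
    simp only [collNum, Finset.sum_eq_zero_iff, Finset.mem_range]
    refine forall₂_congr fun j hj => forall₂_congr fun i hi => ?_
    rw [blk_ofFn h w hj, blk_ofFn h w (hi.trans hj)]
    simp only [ite_eq_right_iff, one_ne_zero, imp_false, not_iff_not]
    exact ⟨binary_injective, fun h => by rw [h]⟩
  rw [key]
  constructor
  · intro hc i j hij
    rcases lt_trichotomy i j with hlt | rfl | hlt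
    · exact absurd hij (hc j j.2 i hlt)
    · rfl
    · exact absurd hij.symm (hc i i.2 j hlt)
  · intro hi j hj i hij he
    have := @hi ⟨i, hij.trans hj⟩ ⟨j, hj⟩ he
    simp at this; omega

theorem take_eq_flatten_blk (l : List Bool) : ∀ k : ℕ,
    l.take (k * b) = ((List.range k).map (blk b l)).flatten
  | 0 => by simp
  | k + 1 => by
    rw [Nat.succ_mul, List.take_add, take_eq_flatten_blk l k, List.range_succ]
    simp [blk]

theorem take_ofFn_eq (h : k * b ≤ n) (w : Fin n → Bool) :
    (List.ofFn w).take (k * b) =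
      (List.ofFn fun i : Fin k => binary b (bitTuple b k w i)).flatten := by
  rw [take_eq_flatten_blk]
  congr 1
  refine List.ext_getElem (by simp) fun i h1 h2 => ?_
  have hi : i < k := by simpa using h1
  simp [blk_ofFn h w hi, bitTuple]

theorem drop_ofFn_setBlocks (hb : 0 < b) (v : Fin k → Fin (2 ^ b)) (w : Fin n → Bool) :
    (List.ofFn (setBlocks v w)).drop (k * b) = (List.ofFn w).drop (k * b) := by
  refine List.ext_getElem (by simp) fun i h1 h2 => ?_
  have : ¬ (k * b + i) / b < k := by
    rw [not_lt, Nat.le_div_iff_mul_le hb]; omega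
  simp [setBlocks, this]

/-- Identifies the string computed by the machine with the second component of the exchange, to
which the uniformity argument applies. -/
theorem simPoint_ofFn (hb : 0 < b) (h : k * b ≤ n) (E : Fin k ↪ Fin (2 ^ b)) (w : Fin n → Bool) :
    simPoint k b (List.ofFn w) (List.ofFn fun i => binary b (E i)).flatten =
      List.ofFn (swapTuple (E, w)).2 := by
  by_cases hw : Function.Injective (bitTuple b k w)
  · rw [simPoint, if_pos ((collNum_ofFn h w).2 hw), swapTuple, dif_pos hw,
      ← List.take_append_drop (k * b) (List.ofFn (setBlocks E w)), take_ofFn_eq h,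
      drop_ofFn_setBlocks hb, bitTuple_setBlocks h]
  · rw [simPoint, if_neg (fun hc => hw ((collNum_ofFn h w).1 hc)), swapTuple, dif_neg hw,
      List.take_append_drop]

open Classical in
/-- The target concept: it accepts the descriptions of tuples with repetitions, and the tuples on
which the predicate, applied to the labels `x` of the vertices, holds. -/
noncomputable def concept (b : ℕ) {k : ℕ} (P : (Fin k → Bool) → Bool) (x : Fin (2 ^ b) → Bool)
    (n : ℕ) (z : Fin n → Bool) : Bool :=
  if Function.Injective (bitTuple b k z) then P fun i => x (bitTuple b k z i) else true

/-- If the hyperedge has been written into the point, its tuple is E and the generator's bit is the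
right label; otherwise the tuple has a repetition, where the concept is true whatever x is. So
pseudorandom inputs give correctly labelled examples. -/
theorem simLabel_ofFn (h : k * b ≤ n) (P : (Fin k → Bool) → Bool) (x : Fin (2 ^ b) → Bool)
    (E : Fin k ↪ Fin (2 ^ b)) (w : Fin n → Bool) :
    simLabel k b (List.ofFn w) (P fun i => x (E i)) =
      concept b P x n (swapTuple (E, w)).2 := by
  by_cases hw : Function.Injective (bitTuple b k w)
  · rw [simLabel, if_pos ((collNum_ofFn h w).2 hw), swapTuple, dif_pos hw, concept,
      bitTuple_setBlocks h, if_pos E.injective]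
  · rw [simLabel, if_neg (fun hc => hw ((collNum_ofFn h w).1 hc)), swapTuple, dif_neg hw, concept,
      if_neg hw]

theorem drop_take_flatten {α : Type} {L : ℕ} : ∀ (ls : List (List α)),
    (∀ l ∈ ls, l.length = L) → ∀ (j : ℕ) (hj : j < ls.length),
      (ls.flatten.drop (j * L)).take L = ls[j]
  | l :: ls, h, 0, _ => by
    have := h l (by simp)
    simp [← this]
  | l :: ls, h, j + 1, hj => by
    have h1 := h l (by simp)
    have h2 := drop_take_flatten ls (fun l hl => h l (by simp [hl])) j (by simpa using hj)
    rw [List.flatten_cons, Nat.succ_mul, add_comm, ← List.drop_drop, ← h1, List.drop_left, h1, h2]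
    simp

end
end PACRE

namespace PACRE

/-! ### Counting errors -/

theorem Learner.WeaklyLearns.mono {L : Learner} {γ γ' : ℝ} {C : ∀ n : ℕ, Set ((Fin n → Bool) → Bool)}
    (h : L.WeaklyLearns γ C) (hγ : γ' ≤ γ) : L.WeaklyLearns γ' C := fun n δ h0 h1 c hc =>
  (h n δ h0 h1 c hc).trans (prob_mono fun _ ⟨g, hg, he⟩ => ⟨g, hg, he.trans (by linarith)⟩)

/-- The number of test points on which the (clocked) prediction of the hypothesis `h` is wrong. -/
noncomputable def Learner.testErrors (L : Learner) (T : ℕ) {n M : ℕ} (c : (Fin n → Bool) → Bool)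
    (h : List Bool) (test : Fin M → Fin n → Bool) : ℕ :=
  ∑ t, if clockedOut L.predict [h, List.ofFn (test t)] T = [c (test t)] then 0 else 1

/-- At most (1/2 - γ) * M errors are expected, so exceeding θ is a deviation of γ / 2 * M. Chebyshev
gives 4 / (γ ^ 2 * M), and 80 / γ ^ 2 ≤ M makes this at most 1/20. -/
theorem prob_testErrors_le (L : Learner) {γ : ℝ} (hγ : 0 < γ) {n d M θ : ℕ}
    (c : (Fin n → Bool) → Bool) (h : List Bool) (he : L.error d c h ≤ 1 / 2 - γ)
    (hM : 80 / γ ^ 2 ≤ M) (hθ : (1 / 2 - γ / 2) * M ≤ θ + 1) :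
    prob (fun test : Fin M → Fin n → Bool =>
      θ < L.testErrors (L.time.eval (n + d)) c h test) ≤ 1 / 20 := by
  classical
  obtain ⟨S, hS⟩ : ∃ S : (Fin n → Bool) → Prop, ∀ x, S x ↔
    ¬ clockedOut L.predict [h, List.ofFn x] (L.time.eval (n + d)) = [c x] := ⟨_, fun _ => Iff.rfl⟩
  have hp : prob S ≤ 1 / 2 - γ :=
    (prob_mono fun x hx => fun ho => (hS x).1 hx (clockedOut_eq ho le_rfl)).trans he
  have hM0 : (0 : ℝ) < M := lt_of_lt_of_le (by positivity) hM
  have ha : 0 < γ / 2 * M := by positivity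
  refine (prob_mono fun test ht => ?_).trans ((prob_deviation_le S M ha).trans ?_)
  · have h1 : ((L.testErrors (L.time.eval (n + d)) c h test : ℕ) : ℝ) =
        ∑ t, if S (test t) then (1 : ℝ) else 0 := by
      simp [Learner.testErrors, hS]
    have h2 : (θ : ℝ) + 1 ≤ (L.testErrors (L.time.eval (n + d)) c h test : ℕ) := by exact_mod_cast ht
    rw [h1] at h2
    refine le_trans ?_ (le_abs_self _)
    have h3 := mul_le_mul_of_nonneg_left hp hM0.le
    linarith
  · rw [div_le_div_iff₀ (by positivity) (by norm_num)]
    rw [div_le_iff₀ (by positivity)] at hM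
    nlinarith

/-- Adding the fixed guesses a modulo 2 preserves the uniform distribution and turns the errors into
the ones of y, of which M / 2 are expected. Chebyshev applies with deviation γ / 2 * M. -/
theorem prob_guess_le {γ : ℝ} (hγ : 0 < γ) {M θ : ℕ} (hM : 80 / γ ^ 2 ≤ M)
    (hθ : (θ : ℝ) ≤ (1 / 2 - γ / 2) * M) (a : Fin M → Bool) :
    prob (fun y : Fin M → Bool => (∑ t, if a t = y t then 0 else 1) ≤ θ) ≤ 1 / 20 := by
  classical
  have hM0 : (0 : ℝ) < M := lt_of_lt_of_le (by positivity) hM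
  have ha : 0 < γ / 2 * M := by positivity
  obtain ⟨S, hS⟩ : ∃ S : Bool → Prop, ∀ x, S x ↔ x = true := ⟨_, fun _ => Iff.rfl⟩
  have hp : prob S = 1 / 2 := by
    rw [prob_eq_sum]; simp [hS]
  have hinv : Function.Involutive fun (y : Fin M → Bool) t => xor (a t) (y t) := fun y => by
    funext t; simp
  set e := Function.Involutive.toPerm _ hinv
  rw [← prob_equiv e]
  refine (prob_mono fun y hy => ?_).trans ((prob_deviation_le S M ha).trans ?_)
  · have h1 : ((∑ t, if a t = e y t then 0 else 1 : ℕ) : ℝ) =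
        ∑ t, if S (y t) then (1 : ℝ) else 0 := by
      push_cast
      refine Finset.sum_congr rfl fun t _ => ?_
      rw [show e y t = xor (a t) (y t) from rfl]
      cases a t <;> cases y t <;> simp [hS]
    have h2 : ((∑ t, if a t = e y t then 0 else 1 : ℕ) : ℝ) ≤ θ := by exact_mod_cast hy
    rw [h1] at h2
    rw [hp]
    refine le_trans ?_ (neg_le_abs _)
    nlinarith
  · rw [div_le_div_iff₀ (by positivity) (by norm_num)]
    rw [div_le_iff₀ (by positivity)] at hM
    nlinarith

/-- Either the learner fails (at most 1/10), or it succeeds and the independent test is misleading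
(at most 1/20 for every fixed successful sample and coins). Clocking does not change the output of a
successful run. -/
theorem prob_many_errors_le (L : Learner) {γ : ℝ} (hγ : 0 < γ) {n d M θ q s : ℕ}
    (c : (Fin n → Bool) → Bool) (hM : 80 / γ ^ 2 ≤ M) (hθ : (1 / 2 - γ / 2) * M ≤ θ + 1)
    (hL : 9 / 10 ≤ prob fun ω : (Fin q → Fin n → Bool) × (Fin s → Bool) => ∃ h : List Bool,
      OutputsWithin L.learn (learnInput d c ω.1 ω.2) (L.time.eval (n + d)) h ∧
        L.error d c h ≤ 1 / 2 - γ) :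
    prob (fun ω : ((Fin q → Fin n → Bool) × (Fin s → Bool)) × (Fin M → Fin n → Bool) =>
      θ < L.testErrors (L.time.eval (n + d)) c (clockedOut L.learn (learnInput d c ω.1.1 ω.1.2)
        (L.time.eval (n + d))) ω.2) ≤ 3 / 20 := by
  set A : (Fin q → Fin n → Bool) × (Fin s → Bool) → Prop := fun ω => ∃ h : List Bool,
      OutputsWithin L.learn (learnInput d c ω.1 ω.2) (L.time.eval (n + d)) h ∧
        L.error d c h ≤ 1 / 2 - γ with hA
  calc _ ≤ prob (fun ω : ((Fin q → Fin n → Bool) × (Fin s → Bool)) × (Fin M → Fin n → Bool) =>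
          ¬ A ω.1 ∨ (A ω.1 ∧ θ < L.testErrors (L.time.eval (n + d)) c (clockedOut L.learn
            (learnInput d c ω.1.1 ω.1.2) (L.time.eval (n + d))) ω.2)) :=
        prob_mono fun ω h => by by_cases hω : A ω.1 <;> simp [hω, h]
    _ ≤ _ := prob_or_le _ _
    _ ≤ 1 / 10 + 1 / 20 := by
        refine add_le_add ?_ (prob_prod_le (by norm_num) fun ω => ?_)
        · rw [prob_fst (fun ω => ¬ A ω), prob_not]; linarith
        · by_cases hω : A ω
          · obtain ⟨h, ho, he⟩ := id hω
            refine (prob_mono fun test ht => ?_).trans (prob_testErrors_le L hγ c h he hM hθ)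
            rw [clockedOut_eq ho le_rfl] at ht
            exact ht.2
          · simp [hω, prob]
    _ = _ := by norm_num

/-! ### Splitting the inputs -/

/-- Split a finite sequence. -/
def splitEquiv (X : Type) {a b m : ℕ} (h : a + b = m) :
    (Fin m → X) ≃ (Fin a → X) × (Fin b → X) :=
  ((finCongr h).arrowCongr (Equiv.refl X)).symm.trans (Fin.appendEquiv a b).symm

/-- Split the coins into the coins for the points and the coins of the learner. -/
def coinEquiv {Q n s m : ℕ} (h : Q * n + s = m) :
    (Fin m → Bool) ≃ (Fin Q → Fin n → Bool) × (Fin s → Bool) :=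
  (splitEquiv Bool h).trans (Equiv.prodCongr ((finProdFinEquiv.arrowCongr (Equiv.refl Bool)).symm.trans
    (Equiv.curry _ _ _)) (Equiv.refl _))

theorem coinEquiv_fst {Q n s m : ℕ} (h : Q * n + s = m) (r : Fin m → Bool) (j : Fin Q) :
    List.ofFn ((coinEquiv h r).1 j) = ((List.ofFn r).drop (j * n)).take n := by
  have := Nat.mul_le_mul_right n (Nat.succ_le_of_lt j.2)
  rw [Nat.succ_mul] at this
  refine List.ext_getElem (by simp; omega) fun i h1 h2 => ?_
  simp only [List.getElem_ofFn, List.getElem_take, List.getElem_drop]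
  rw [show (coinEquiv h r).1 j ⟨i, by simpa using h1⟩ =
    r ⟨finProdFinEquiv (j, (⟨i, by simpa using h1⟩ : Fin n)), _⟩ from rfl]
  congr 1
  simp [finProdFinEquiv, mul_comm, add_comm]

theorem coinEquiv_snd {Q n s m : ℕ} (h : Q * n + s = m) (r : Fin m → Bool) :
    List.ofFn (coinEquiv h r).2 = (List.ofFn r).drop (Q * n) := by
  refine List.ext_getElem (by simp; omega) fun i h1 h2 => ?_
  simp only [List.getElem_ofFn, List.getElem_drop]
  rfl

theorem drop_take_encodeHypergraph {b k m : ℕ} (G : Hypergraph (2 ^ b) m k) (j : Fin m) :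
    ((encodeHypergraph G).drop (j * (k * b))).take (k * b) =
      (List.ofFn fun i => binary b (G j i)).flatten := by
  rw [encodeHypergraph, Nat.clog_pow 2 b (by norm_num), drop_take_flatten _ _ j (by simp)]
  · simp
  · intro l hl
    obtain ⟨j, rfl⟩ := (List.mem_ofFn' _ _).1 hl
    simp [binary, Function.comp_def]

theorem length_encodeHypergraph {b k m : ℕ} (G : Hypergraph (2 ^ b) m k) :
    (encodeHypergraph G).length = m * (k * b) := by
  rw [encodeHypergraph, Nat.clog_pow 2 b (by norm_num)]
  simp [binary, Function.comp_def]

end PACRE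

namespace PACRE

/-! ### The distinguisher built from a learner -/

/-- The data of the distinguisher built from a learner, with examples of length `n ^ e` for a
hypergraph with `n` vertices. -/
noncomputable def learnerParams (L : Learner) (e k M θ : ℕ) : DistParams where
  learn := L.learn
  predict := L.predict
  k := k
  M := M
  θ := θ
  d := 10
  nP := .X ^ e
  qP := L.examples.comp (.X ^ e + 10)
  tP := L.time.comp (.X ^ e + 10)
  cP := (L.examples.comp (.X ^ e + 10) + .C M) * .X ^ e + L.coins.comp (.X ^ e + 10)

/-- The input of the distinguisher as an instance. -/
def distInst {b m k s : ℕ} (G : Hypergraph (2 ^ b) m k) (y : Fin m → Bool) (r : Fin s → Bool) :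
    DistInst := ⟨b, encodeHypergraph G, List.ofFn y, List.ofFn r⟩

section
variable {L : Learner} {e k M θ b m n q s cc : ℕ}

theorem learnerParams_n (i : DistInst) : (learnerParams L e k M θ).n i = (2 ^ i.b) ^ e := by
  simp [learnerParams, DistParams.n]

theorem learnerParams_q (i : DistInst) :
    (learnerParams L e k M θ).q i = L.examples.eval ((2 ^ i.b) ^ e + 10) := by
  simp [learnerParams, DistParams.q]

theorem learnerParams_T (i : DistInst) :
    (learnerParams L e k M θ).T i = L.time.eval ((2 ^ i.b) ^ e + 10) := by
  simp [learnerParams, DistParams.T]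

theorem learnerParams_cP (N : ℕ) : (learnerParams L e k M θ).cP.eval N =
    (L.examples.eval (N ^ e + 10) + M) * N ^ e + L.coins.eval (N ^ e + 10) := by
  simp [learnerParams]

theorem point_distInst (hb : 0 < b) (hn : (2 ^ b) ^ e = n) (hkn : k * b ≤ n) {Q : ℕ} (hQ : Q ≤ m)
    (hc : Q * n + s = cc) (G : Hypergraph (2 ^ b) m k) (y : Fin m → Bool) (r : Fin cc → Bool)
    (j : Fin Q) : (learnerParams L e k M θ).point (distInst G y r) j =
      List.ofFn (swapTuple (G ⟨j, j.2.trans_le hQ⟩, (coinEquiv hc r).1 j)).2 := by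
  have hk : (learnerParams L e k M θ).k = k := rfl
  have h1 := drop_take_encodeHypergraph G ⟨j, j.2.trans_le hQ⟩
  rw [DistParams.point, learnerParams_n]
  simp only [distInst, hn, hk] at h1 ⊢
  rw [h1, ← coinEquiv_fst hc r j, simPoint_ofFn hb hkn]

theorem headD_drop_ofFn (y : Fin m → Bool) {j : ℕ} (hj : j < m) :
    ((List.ofFn y).drop j).headD false = y ⟨j, hj⟩ := by
  rw [List.drop_eq_getElem_cons (by simpa using hj)]; simp

theorem label_distInst (hn : (2 ^ b) ^ e = n) {Q : ℕ} (hQ : Q ≤ m)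
    (hc : Q * n + s = cc) (G : Hypergraph (2 ^ b) m k) (y : Fin m → Bool) (r : Fin cc → Bool)
    (j : Fin Q) : (learnerParams L e k M θ).label (distInst G y r) j =
      simLabel k b (List.ofFn ((coinEquiv hc r).1 j)) (y ⟨j, j.2.trans_le hQ⟩) := by
  have hk : (learnerParams L e k M θ).k = k := rfl
  rw [DistParams.label, learnerParams_n]
  simp only [distInst, hn, hk]
  rw [← coinEquiv_fst hc r j, headD_drop_ofFn]

theorem good_distInst (hn : (2 ^ b) ^ e = n) (hkn : k * b ≤ n)
    (hq : L.examples.eval (n + 10) + M ≤ m)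
    (hc : (L.examples.eval (n + 10) + M) * n + L.coins.eval (n + 10) = cc)
    (G : Hypergraph (2 ^ b) m k) (y : Fin m → Bool) (r : Fin cc → Bool) :
    (learnerParams L e k M θ).Good (distInst G y r) := by
  constructor
  · rw [learnerParams_n]; simpa [distInst, hn, learnerParams] using hkn
  · rw [learnerParams_n, learnerParams_q]
    simp only [distInst, hn, learnerParams, List.length_ofFn]
    omega
  · rw [learnerParams_cP]
    simp [distInst, hn, hc]
  · rw [learnerParams_q]
    simp only [distInst, hn, learnerParams, length_encodeHypergraph]
    exact Nat.mul_le_mul_right _ hq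
  · rw [learnerParams_q]
    simpa [distInst, hn, learnerParams] using hq

theorem restCoins_distInst (hn : (2 ^ b) ^ e = n)
    (hc : (L.examples.eval (n + 10) + M) * n + s = cc)
    (G : Hypergraph (2 ^ b) m k) (y : Fin m → Bool) (r : Fin cc → Bool) :
    (learnerParams L e k M θ).restCoins (distInst G y r) = List.ofFn (coinEquiv hc r).2 := by
  rw [DistParams.restCoins, learnerParams_n, learnerParams_q, coinEquiv_snd]
  simp only [distInst, hn, learnerParams]

/-- The rearrangement of hypergraphs and coins into simulated points and coins of the learner. -/
noncomputable def pseudoEquiv (hb : 0 < b) (hkn : k * b ≤ n) {m' : ℕ} (hm : (q + M) + m' = m)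
    (hc : (q + M) * n + s = cc) : Hypergraph (2 ^ b) m k × (Fin cc → Bool) ≃
      (((Fin q → Fin n → Bool) × (Fin s → Bool)) × (Fin M → Fin n → Bool)) ×
        (Hypergraph (2 ^ b) (q + M) k × Hypergraph (2 ^ b) m' k) :=
  (Equiv.prodCongr (splitEquiv _ hm) (coinEquiv hc)).trans <|
    (Equiv.prodProdProdComm _ _ _ _).trans <|
      (Equiv.prodCongr (swapEquiv hb hkn (q + M)) (Equiv.refl _)).trans <|
        { toFun := fun x => ((((splitEquiv _ rfl x.1.2).1, x.2.2), (splitEquiv _ rfl x.1.2).2),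
            (x.1.1, x.2.1))
          invFun := fun x => ((x.2.1, (splitEquiv _ rfl).symm (x.1.1.1, x.1.2)), (x.2.2, x.1.1.2))
          left_inv := fun x => by simp
          right_inv := fun x => by simp }

/-- An identity without any probability: on a pseudorandom string the machine carries out the
learning and testing experiment for the concept of x, on the points produced by `pseudoEquiv`. -/
theorem errs_pseudo (hb : 0 < b) (hn : (2 ^ b) ^ e = n) (hkn : k * b ≤ n)
    (hq : L.examples.eval (n + 10) = q) {m' : ℕ} (hm : (q + M) + m' = m)
    (hc : (q + M) * n + s = cc) (P : (Fin k → Bool) → Bool) (x : Fin (2 ^ b) → Bool)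
    (ω : Hypergraph (2 ^ b) m k × (Fin cc → Bool)) :
    (learnerParams L e k M θ).errs (distInst ω.1 (goldreich P ω.1 x) ω.2) M =
      L.testErrors (L.time.eval (n + 10)) (concept b P x n)
        (clockedOut L.learn (learnInput 10 (concept b P x n)
          (pseudoEquiv hb hkn hm hc ω).1.1.1 (pseudoEquiv hb hkn hm hc ω).1.1.2)
          (L.time.eval (n + 10)))
        (pseudoEquiv hb hkn hm hc ω).1.2 := by
  obtain ⟨G, r⟩ := ω
  have hQ : q + M ≤ m := by omega
  set i := distInst G (goldreich P G x) r with hi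
  set PP := learnerParams L e k M θ with hPP
  set z : Fin (q + M) → Fin n → Bool := fun j =>
    (swapTuple (G ⟨j, j.2.trans_le hQ⟩, (coinEquiv hc r).1 j)).2 with hz
  have hpoint : ∀ j : Fin (q + M), PP.point i j = List.ofFn (z j) := fun j =>
    point_distInst hb hn hkn hQ hc G _ r j
  have hlabel : ∀ j : Fin (q + M), PP.label i j = concept b P x n (z j) := fun j => by
    rw [hi, hPP, label_distInst hn hQ hc G _ r j, goldreich,
      simLabel_ofFn hkn P x (G ⟨j, j.2.trans_le hQ⟩)]
  have e1 : ∀ j : Fin q, (pseudoEquiv hb hkn hm hc (G, r)).1.1.1 j = z ⟨j, by omega⟩ := fun j => rfl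
  have e2 : ∀ t : Fin M, (pseudoEquiv hb hkn hm hc (G, r)).1.2 t = z ⟨q + t, by omega⟩ := fun j => rfl
  have e3 : (pseudoEquiv hb hkn hm hc (G, r)).1.1.2 = (coinEquiv hc r).2 := rfl
  have hq' : PP.q i = q := by rw [hPP, learnerParams_q, ← hq, ← hn]; rfl
  have hn' : PP.n i = n := by rw [hPP, learnerParams_n, ← hn]; rfl
  have hT' : PP.T i = L.time.eval (n + 10) := by rw [hPP, learnerParams_T, ← hn]; rfl
  have hsample : PP.sample i q = encodeSample (concept b P x n)
      (pseudoEquiv hb hkn hm hc (G, r)).1.1.1 := by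
    rw [DistParams.sample, encodeSample]
    congr 1
    refine List.ext_getElem (by simp) fun j h1 h2 => ?_
    have hj : j < q := by simpa using h1
    have a1 := hpoint ⟨j, by omega⟩
    have a2 := hlabel ⟨j, by omega⟩
    simp only at a1 a2
    simp [e1, a1, a2]
  have hrest : PP.restCoins i = List.ofFn (coinEquiv hc r).2 := by
    subst hq
    exact restCoins_distInst hn hc G _ r
  have hin : PP.learnIn i = learnInput 10 (concept b P x n)
      (pseudoEquiv hb hkn hm hc (G, r)).1.1.1 (pseudoEquiv hb hkn hm hc (G, r)).1.1.2 := by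
    rw [DistParams.learnIn, learnInput, hn', hq', hsample, hrest, e3]
    rfl
  rw [DistParams.errs, Learner.testErrors, Finset.sum_range]
  refine Finset.sum_congr rfl fun t _ => ?_
  have a1 := hpoint ⟨q + t, by omega⟩
  have a2 := hlabel ⟨q + t, by omega⟩
  simp only at a1 a2
  rw [DistParams.pred, DistParams.hyp, hin, hq', a1, a2, hT', e2]
  rfl

theorem prob_pseudoEquiv (hb : 0 < b) (hkn : k * b ≤ n) (hk : k ≤ 2 ^ b) {m' : ℕ}
    (hm : (q + M) + m' = m) (hc : (q + M) * n + s = cc)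
    (p : (((Fin q → Fin n → Bool) × (Fin s → Bool)) × (Fin M → Fin n → Bool)) → Prop) :
    prob (fun ω : Hypergraph (2 ^ b) m k × (Fin cc → Bool) => p (pseudoEquiv hb hkn hm hc ω).1) =
      prob p := by
  have hne : Nonempty (Fin k ↪ Fin (2 ^ b)) := ⟨Fin.castLEEmb hk⟩
  exact (prob_equiv (pseudoEquiv hb hkn hm hc) fun ω => p ω.1).trans (prob_fst p)

theorem prob_pseudo_le (hb : 0 < b) (hn : (2 ^ b) ^ e = n) (hkn : k * b ≤ n) (hk : k ≤ 2 ^ b)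
    (hq : L.examples.eval (n + 10) = q) (hm : q + M ≤ m) (hs : L.coins.eval (n + 10) = s)
    (hc : (q + M) * n + s = cc) (P : (Fin k → Bool) → Bool) {γ : ℝ} (hγ : 0 < γ)
    (hM : 80 / γ ^ 2 ≤ M) (hθ : (1 / 2 - γ / 2) * M ≤ θ + 1) {C : ∀ n : ℕ, Set ((Fin n → Bool) → Bool)}
    (hL : L.WeaklyLearns γ C) (hC : ∀ x, concept b P x n ∈ C n) :
    prob (fun ω : Hypergraph (2 ^ b) m k × (Fin (2 ^ b) → Bool) × (Fin cc → Bool) =>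
      θ < (learnerParams L e k M θ).errs (distInst ω.1 (goldreich P ω.1 ω.2.1) ω.2.2) M) ≤ 3 / 20 := by
  have hne : Nonempty (Fin k ↪ Fin (2 ^ b)) := ⟨Fin.castLEEmb hk⟩
  let E : Hypergraph (2 ^ b) m k × (Fin (2 ^ b) → Bool) × (Fin cc → Bool) ≃
      (Fin (2 ^ b) → Bool) × Hypergraph (2 ^ b) m k × (Fin cc → Bool) :=
    ⟨fun ω => (ω.2.1, ω.1, ω.2.2), fun ω => (ω.2.1, ω.1, ω.2.2), fun _ => rfl, fun _ => rfl⟩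
  refine (prob_equiv E fun ω => θ < (learnerParams L e k M θ).errs
    (distInst ω.2.1 (goldreich P ω.2.1 ω.1) ω.2.2) M).trans_le ?_
  -- The seed x is fixed, and with it the target concept; the hypergraph and the coins provide the
  -- randomness of the experiment.
  refine prob_prod_le (by norm_num) fun x => ?_
  obtain ⟨m', hm'⟩ := Nat.exists_eq_add_of_le hm
  -- The confidence δ = 1/10 corresponds to the constant 10 in `learnerParams`.
  have hδ : ⌈1 / (1 / 10 : ℝ)⌉₊ = 10 := by norm_num
  have hLx := hL n (1 / 10) (by norm_num) (by norm_num) _ (hC x)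
  rw [hδ, hq, hs] at hLx
  have key := prob_many_errors_le L hγ (concept b P x n) hM hθ
    (le_trans (by norm_num) hLx)
  obtain ⟨p, hp⟩ : ∃ p : (((Fin q → Fin n → Bool) × (Fin s → Bool)) × (Fin M → Fin n → Bool)) →
      Prop, ∀ ω, p ω ↔ θ < L.testErrors (L.time.eval (n + 10)) (concept b P x n)
        (clockedOut L.learn (learnInput 10 (concept b P x n) ω.1.1 ω.1.2)
          (L.time.eval (n + 10))) ω.2 := ⟨_, fun _ => Iff.rfl⟩
  rw [← prob_congr hp, ← prob_pseudoEquiv hb hkn hk hm'.symm hc] at key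
  refine (prob_mono fun ω hω => (hp _).2 ?_).trans key
  rw [← errs_pseudo hb hn hkn hq hm'.symm hc P x ω]
  exact hω

/-- The hypothesis sees only the first q labels, so the predictions do not depend on the bits that
serve as test labels. -/
theorem pred_congr (hn : (2 ^ b) ^ e = n) (hq : L.examples.eval (n + 10) = q) (hm : q ≤ m)
    (G : Hypergraph (2 ^ b) m k) {y y' : Fin m → Bool} (r : Fin cc → Bool)
    (h : ∀ j : Fin m, (j : ℕ) < q → y j = y' j) (t : ℕ) :
    (learnerParams L e k M θ).pred (distInst G y r) t =
      (learnerParams L e k M θ).pred (distInst G y' r) t := by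
  have hq' : ∀ y : Fin m → Bool, (learnerParams L e k M θ).q (distInst G y r) = q := fun y => by
    rw [learnerParams_q, ← hq, ← hn]; rfl
  have hs : (learnerParams L e k M θ).sample (distInst G y r) q =
      (learnerParams L e k M θ).sample (distInst G y' r) q := by
    rw [DistParams.sample, DistParams.sample]
    congr 1
    refine List.map_congr_left fun j hj => ?_
    have hj' : j < q := by simpa using hj
    have hl : (learnerParams L e k M θ).label (distInst G y r) j =
        (learnerParams L e k M θ).label (distInst G y' r) j := by
      rw [DistParams.label, DistParams.label]
      simp only [distInst]
      rw [headD_drop_ofFn y (hj'.trans_le hm), headD_drop_ofFn y' (hj'.trans_le hm), h _ hj']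
      rfl
    rw [hl]; rfl
  have hh : (learnerParams L e k M θ).hyp (distInst G y r) =
      (learnerParams L e k M θ).hyp (distInst G y' r) := by
    rw [DistParams.hyp, DistParams.hyp, DistParams.learnIn, DistParams.learnIn, hq', hq', hs]; rfl
  rw [DistParams.pred, DistParams.pred, hh, hq', hq']; rfl

/-- A union bound over the M tests disposes of test tuples with a repetition. Without these, the
test labels are uniform bits independent of the predictions, and `prob_guess_le` applies once
everything else is fixed. -/
theorem prob_random_le (hb : 0 < b) (hn : (2 ^ b) ^ e = n) (hkn : k * b ≤ n) (hk : k ≤ 2 ^ b)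
    (hq : L.examples.eval (n + 10) = q) (hm : q + M ≤ m)
    (hc : (q + M) * n + s = cc) {γ : ℝ} (hγ : 0 < γ)
    (hM : 80 / γ ^ 2 ≤ M) (hθ : (θ : ℝ) ≤ (1 / 2 - γ / 2) * M) :
    prob (fun ω : Hypergraph (2 ^ b) m k × (Fin m → Bool) × (Fin cc → Bool) =>
      (learnerParams L e k M θ).errs (distInst ω.1 ω.2.1 ω.2.2) M ≤ θ) ≤
        M * (k ^ 2 / 2 ^ b) + 1 / 20 := by
  have hne : Nonempty (Fin k ↪ Fin (2 ^ b)) := ⟨Fin.castLEEmb hk⟩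
  obtain ⟨m', hm'⟩ := Nat.exists_eq_add_of_le hm
  let w : (Fin cc → Bool) → ℕ → Fin n → Bool := fun r t =>
    if h : t < M then (coinEquiv hc r).1 ⟨q + t, by omega⟩ else fun _ => false
  let bad : (Fin cc → Bool) → ℕ → Prop := fun r t => ¬ Function.Injective (bitTuple b k (w r t))
  have hbad : ∀ t < M, prob (fun r => bad r t) ≤ k ^ 2 / 2 ^ b := fun t ht => by
    have h1 : prob (fun r => bad r t) = prob fun r : Fin cc → Bool =>
        ¬ Function.Injective (bitTuple b k ((coinEquiv hc r).1 ⟨q + t, by omega⟩)) :=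
      prob_congr fun r => by simp only [bad, w, dif_pos ht]
    rw [h1]
    refine (prob_equiv (coinEquiv hc) fun x =>
      ¬ Function.Injective (bitTuple b k (x.1 ⟨q + t, by omega⟩))).trans_le ?_
    rw [prob_fst fun x : Fin (q + M) → Fin n → Bool =>
        ¬ Function.Injective (bitTuple b k (x ⟨q + t, by omega⟩)),
      prob_eval _ fun x : Fin n → Bool => ¬ Function.Injective (bitTuple b k x)]
    exact prob_not_injective_le hb hkn
  refine (prob_mono (q := fun ω => (∃ t < M, bad ω.2.2 t) ∨ ((¬ ∃ t < M, bad ω.2.2 t) ∧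
    (learnerParams L e k M θ).errs (distInst ω.1 ω.2.1 ω.2.2) M ≤ θ)) fun ω h => ?_).trans
      ((prob_or_le _ _).trans (add_le_add ?_ ?_))
  · by_cases hx : ∃ t < M, bad ω.2.2 t
    · exact .inl hx
    · exact .inr ⟨hx, h⟩
  · refine prob_exists_le M _ fun t ht => ?_
    rw [prob_snd fun x : (Fin m → Bool) × (Fin cc → Bool) => bad x.2 t,
      prob_snd fun x : (Fin cc → Bool) => bad x t]
    exact hbad t ht
  · let Y : (Fin m → Bool) ≃ (Fin q → Bool) × (Fin M → Bool) × (Fin m' → Bool) :=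
      (splitEquiv Bool (a := q) (b := M + m') (by omega)).trans
        (Equiv.prodCongr (Equiv.refl _) (splitEquiv Bool rfl))
    let F : Hypergraph (2 ^ b) m k × (Fin m → Bool) × (Fin cc → Bool) ≃
        (Hypergraph (2 ^ b) m k × (Fin cc → Bool) × (Fin q → Bool) × (Fin m' → Bool)) ×
          (Fin M → Bool) :=
      { toFun := fun ω => ((ω.1, ω.2.2, (Y ω.2.1).1, (Y ω.2.1).2.2), (Y ω.2.1).2.1)
        invFun := fun ω => (ω.1.1, Y.symm (ω.1.2.2.1, ω.2, ω.1.2.2.2), ω.1.2.1)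
        left_inv := fun ω => by simp
        right_inv := fun ω => by simp }
    rw [← prob_equiv F.symm]
    refine prob_prod_le (by norm_num) fun ⟨G, r, y₁, y₃⟩ => ?_
    let y : (Fin M → Bool) → Fin m → Bool := fun y₂ => Y.symm (y₁, y₂, y₃)
    have hy : ∀ y₂, Y (y y₂) = (y₁, y₂, y₃) := fun y₂ => Y.apply_symm_apply _
    have hy1 : ∀ y₂ (j : Fin m) (hj : (j : ℕ) < q), y y₂ j = y₁ ⟨j, hj⟩ := fun y₂ j hj =>
      congrFun (congrArg Prod.fst (hy y₂)) ⟨j, hj⟩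
    have hy2 : ∀ y₂ (t : Fin M), y y₂ ⟨q + t, by omega⟩ = y₂ t := fun y₂ t =>
      congrFun (congrArg (fun z => z.2.1) (hy y₂)) t
    -- By `pred_congr` the predictions can be computed with an arbitrary dummy in place of the test
    -- labels, which shows that the guesses are fixed in advance.
    refine (prob_mono fun y₂ h => ?_).trans (prob_guess_le hγ hM hθ fun t =>
      decide ((learnerParams L e k M θ).pred (distInst G (y fun _ => false) r) t = [true]))
    obtain ⟨hinj, herr⟩ := h
    change (learnerParams L e k M θ).errs (distInst G (y y₂) r) M ≤ θ at herr
    refine le_trans ?_ herr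
    rw [DistParams.errs, Finset.sum_range]
    refine Finset.sum_le_sum fun t _ => ?_
    have hl := label_distInst (L := L) (M := M) (θ := θ) hn hm hc G (y y₂) r ⟨q + t, by omega⟩
    have hi : Function.Injective (bitTuple b k ((coinEquiv hc r).1 ⟨q + t, by omega⟩)) := by
      by_contra h
      refine hinj ⟨t, t.2, ?_⟩
      change ¬ Function.Injective (bitTuple b k (w r t))
      simp only [w, dif_pos t.2]
      exact h
    rw [simLabel, if_pos ((collNum_ofFn hkn _).2 hi)] at hl
    have hq' : (learnerParams L e k M θ).q (distInst G (y y₂) r) = q := by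
      rw [learnerParams_q, ← hq, ← hn]; rfl
    rw [hq', pred_congr (M := M) (θ := θ) hn hq (by omega) G r
      (fun j hj => (hy1 y₂ j hj).trans (hy1 (fun _ => false) j hj).symm) t]
    simp only at hl
    rw [hl, hy2]
    -- A prediction may be neither [true] nor [false]. It is then always an error, while the guess
    -- false may be right, so the guesses have at most as many errors.
    split_ifs with h1 h2 h2
    · rfl
    · simp
    · exact absurd (by rw [h2]; cases y₂ t <;> simp) h1
    · rfl

end
end PACRE

namespace PACRE

/-! ### Hardness from the local-PRG assumption -/

theorem eventually_eval_le_pow (p : Polynomial ℕ) :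
    ∃ s : ℕ, ∀ᶠ N : ℕ in Filter.atTop, p.eval N ≤ N ^ s := by
  induction p using Polynomial.induction_on' with
  | add p q hp hq =>
    obtain ⟨s, hs⟩ := hp
    obtain ⟨t, ht⟩ := hq
    refine ⟨max s t + 1, ?_⟩
    filter_upwards [hs, ht, Filter.eventually_ge_atTop 2] with N h1 h2 h3
    have h4 : N ^ s ≤ N ^ max s t := Nat.pow_le_pow_right (by omega) (le_max_left _ _)
    have h5 : N ^ t ≤ N ^ max s t := Nat.pow_le_pow_right (by omega) (le_max_right _ _)
    rw [Polynomial.eval_add, pow_succ]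
    nlinarith
  | monomial d a =>
    refine ⟨d + 1, ?_⟩
    filter_upwards [Filter.eventually_ge_atTop a] with N h
    rw [Polynomial.eval_monomial, pow_succ, mul_comm]
    exact Nat.mul_le_mul_left _ h

theorem tendsto_two_pow : Filter.Tendsto (fun b : ℕ => 2 ^ b) Filter.atTop Filter.atTop :=
  tendsto_pow_atTop_atTop_of_one_lt (by norm_num)

theorem eventually_mul_le_two_pow (k : ℕ) : ∀ᶠ b : ℕ in Filter.atTop, k * b ≤ 2 ^ b := by
  have h := tendsto_pow_const_div_const_pow_of_one_lt 1 (r := (2 : ℝ)) (by norm_num)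
  filter_upwards [h.eventually_le_const (show (0 : ℝ) < 1 / (k + 1) by positivity)] with b hb
  rw [div_le_div_iff₀ (by positivity) (by positivity)] at hb
  have : (b : ℝ) * (k + 1) ≤ 2 ^ b := by simpa using hb
  have h2 : b * (k + 1) ≤ 2 ^ b := by exact_mod_cast this
  nlinarith

theorem accepts_iff_errs_le {L : Learner} {e k M θ b m : ℕ} {c : Prog} {p : Polynomial ℕ}
    (hacc : ∀ i, (learnerParams L e k M θ).Good i →
      (OutputsWithin c [unary (2 ^ i.b), i.gr, i.yy, i.co] (p.eval (2 ^ i.b)) [true] ↔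
        (learnerParams L e k M θ).errs i M ≤ θ))
    (hkn : k * b ≤ (2 ^ b) ^ e) (hm : L.examples.eval ((2 ^ b) ^ e + 10) + M ≤ m)
    (G : Hypergraph (2 ^ b) m k) (y : Fin m → Bool)
    (r : Fin ((learnerParams L e k M θ).cP.eval (2 ^ b)) → Bool) :
    Distinguisher.Accepts ⟨c, (learnerParams L e k M θ).cP, p⟩ G y r ↔
      (learnerParams L e k M θ).errs (distInst G y r) M ≤ θ :=
  hacc _ (good_distInst rfl hkn hm (learnerParams_cP _).symm G y r)

/-- A class that contains the functions `concept` is not weakly learnable. -/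
theorem not_weaklyLearns (hPRG : LocalPRGAssumption) {C : ∀ n : ℕ, Set ((Fin n → Bool) → Bool)}
    {e : ℕ} (he : e ≠ 0) {γ : ℝ} (hγ : 0 < γ)
    (hC : ∀ (k : ℕ) (P : (Fin k → Bool) → Bool), ∀ᶠ b : ℕ in Filter.atTop,
      ∀ x, concept b P x ((2 ^ b) ^ e) ∈ C ((2 ^ b) ^ e)) :
    ¬ ∃ L : Learner, L.WeaklyLearns γ C := by
  rintro ⟨L, hL⟩
  -- This makes the threshold (1/2 - γ/2) * M nonnegative, as its floor requires.
  wlog hγ2 : γ ≤ 1 / 2 generalizing γ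
  · exact this (γ := 1 / 2) (by norm_num) (hL.mono (not_le.1 hγ2).le) le_rfl
  obtain ⟨M, hM⟩ := exists_nat_ge (80 / γ ^ 2)
  set θ : ℕ := ⌊(1 / 2 - γ / 2) * M⌋₊
  have hθ : (θ : ℝ) ≤ (1 / 2 - γ / 2) * M :=
    Nat.floor_le (mul_nonneg (by linarith) (Nat.cast_nonneg _))
  have hθ' : (1 / 2 - γ / 2) * M ≤ (θ : ℝ) + 1 := (Nat.lt_floor_add_one _).le
  -- The stretch must cover the training and test examples. The assumption is used with s + 2, which
  -- exceeds 1 even for s = 0.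
  obtain ⟨s, hs⟩ := eventually_eval_le_pow (L.examples.comp (.X ^ e + 10) + .C M)
  obtain ⟨k, P, hP⟩ := hPRG ((s + 2 : ℕ) : ℝ) (by push_cast; linarith [Nat.cast_nonneg (α := ℝ) s])
  obtain ⟨c, p, hhalt, hacc⟩ := (learnerParams L e k M θ).exists_prog
  have hA := hP ⟨c, (learnerParams L e k M θ).cP, p⟩ fun n G y r => hhalt _ _ _ _
  have hlim : Filter.Tendsto (fun b : ℕ => (M : ℝ) * ((k : ℝ) ^ 2 / 2 ^ b)) Filter.atTop
      (nhds ((M : ℝ) * 0)) :=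
    (tendsto_const_nhds.div_atTop
      (tendsto_pow_atTop_atTop_of_one_lt (one_lt_two (α := ℝ)))).const_mul _
  rw [mul_zero] at hlim
  -- One b suffices for the contradiction: the pseudorandomness bound holds for all large numbers of
  -- vertices, in particular for some large power of two.
  obtain ⟨b, h1, h2, h3, h4, h5, h6, h7⟩ := ((tendsto_two_pow.eventually hA).and
    ((tendsto_two_pow.eventually hs).and ((hC k P).and ((eventually_mul_le_two_pow k).and
      ((Filter.eventually_gt_atTop 0).and ((tendsto_two_pow.eventually_ge_atTop k).and
        (hlim.eventually_le_const (show (0 : ℝ) < 1 / 20 by norm_num)))))))).exists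
  have hkn : k * b ≤ (2 ^ b) ^ e := h4.trans (Nat.le_self_pow he _)
  have hm : L.examples.eval ((2 ^ b) ^ e + 10) + M ≤ ⌊((2 ^ b : ℕ) : ℝ) ^ ((s + 2 : ℕ) : ℝ)⌋₊ := by
    rw [Real.rpow_natCast, ← Nat.cast_pow, Nat.floor_natCast]
    have : L.examples.eval ((2 ^ b) ^ e + 10) + M ≤ (2 ^ b) ^ s := by simpa using h2
    exact this.trans (Nat.pow_le_pow_right (by positivity) (by omega))
  beta_reduce at h1
  generalize ⌊((2 ^ b : ℕ) : ℝ) ^ ((s + 2 : ℕ) : ℝ)⌋₊ = m at h1 hm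
  have hne : Nonempty (Fin k ↪ Fin (2 ^ b)) := ⟨Fin.castLEEmb h6⟩
  have hps := prob_pseudo_le h5 rfl hkn h6 rfl hm rfl
    (learnerParams_cP (L := L) (k := k) (θ := θ) (2 ^ b)).symm P hγ hM hθ' hL h3
  have hrd := prob_random_le (θ := θ) (L := L) h5 rfl hkn h6 rfl hm
    (learnerParams_cP (L := L) (k := k) (θ := θ) (2 ^ b)).symm hγ hM hθ
  have e1 : Distinguisher.probRandom ⟨c, (learnerParams L e k M θ).cP, p⟩ k (2 ^ b) m ≤ 1 / 10 := by
    refine ((prob_mono fun ω hω => ?_).trans hrd).trans (by linarith)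
    exact (accepts_iff_errs_le hacc hkn hm _ _ _).1 hω
  have e2 : 17 / 20 ≤
      Distinguisher.probPseudo ⟨c, (learnerParams L e k M θ).cP, p⟩ P (2 ^ b) m := by
    have h := prob_not fun ω : Hypergraph (2 ^ b) m k × (Fin (2 ^ b) → Bool) ×
        (Fin ((learnerParams L e k M θ).cP.eval (2 ^ b)) → Bool) =>
      θ < (learnerParams L e k M θ).errs (distInst ω.1 (goldreich P ω.1 ω.2.1) ω.2.2) M
    refine le_trans ?_ (prob_mono fun ω hω =>
      (accepts_iff_errs_le hacc hkn hm _ _ _).2 (not_lt.1 hω))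
    rw [h]; linarith
  -- 17/20 - 1/10 = 3/4 exceeds the permitted advantage 1/3.
  have := (abs_le.1 h1).2
  linarith

end PACRE

namespace PACRE

/-! ### Regular expressions for the concepts -/

/-- The expression of a single word. -/
def wordRE : List Bool → RegularExpression Bool
  | [] => .epsilon
  | a :: l => .comp (.char a) (wordRE l)

/-- The union of a list of expressions. -/
def unionRE {α : Type} (f : α → RegularExpression Bool) : List α → RegularExpression Bool
  | [] => .zero
  | a :: l => .plus (f a) (unionRE f l)

theorem mem_matches'_wordRE : ∀ l z : List Bool, z ∈ (wordRE l).matches' ↔ z = l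
  | [], _ => Iff.rfl
  | a :: l, z => by
    simp only [wordRE, RegularExpression.matches', Language.mem_mul, mem_matches'_wordRE l]
    constructor
    · rintro ⟨_, rfl, _, rfl, rfl⟩
      rfl
    · rintro rfl
      exact ⟨[a], rfl, l, rfl, rfl⟩

theorem mem_matches'_unionRE {α : Type} (f : α → RegularExpression Bool) (z : List Bool) :
    ∀ l : List α, z ∈ (unionRE f l).matches' ↔ ∃ a ∈ l, z ∈ (f a).matches'
  | [] => by simp [unionRE, RegularExpression.matches']
  | a :: l => by
    simp [unionRE, RegularExpression.matches', Language.mem_add, mem_matches'_unionRE f z l]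

theorem reSize_wordRE : ∀ l : List Bool, reSize (wordRE l) = l.length + 1
  | [] => rfl
  | a :: l => by rw [wordRE, reSize, reSize_wordRE l, reSize, List.length_cons]; ring

theorem reSize_unionRE_le {α : Type} (f : α → RegularExpression Bool) {B : ℕ}
    (hf : ∀ a, reSize (f a) ≤ B) : ∀ l : List α, reSize (unionRE f l) ≤ l.length * (B + 1) + 1
  | [] => by simp [unionRE, reSize]
  | a :: l => by
    have h1 := hf a
    have h2 := reSize_unionRE_le f hf l
    rw [unionRE, reSize, List.length_cons, Nat.succ_mul]; omega

theorem starFree_wordRE : ∀ l : List Bool, REStarFree (wordRE l)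
  | [] => trivial
  | _ :: l => ⟨trivial, starFree_wordRE l⟩

theorem starFree_unionRE {α : Type} (f : α → RegularExpression Bool)
    (hf : ∀ a, REStarFree (f a)) : ∀ l : List α, REStarFree (unionRE f l)
  | [] => trivial
  | a :: l => ⟨hf a, starFree_unionRE f hf l⟩

section
variable {b k n : ℕ}

/-- The binary representations of the vertices in `S`. -/
def vertexRE (b : ℕ) (S : Fin (2 ^ b) → Bool) : RegularExpression Bool :=
  unionRE (fun v : Fin (2 ^ b) => wordRE (binary b v)) ((List.finRange (2 ^ b)).filter S)

/-- The descriptions of the tuples in `S 0 × S 1 × …`. -/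
def boxRE (b : ℕ) : (k : ℕ) → (Fin k → Fin (2 ^ b) → Bool) → RegularExpression Bool
  | 0, _ => .epsilon
  | k + 1, S => .comp (vertexRE b (S 0)) (boxRE b k fun i => S i.succ)

/-- The description of a tuple of vertices. -/
def tupleWord (v : Fin k → Fin (2 ^ b)) : List Bool := (List.ofFn fun i => binary b (v i)).flatten

theorem length_tupleWord (v : Fin k → Fin (2 ^ b)) : (tupleWord v).length = k * b := by
  simp [tupleWord, binary, Function.comp_def]

theorem tupleWord_succ (v : Fin (k + 1) → Fin (2 ^ b)) :
    tupleWord v = binary b (v 0) ++ tupleWord fun i => v i.succ := by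
  simp [tupleWord]

/-- All vertices are written with the same number b of bits, so concatenations decode uniquely. -/
theorem tupleWord_injective : ∀ {k : ℕ}, Function.Injective (tupleWord (b := b) (k := k))
  | 0, u, v, _ => Subsingleton.elim u v
  | k + 1, u, v, h => by
    rw [tupleWord_succ, tupleWord_succ] at h
    obtain ⟨h1, h2⟩ := List.append_inj h (by simp [binary])
    funext i
    refine Fin.cases (binary_injective h1) (fun i => ?_) i
    exact congrFun (tupleWord_injective h2) i

theorem mem_vertexRE (S : Fin (2 ^ b) → Bool) (z : List Bool) :
    z ∈ (vertexRE b S).matches' ↔ ∃ v, S v = true ∧ z = binary b v := by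
  simp only [vertexRE, mem_matches'_unionRE, mem_matches'_wordRE, List.mem_filter, List.mem_finRange,
    true_and]

theorem mem_boxRE : ∀ {k : ℕ} (S : Fin k → Fin (2 ^ b) → Bool) (z : List Bool),
    z ∈ (boxRE b k S).matches' ↔ ∃ v : Fin k → Fin (2 ^ b), (∀ i, S i (v i) = true) ∧ z = tupleWord v
  | 0, S, z => by
    simp [boxRE, RegularExpression.matches', tupleWord, Language.mem_one]
  | k + 1, S, z => by
    simp only [boxRE, RegularExpression.matches', Language.mem_mul, mem_vertexRE, mem_boxRE]
    constructor
    · rintro ⟨_, ⟨v, hv, rfl⟩, _, ⟨w, hw, rfl⟩, rfl⟩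
      refine ⟨Fin.cons v w, fun i => Fin.cases hv hw i, ?_⟩
      rw [tupleWord_succ]; rfl
    · rintro ⟨v, hv, rfl⟩
      exact ⟨_, ⟨v 0, hv 0, rfl⟩, _, ⟨fun i => v i.succ, fun i => hv _, rfl⟩, (tupleWord_succ v).symm⟩

theorem starFree_boxRE : ∀ {k : ℕ} (S : Fin k → Fin (2 ^ b) → Bool), REStarFree (boxRE b k S)
  | 0, _ => trivial
  | _ + 1, _ => ⟨starFree_unionRE _ (fun _ => starFree_wordRE _) _, starFree_boxRE _⟩

theorem reSize_vertexRE_le (S : Fin (2 ^ b) → Bool) : reSize (vertexRE b S) ≤ 4 * (2 ^ b) ^ 2 := by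
  have h1 : reSize (vertexRE b S) ≤ _ := reSize_unionRE_le
    (fun v : Fin (2 ^ b) => wordRE (binary b v)) (B := b + 1)
    (fun v => by simp [reSize_wordRE, binary]) ((List.finRange (2 ^ b)).filter S)
  have h2 : ((List.finRange (2 ^ b)).filter S).length ≤ 2 ^ b := by
    simpa using List.length_filter_le S (List.finRange (2 ^ b))
  have h3 : b < 2 ^ b := Nat.lt_two_pow_self
  nlinarith

theorem reSize_boxRE_le : ∀ {k : ℕ} (S : Fin k → Fin (2 ^ b) → Bool),
    reSize (boxRE b k S) ≤ k * (4 * (2 ^ b) ^ 2) + 1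
  | 0, _ => by simp [boxRE, reSize]
  | k + 1, S => by
    have h1 := reSize_vertexRE_le (S 0)
    have h2 := reSize_boxRE_le fun i => S i.succ
    rw [boxRE, reSize, Nat.succ_mul]; omega

/-- Boxes whose union is the set of tuples accepted by `concept`. -/
noncomputable def conceptBoxes (P : (Fin k → Bool) → Bool) (x : Fin (2 ^ b) → Bool) :
    List (Fin k → Fin (2 ^ b) → Bool) :=
  ((Finset.univ.filter fun α => P α = true).toList.map fun α i v => x v == α i) ++
    ((Finset.univ : Finset ((Fin k × Fin k) × Fin (2 ^ b))).filter fun t => t.1.1 ≠ t.1.2).toList.map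
      fun t l u => !(l == t.1.1 || l == t.1.2) || u == t.2

/-- A box of the first kind prescribes by α the label of each entry; it need not exclude
repetitions, as the concept is true on them. A box of the second kind prescribes one vertex at two
different positions and leaves the other entries free. -/
theorem exists_mem_conceptBoxes (P : (Fin k → Bool) → Bool) (x : Fin (2 ^ b) → Bool)
    (z : Fin n → Bool) :
    (∃ S ∈ conceptBoxes P x, ∀ i, S i (bitTuple b k z i) = true) ↔ concept b P x n z = true := by
  simp only [conceptBoxes, List.mem_append, List.mem_map, Finset.mem_toList, Finset.mem_filter,
    Finset.mem_univ, true_and, concept]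
  generalize bitTuple b k z = v
  constructor
  · rintro ⟨S, ⟨α, hα, rfl⟩ | ⟨t, ht, rfl⟩, h⟩
    · split_ifs
      · rw [← hα]; congr 1; funext i; simpa using h i
      · rfl
    · rw [if_neg]
      intro hv
      have h1 := h t.1.1
      have h2 := h t.1.2
      simp only [beq_self_eq_true, Bool.true_or, Bool.or_true, Bool.not_true, Bool.false_or,
        beq_iff_eq] at h1 h2
      exact ht (hv (h1.trans h2.symm))
  · intro h
    by_cases hv : Function.Injective v
    · rw [if_pos hv] at h
      exact ⟨_, .inl ⟨_, h, rfl⟩, fun i => by simp⟩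
    · simp only [Function.Injective, not_forall] at hv
      obtain ⟨i, j, h1, h2⟩ := hv
      refine ⟨_, .inr ⟨((i, j), v i), h2, rfl⟩, fun l => ?_⟩
      by_cases hi : l = i
      · simp [hi]
      · by_cases hj : l = j
        · simp [hj, h1]
        · simp [hi, hj]

theorem length_conceptBoxes_le (P : (Fin k → Bool) → Bool) (x : Fin (2 ^ b) → Bool) :
    (conceptBoxes P x).length ≤ 2 ^ k + k * k * 2 ^ b := by
  simp only [conceptBoxes, List.length_append, List.length_map, Finset.length_toList]
  exact Nat.add_le_add ((Finset.card_filter_le _ _).trans (by simp))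
    ((Finset.card_filter_le _ _).trans (by simp))

/-- The expression of the set of descriptions of tuples accepted by `concept`. -/
noncomputable def conceptRE (P : (Fin k → Bool) → Bool) (x : Fin (2 ^ b) → Bool) :
    RegularExpression Bool := unionRE (boxRE b k) (conceptBoxes P x)

theorem starFree_conceptRE (P : (Fin k → Bool) → Bool) (x : Fin (2 ^ b) → Bool) :
    REStarFree (conceptRE P x) := starFree_unionRE _ (fun _ => starFree_boxRE _) _

/-- With N = 2 ^ b there are O(N) boxes of size O(N ^ 2), with constants depending only on k; one
more factor N absorbs the constants. -/
theorem eventually_reSize_conceptRE_le (P : (Fin k → Bool) → Bool) :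
    ∀ᶠ b : ℕ in Filter.atTop, ∀ x : Fin (2 ^ b) → Bool, reSize (conceptRE P x) ≤ (2 ^ b) ^ 4 := by
  filter_upwards [tendsto_two_pow.eventually_ge_atTop ((2 ^ k + k * k) * (4 * k + 2) + 1)] with b hb x
  have h1 : reSize (conceptRE P x) ≤ _ :=
    reSize_unionRE_le (boxRE b k) reSize_boxRE_le (conceptBoxes P x)
  have h2 := length_conceptBoxes_le P x
  have hN : 1 ≤ 2 ^ b := Nat.one_le_two_pow
  generalize reSize (conceptRE P x) = r at *
  generalize (conceptBoxes P x).length = c at *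
  clear x
  generalize 2 ^ b = N at *
  have h3 : 2 ^ k + k * k * N ≤ (2 ^ k + k * k) * N := by
    rw [add_mul]; exact Nat.add_le_add_right (Nat.le_mul_of_pos_right _ hN) _
  have hN2 : 1 ≤ N ^ 2 := Nat.one_le_pow _ _ hN
  have h4 : k * (4 * N ^ 2) + 1 + 1 ≤ (4 * k + 2) * N ^ 2 := by nlinarith
  calc _ ≤ _ := h1
    _ ≤ (2 ^ k + k * k) * N * ((4 * k + 2) * N ^ 2) + 1 :=
      Nat.add_le_add_right (Nat.mul_le_mul (h2.trans h3) h4) 1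
    _ ≤ (2 ^ k + k * k) * N * ((4 * k + 2) * N ^ 2) + N ^ 3 :=
      Nat.add_le_add_left (Nat.one_le_pow _ _ hN) _
    _ = ((2 ^ k + k * k) * (4 * k + 2) + 1) * N ^ 3 := by ring
    _ ≤ N * N ^ 3 := Nat.mul_le_mul_right _ hb
    _ = N ^ 4 := by ring

/-- The expression, followed by a language that contains all words of the remaining length,
represents the concept. -/
theorem represents_concept (h : k * b ≤ n) (P : (Fin k → Bool) → Bool) (x : Fin (2 ^ b) → Bool)
    {W : Language Bool} (hW : ∀ l : List Bool, l.length = n - k * b → l ∈ W) :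
    Represents ((conceptRE P x).matches' * W) (concept b P x n) := by
  intro z
  have hz : (List.ofFn z).take (k * b) = tupleWord (bitTuple b k z) := take_ofFn_eq h z
  rw [← exists_mem_conceptBoxes, Language.mem_mul]
  simp only [conceptRE, mem_matches'_unionRE, mem_boxRE]
  constructor
  -- Words of a box have length k * b, so the only possible factorisation splits off the tuple part
  -- of z; what W contains beyond the required words is irrelevant.
  · rintro ⟨_, ⟨S, hS, v, hv, rfl⟩, c, -, hc⟩
    rw [← hc, ← length_tupleWord v, List.take_left] at hz
    rw [← tupleWord_injective hz]
    exact ⟨S, hS, hv⟩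
  · rintro ⟨S, hS, hv⟩
    exact ⟨_, ⟨S, hS, _, hv, rfl⟩, (List.ofFn z).drop (k * b), hW _ (by simp), by
      rw [← hz, List.take_append_drop]⟩

end

/-! ### Wildcards -/

/-- A single wildcard. -/
def anyRE : RegularExpression Bool := .plus (.char false) (.char true)

/-- A sequence of wildcards. -/
def wildRE : ℕ → RegularExpression Bool
  | 0 => .epsilon
  | m + 1 => .comp anyRE (wildRE m)

theorem mem_anyRE (a : Bool) : [a] ∈ anyRE.matches' := by
  cases a
  · exact .inl rfl
  · exact .inr rfl

theorem mem_pow_of_length {A : Language Bool} (hA : ∀ a, [a] ∈ A) :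
    ∀ {m : ℕ} (l : List Bool), l.length = m → l ∈ A ^ m
  | 0, l, h => by rw [List.length_eq_zero_iff.1 h, pow_zero]; exact Language.nil_mem_one
  | m + 1, [], h => by simp at h
  | m + 1, a :: l, h => by
    rw [pow_succ', Language.mem_mul]
    exact ⟨[a], hA a, l, mem_pow_of_length hA l (by simpa using h), rfl⟩

theorem matches'_wildRE : ∀ m : ℕ, (wildRE m).matches' = anyRE.matches' ^ m
  | 0 => rfl
  | m + 1 => by rw [wildRE, RegularExpression.matches', matches'_wildRE m, pow_succ']

theorem reSize_wildRE : ∀ m : ℕ, reSize (wildRE m) = 3 * m + 1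
  | 0 => rfl
  | m + 1 => by rw [wildRE, reSize, reSize_wildRE m]; simp [anyRE, reSize]; ring

theorem starFree_wildRE : ∀ m : ℕ, REStarFree (wildRE m)
  | 0 => trivial
  | m + 1 => ⟨⟨trivial, trivial⟩, starFree_wildRE m⟩

/-- A plain expression as an expression with counting. -/
def toCountRE : RegularExpression Bool → CountRE
  | .zero => .zero
  | .epsilon => .epsilon
  | .char a => .char a
  | .plus R₁ R₂ => .plus (toCountRE R₁) (toCountRE R₂)
  | .comp R₁ R₂ => .comp (toCountRE R₁) (toCountRE R₂)
  | .star R => .star (toCountRE R)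

theorem lang_toCountRE : ∀ R : RegularExpression Bool, (toCountRE R).lang = R.matches'
  | .zero => rfl
  | .epsilon => rfl
  | .char _ => rfl
  | .plus R₁ R₂ => by
    rw [toCountRE, CountRE.lang, lang_toCountRE R₁, lang_toCountRE R₂]; rfl
  | .comp R₁ R₂ => by
    rw [toCountRE, CountRE.lang, lang_toCountRE R₁, lang_toCountRE R₂]; rfl
  | .star R => by rw [toCountRE, CountRE.lang, lang_toCountRE R]; rfl

theorem size_toCountRE : ∀ R : RegularExpression Bool, (toCountRE R).size = reSize R
  | .zero => rfl
  | .epsilon => rfl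
  | .char _ => rfl
  | .plus R₁ R₂ => by rw [toCountRE, CountRE.size, size_toCountRE R₁, size_toCountRE R₂, reSize]
  | .comp R₁ R₂ => by rw [toCountRE, CountRE.size, size_toCountRE R₁, size_toCountRE R₂, reSize]
  | .star R => by rw [toCountRE, CountRE.size, size_toCountRE R, reSize]

theorem starFree_toCountRE : ∀ R : RegularExpression Bool, REStarFree R → (toCountRE R).StarFree
  | .zero, _ => trivial
  | .epsilon, _ => trivial
  | .char _, _ => trivial
  | .plus R₁ R₂, h => ⟨starFree_toCountRE R₁ h.1, starFree_toCountRE R₂ h.2⟩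
  | .comp R₁ R₂, h => ⟨starFree_toCountRE R₁ h.1, starFree_toCountRE R₂ h.2⟩
  | .star _, h => h.elim

/-! ### The three classes -/

/-- The reason for padding to length n = N ^ e: for e ≥ 5 / ε the budget n ^ ε leaves room for N ^
5. -/
theorem pow_five_le_rpow {N e : ℕ} {ε : ℝ} (hN : 1 ≤ N) (he : 5 ≤ e * ε) :
    ((N ^ 5 : ℕ) : ℝ) ≤ ((N ^ e : ℕ) : ℝ) ^ ε := by
  rw [Nat.cast_pow, Nat.cast_pow, ← Real.rpow_natCast, ← Real.rpow_natCast,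
    ← Real.rpow_mul (Nat.cast_nonneg _)]
  exact Real.rpow_le_rpow_of_exponent_le (by exact_mod_cast hN) (by exact_mod_cast he)

theorem eventually_concept_mem_plainClass {ε : ℝ} {e : ℕ} (he0 : e ≠ 0) (he : 5 ≤ e * ε) (k : ℕ)
    (P : (Fin k → Bool) → Bool) : ∀ᶠ b : ℕ in Filter.atTop,
      ∀ x, concept b P x ((2 ^ b) ^ e) ∈ plainClass (fun n => (n : ℝ) ^ ε) ((2 ^ b) ^ e) := by
  filter_upwards [eventually_reSize_conceptRE_le P, eventually_mul_le_two_pow k,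
    tendsto_two_pow.eventually_ge_atTop 5] with b h1 h2 h3 x
  -- The starred wildcard has size 4, and N ^ 4 + 4 ≤ N ^ 5 as soon as N ≥ 5.
  refine ⟨.comp (conceptRE P x) (.star anyRE), ?_, ?_⟩
  · refine le_trans (Nat.cast_le.2 ?_) (pow_five_le_rpow Nat.one_le_two_pow he)
    have h4 := h1 x
    have h5 : 1 ≤ (2 ^ b) ^ 4 := Nat.one_le_pow _ _ (by positivity)
    simp only [reSize, anyRE, pow_succ _ 4]
    nlinarith
  · refine represents_concept (h2.trans (Nat.le_self_pow he0 _)) P x fun l _ => ?_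
    rw [RegularExpression.matches', Language.kstar_eq_iSup_pow, Language.mem_iSup]
    exact ⟨_, mem_pow_of_length mem_anyRE l rfl⟩

theorem eventually_concept_mem_starFreeClass (k : ℕ)
    (P : (Fin k → Bool) → Bool) : ∀ᶠ b : ℕ in Filter.atTop,
      ∀ x, concept b P x ((2 ^ b) ^ 5) ∈ starFreeClass (fun n => 5 * (n : ℝ)) ((2 ^ b) ^ 5) := by
  filter_upwards [eventually_reSize_conceptRE_le P, eventually_mul_le_two_pow k,
    tendsto_two_pow.eventually_ge_atTop 5] with b h1 h2 h3 x
  refine ⟨.comp (conceptRE P x) (wildRE ((2 ^ b) ^ 5 - k * b)),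
    ⟨starFree_conceptRE P x, starFree_wildRE _⟩, ?_, ?_⟩
  · beta_reduce
    -- With n = N ^ 5, at most N ^ 4 ≤ n is spent on the tuples and at most 3 * n + 1 on the
    -- wildcards, so 5 * n suffices.
    rw [show (5 : ℝ) * (((2 ^ b) ^ 5 : ℕ) : ℝ) = ((5 * (2 ^ b) ^ 5 : ℕ) : ℝ) by push_cast; rfl,
      Nat.cast_le, reSize, reSize_wildRE]
    have h4 := h1 x
    have h5 : 1 ≤ (2 ^ b) ^ 5 := Nat.one_le_pow _ _ (by positivity)
    have h6 : (2 ^ b) ^ 4 ≤ (2 ^ b) ^ 5 := Nat.pow_le_pow_right (by positivity) (by norm_num)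
    omega
  · refine represents_concept (h2.trans (Nat.le_self_pow (by norm_num) _)) P x fun l hl => ?_
    rw [matches'_wildRE]
    exact mem_pow_of_length mem_anyRE l hl

theorem eventually_concept_mem_starFreeCountClass {ε : ℝ} {e : ℕ} (he0 : e ≠ 0) (he : 5 ≤ e * ε)
    (k : ℕ) (P : (Fin k → Bool) → Bool) : ∀ᶠ b : ℕ in Filter.atTop,
      ∀ x, concept b P x ((2 ^ b) ^ e) ∈ starFreeCountClass (fun n => (n : ℝ) ^ ε) ((2 ^ b) ^ e) := by
  filter_upwards [eventually_reSize_conceptRE_le P, eventually_mul_le_two_pow k,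
    tendsto_two_pow.eventually_ge_atTop (e + 4)] with b h1 h2 h3 x
  refine ⟨.comp (toCountRE (conceptRE P x)) (.count (toCountRE anyRE) ((2 ^ b) ^ e - k * b)),
    ⟨starFree_toCountRE _ (starFree_conceptRE P x), ⟨trivial, trivial⟩⟩, ?_, ?_⟩
  · refine le_trans (Nat.cast_le.2 ?_) (pow_five_le_rpow Nat.one_le_two_pow he)
    have h4 := h1 x
    -- The exponent costs at most b * e, so the total is at most N ^ 4 + 3 + b * e ≤ (e + 4) * N ^
    -- 4, whence the requirement N ≥ e + 4.
    have h5 : Nat.clog 2 ((2 ^ b) ^ e - k * b) ≤ b * e := by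
      refine (Nat.clog_mono_right 2 (Nat.sub_le _ _)).trans ?_
      rw [← pow_mul, Nat.clog_pow 2 _ (by norm_num)]
    have h6 : b < 2 ^ b := Nat.lt_two_pow_self
    simp only [CountRE.size, size_toCountRE, anyRE, reSize]
    clear h1
    generalize reSize (conceptRE P x) = r at *
    clear x
    generalize Nat.clog 2 ((2 ^ b) ^ e - k * b) = c at *
    generalize 2 ^ b = N at *
    have h7 : N ≤ N ^ 4 := Nat.le_self_pow (by norm_num) _
    have h8 : b * e ≤ N ^ 4 * e := Nat.mul_le_mul_right _ (by omega)
    have h9 : (e + 4) * N ^ 4 ≤ N * N ^ 4 := Nat.mul_le_mul_right _ h3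
    have h10 : N * N ^ 4 = N ^ 5 := by ring
    nlinarith
  · rw [CountRE.lang, CountRE.lang, lang_toCountRE, lang_toCountRE]
    exact represents_concept (h2.trans (Nat.le_self_pow he0 _)) P x fun l hl =>
      mem_pow_of_length mem_anyRE l hl

theorem exists_five_le_mul {ε : ℝ} (hε : 0 < ε) : ∃ e : ℕ, e ≠ 0 ∧ 5 ≤ e * ε := by
  obtain ⟨e, he⟩ := exists_nat_ge (5 / ε)
  refine ⟨e + 1, by omega, ?_⟩
  rw [div_le_iff₀ hε] at he
  push_cast; nlinarith

end PACRE

theorem mainTheorem1 (hPRG : PACRE.LocalPRGAssumption) :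
    (∀ ε γ : ℝ, 0 < ε → 0 < γ →
      ¬ ∃ L : PACRE.Learner, L.WeaklyLearns γ (PACRE.plainClass fun n => (n : ℝ) ^ ε)) ∧
    (∃ K : ℝ, 0 < K ∧ ∀ γ : ℝ, 0 < γ →
      ¬ ∃ L : PACRE.Learner, L.WeaklyLearns γ (PACRE.starFreeClass fun n => K * (n : ℝ))) ∧
    (∀ ε γ : ℝ, 0 < ε → 0 < γ →
      ¬ ∃ L : PACRE.Learner, L.WeaklyLearns γ (PACRE.starFreeCountClass fun n => (n : ℝ) ^ ε)) := by
  refine ⟨fun ε γ hε hγ => ?_, ⟨5, by norm_num, fun γ hγ => ?_⟩, fun ε γ hε hγ => ?_⟩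
  · obtain ⟨e, he0, he⟩ := PACRE.exists_five_le_mul hε
    exact PACRE.not_weaklyLearns hPRG he0 hγ (PACRE.eventually_concept_mem_plainClass he0 he)
  · exact PACRE.not_weaklyLearns hPRG (by norm_num) hγ PACRE.eventually_concept_mem_starFreeClass
  · obtain ⟨e, he0, he⟩ := PACRE.exists_five_le_mul hε
    exact PACRE.not_weaklyLearns hPRG he0 hγ (PACRE.eventually_concept_mem_starFreeCountClass he0 he)
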